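/- Setting. Let $X,Y$ be (discrete) metric spaces with bounded geometry and let $p:X\to Y$ be uniformly expansive (for each $r>0$ there is $s>0$ such that $d(x,x')<r$ implies $d(p(x),p(x'))<s$) and such that for each $R>0$ the family of subspaces $\{p^{-1}(B_Y(y,R))\}_{y\in Y}$ of $X$ has equi-property A: for all $R',\varepsilon>0$ there are $S>0$ and maps $\xi^{(y)}:X_y\to\ell^2(X_y)$, $X_y=p^{-1}(B_Y(y,R))$, with $\xi^{(y)}_x(x')\in[0,1]$, $\|\xi^{(y)}_x\|=1$, $\operatorname{supp}\xi^{(y)}_x\subseteq B(x,S)$ and $\sup\{\|\xi^{(y)}_x-\xi^{(y)}_{x'}\|: x,x'\in X_y,\ d(x,x')\le R'\}<\varepsilon$, uniformly in $y$. Let $H$ be a real Hilbert space and $f:Y\to H$ a coarse embedding. Coefficients. For a finite-dimensional subspace $W\subset H$ let $\mathcal A(W)=C_0(\mathbb R)\,\widehat\otimes\, C_0(W,\mathrm{Cliff}(W))$ (graded tensor product; $\mathrm{Cliff}(W)$ is the complexified Clifford algebra with $v^2=\|v\|^2$, $v^*=v$, and $C_0(\mathbb R)$ is graded by even and odd functions);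 its elements are regarded as functions $\mathbb R\times W\to\mathrm{Cliff}(W)$. For $W\subset W'$ let $\beta:\mathcal A(W)\to\mathcal A(W')$ be given by $\beta(g\widehat\otimes h)=g(\mathsf x\widehat\otimes1+1\widehat\otimes C)(1\widehat\otimes\tilde h)$, where $\mathsf x$ is the multiplication by the coordinate on $\mathbb R$, $C(v)=v-v_W\in\mathrm{Cliff}(W')$, $\tilde h(v)=h(v_W)$ and $v_W$ is the orthogonal projection of $v$ to $W$. Put $W_n(y)=\mathrm{span}\{f(y'):d(y,y')\le n^2\}$, $V=\bigcup_nW_n(y)$ and $\mathcal A(V)=\varinjlim_{W\subset V}\mathcal A(W)$. The space $\mathbb R_+\times H$ carries the topology in which $(t_i,v_i)\to(t,v)$ iff $t_i^2+\|v_i\|^2\to t^2+\|v\|^2$ and $\langle v_i,u\rangle\to\langle v,u\rangle$ for all $u\in H$; the support of $a\in\mathcal A(V)$ is the complement of the set of all points at which some $g\in C_0(\mathbb R_+\times H)$ with $g\cdot a=0$ does not vanish. Let $B(v,r)=\{(t,h)\in\mathbb R_+\times H:t^2+\|h-v\|^2<r^2\}$. Algebras. $\mathbb C_u[X,\mathcal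 A]$ is the $*$-algebra of all matrices $T:X\times X\to\mathcal A(V)$ for which (1) there are $N\in\mathbb N$ and $c>0$ such that each $T(x,y)$ is the image in $\mathcal A(V)$ of some $T_1(x,y)\in\mathcal A(W_N(p(x)))$ whose directional derivatives $D_ZT_1(x,y)$ exist, lie in $\mathcal A(W_N(p(x)))$ and have norm at most $c$, for all $Z\in\mathbb R\times W_N(p(x))$ with $\|Z\|\le1$; (2) $\sup_{x,y}\|T(x,y)\|<\infty$; (3) there is $r_1>0$ such that $T(x,y)=0$ whenever $d(x,y)>r_1$; (4) there is $r_2>0$ such that $\operatorname{supp}T(x,y)\subseteq B(f(p(x)),r_2)$ for all $x,y$. Let $E$ be the Hilbert $\mathcal A(V)$-module of all $\sum_{x\in X}a_x[x]$ with $a_x\in\mathcal A(V)$ and $\sum_xa_x^*a_x$ norm convergent. Let $C^*_u(X,\mathcal A)$ be the closure of $\mathbb C_u[X,\mathcal A]$, acting on $E$ by matrix multiplication, in the $C^*$-algebra $\mathcal B(E)$ of adjointable operators, and let $C^*_{u,max}(X,\mathcal A)$ be its completion in the norm $\|T\|_{max}=\sup_\phi\|\phi(T)\|$, where $\phi$ ranges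 over the $*$-representations of $\mathbb C_u[X,\mathcal A]$ on Hilbert spaces. For $O\subset\mathbb R_+\times H$ open, let $\mathbb C_u[X,\mathcal A]_O$ consist of all $T\in\mathbb C_u[X,\mathcal A]$ with $\operatorname{supp}T(x,y)\subseteq O$ for all $x,y$, and let $C^*_{u,\phi}(X,\mathcal A)_O$ and $C^*_u(X,\mathcal A)_O$ be its closures in $C^*_{u,max}(X,\mathcal A)$ and in $C^*_u(X,\mathcal A)$. Proposition. These objects are well defined ($\|T\|_{max}<\infty$ and $T$ acts by an adjointable operator on $E$, for every $T\in\mathbb C_u[X,\mathcal A]$), and there is a unique $*$-homomorphism $\lambda:C^*_{u,max}(X,\mathcal A)\to C^*_u(X,\mathcal A)$ that is the identity on $\mathbb C_u[X,\mathcal A]$ (the canonical quotient map). Let $r>0$ and let $\{O_{r,i}\}_{i\in J}$ be an $r$-separate family of open subsets of $\mathbb R_+\times H$, i.e. the $O_{r,i}$ are pairwise disjoint and for each $i\in J$ there is $x_i\in X$ with $O_{r,i}\subseteq B(f(p(x_i)),r)$. Let $O_r=\bigsqcup_{i\in J}O_{r,i}$. Then $\lambda$ restricts to an isomorphism $$\lambda: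 C^*_{u,\phi}(X,\mathcal A)_{O_r}\to C^*_u(X,\mathcal A)_{O_r}.$$ -/

import Mathlib

open scoped ENNReal NNReal Topology
open Filter

noncomputable section

/-! ### Matrices -/

/-- `X`-by-`X` matrices over `A` all of whose rows and columns are finitely supported. -/
@[ext]
structure BandMatrix (X A : Type*) [Zero A] where
  entry : X → X → A
  row_finite : ∀ x, {y | entry x y ≠ 0}.Finite
  col_finite : ∀ y, {x | entry x y ≠ 0}.Finite

namespace BandMatrix

variable {X A : Type*}

instance [Zero A] : Zero (BandMatrix X A) :=
  ⟨⟨fun _ _ => 0, fun _ => by simp, fun _ => by simp⟩⟩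

@[simp] theorem zero_entry [Zero A] (x y : X) : (0 : BandMatrix X A).entry x y = 0 := rfl

section
variable [NonUnitalRing A]

instance : Add (BandMatrix X A) :=
  ⟨fun S T => ⟨fun x y => S.entry x y + T.entry x y,
    fun x => ((S.row_finite x).union (T.row_finite x)).subset fun y hy => by
      by_contra h
      simp only [Set.mem_union, Set.mem_ofPred_eq, not_or, not_not] at h hy
      simp [h.1, h.2] at hy,
    fun y => ((S.col_finite y).union (T.col_finite y)).subset fun x hx => by
      by_contra h
      simp only [Set.mem_union, Set.mem_ofPred_eq, not_or, not_not] at h hx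
      simp [h.1, h.2] at hx⟩⟩

instance : Neg (BandMatrix X A) :=
  ⟨fun S => ⟨fun x y => -S.entry x y, fun x => by simpa using S.row_finite x,
    fun y => by simpa using S.col_finite y⟩⟩

/-- The matrix product. -/
instance : Mul (BandMatrix X A) :=
  ⟨fun S T => ⟨fun x y => ∑ᶠ z, S.entry x z * T.entry z y,
    fun x => ((S.row_finite x).biUnion fun z _ => T.row_finite z).subset fun y hy => by
      obtain ⟨z, hz⟩ : ∃ z, S.entry x z * T.entry z y ≠ 0 := by
        by_contra! h
        exact hy (by simp [h])
      simp only [Set.mem_iUnion, Set.mem_ofPred_eq]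
      exact ⟨z, left_ne_zero_of_mul hz, right_ne_zero_of_mul hz⟩,
    fun y => ((T.col_finite y).biUnion fun z _ => S.col_finite z).subset fun x hx => by
      obtain ⟨z, hz⟩ : ∃ z, S.entry x z * T.entry z y ≠ 0 := by
        by_contra! h
        exact hx (by simp [h])
      simp only [Set.mem_iUnion, Set.mem_ofPred_eq]
      exact ⟨z, right_ne_zero_of_mul hz, left_ne_zero_of_mul hz⟩⟩⟩

@[simp] theorem add_entry (S T : BandMatrix X A) (x y : X) :
    (S + T).entry x y = S.entry x y + T.entry x y := rfl

@[simp] theorem neg_entry (S : BandMatrix X A) (x y : X) : (-S).entry x y = -S.entry x y := rfl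

theorem mul_entry (S T : BandMatrix X A) (x y : X) :
    (S * T).entry x y = ∑ᶠ z, S.entry x z * T.entry z y := rfl

theorem mul_entry_eq_sum (S T : BandMatrix X A) (x y : X) (s : Finset X)
    (hs : ∀ z, S.entry x z ≠ 0 → z ∈ s) :
    (S * T).entry x y = ∑ z ∈ s, S.entry x z * T.entry z y :=
  finsum_eq_sum_of_support_subset _ fun z hz => hs z (left_ne_zero_of_mul hz)

theorem mul_entry_eq_sum' (S T : BandMatrix X A) (x y : X) (s : Finset X)
    (hs : ∀ z, T.entry z y ≠ 0 → z ∈ s) :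
    (S * T).entry x y = ∑ z ∈ s, S.entry x z * T.entry z y :=
  finsum_eq_sum_of_support_subset _ fun z hz => hs z (right_ne_zero_of_mul hz)

instance : AddCommGroup (BandMatrix X A) where
  add_assoc _ _ _ := by ext; simp [add_assoc]
  zero_add _ := by ext; simp
  add_zero _ := by ext; simp
  add_comm _ _ := by ext; simp [add_comm]
  neg_add_cancel _ := by ext; simp
  nsmul := nsmulRec
  zsmul := zsmulRec

theorem mul_assoc_aux (S T R : BandMatrix X A) : S * T * R = S * (T * R) := by
  ext x y
  have h1 : ∀ z, S.entry x z ≠ 0 → z ∈ (S.row_finite x).toFinset := fun z hz => by simpa using hz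
  have h2 : ∀ z, R.entry z y ≠ 0 → z ∈ (R.col_finite y).toFinset := fun z hz => by simpa using hz
  rw [mul_entry_eq_sum' _ _ _ _ _ h2, mul_entry_eq_sum _ _ _ _ _ h1]
  simp_rw [fun z => mul_entry_eq_sum S T x z _ h1, fun z => mul_entry_eq_sum' T R z y _ h2,
    Finset.sum_mul, Finset.mul_sum, mul_assoc]
  exact Finset.sum_comm

instance : NonUnitalRing (BandMatrix X A) where
  left_distrib S T R := by
    ext x y
    have h1 : ∀ z, S.entry x z ≠ 0 → z ∈ (S.row_finite x).toFinset := fun z hz => by simpa using hz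
    rw [add_entry, mul_entry_eq_sum _ _ _ _ _ h1, mul_entry_eq_sum _ _ _ _ _ h1,
      mul_entry_eq_sum _ _ _ _ _ h1, ← Finset.sum_add_distrib]
    simp [mul_add]
  right_distrib S T R := by
    ext x y
    have h2 : ∀ z, R.entry z y ≠ 0 → z ∈ (R.col_finite y).toFinset := fun z hz => by simpa using hz
    rw [add_entry, mul_entry_eq_sum' _ _ _ _ _ h2, mul_entry_eq_sum' _ _ _ _ _ h2,
      mul_entry_eq_sum' _ _ _ _ _ h2, ← Finset.sum_add_distrib]
    simp [add_mul]
  zero_mul S := by ext x y; simp [mul_entry]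
  mul_zero S := by ext x y; simp [mul_entry]
  mul_assoc := mul_assoc_aux

/-- The adjoint matrix. -/
instance [StarRing A] : StarRing (BandMatrix X A) where
  star S := ⟨fun x y => star (S.entry y x), fun x => by simpa using S.col_finite x,
    fun y => by simpa using S.row_finite y⟩
  star_involutive S := by ext x y; exact star_star _
  star_mul S T := by
    ext x y
    have h1 : ∀ z, S.entry y z ≠ 0 → z ∈ (S.row_finite y).toFinset := fun z hz => by simpa using hz
    have h2 : ∀ z, star (S.entry y z) ≠ 0 → z ∈ (S.row_finite y).toFinset :=
      fun z hz => by simpa using hz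
    have e := mul_entry_eq_sum S T y x _ h1
    refine (congrArg star e).trans ?_
    rw [mul_entry_eq_sum' _ _ _ _ _ h2, star_sum]
    simp_rw [star_mul]
  star_add S T := by ext x y; exact star_add _ _

@[simp] theorem star_entry [StarRing A] (S : BandMatrix X A) (x y : X) :
    (star S).entry x y = star (S.entry y x) := rfl

section
variable [Module ℂ A]

instance : SMul ℂ (BandMatrix X A) :=
  ⟨fun c S => ⟨fun x y => c • S.entry x y,
    fun x => (S.row_finite x).subset fun y hy h => hy (by simp [h]),
    fun y => (S.col_finite y).subset fun x hx h => hx (by simp [h])⟩⟩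

@[simp] theorem smul_entry (c : ℂ) (S : BandMatrix X A) (x y : X) :
    (c • S).entry x y = c • S.entry x y := rfl

instance : Module ℂ (BandMatrix X A) where
  one_smul _ := by ext; simp
  mul_smul _ _ _ := by ext; simp [mul_smul]
  smul_zero _ := by ext; simp
  smul_add _ _ _ := by ext; simp
  add_smul _ _ _ := by ext; simp [add_smul]
  zero_smul _ := by ext; simp

instance [IsScalarTower ℂ A A] : IsScalarTower ℂ (BandMatrix X A) (BandMatrix X A) where
  smul_assoc c S T := by
    ext x y
    have h1 : ∀ z, S.entry x z ≠ 0 → z ∈ (S.row_finite x).toFinset := fun z hz => by simpa using hz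
    have h2 : ∀ z, (c • S).entry x z ≠ 0 → z ∈ (S.row_finite x).toFinset :=
      fun z hz => h1 z fun h => hz (by simp [h])
    simp only [smul_eq_mul, smul_entry]
    rw [mul_entry_eq_sum _ _ _ _ _ h1, mul_entry_eq_sum _ _ _ _ _ h2, Finset.smul_sum]
    simp [smul_mul_assoc]

instance [SMulCommClass ℂ A A] : SMulCommClass ℂ (BandMatrix X A) (BandMatrix X A) where
  smul_comm c S T := by
    ext x y
    have h1 : ∀ z, S.entry x z ≠ 0 → z ∈ (S.row_finite x).toFinset := fun z hz => by simpa using hz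
    simp only [smul_eq_mul, smul_entry]
    rw [mul_entry_eq_sum _ _ _ _ _ h1, mul_entry_eq_sum _ _ _ _ _ h1, Finset.smul_sum]
    simp [mul_smul_comm]

instance [StarRing A] [StarModule ℂ A] : StarModule ℂ (BandMatrix X A) where
  star_smul c S := by ext x y; simp

end
end
end BandMatrix
/-! ### The standard Hilbert module and its adjointable operators -/

section HilbertModule

variable {X A : Type*} [NonUnitalCStarAlgebra A]

theorem HilbMod.summable_of_le {f g : X → A} (hg : Summable g)
    (h : ∀ s : Finset X, ‖∑ x ∈ s, f x‖ ≤ 2 * ‖∑ x ∈ s, g x‖) : Summable f := by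
  rw [summable_iff_vanishing_norm] at hg ⊢
  intro ε hε
  obtain ⟨s, hs⟩ := hg (ε / 2) (by positivity)
  exact ⟨s, fun t ht => by linarith [h t, hs t ht]⟩

open WithCStarModule in
/-- The norm of a finite column, computed in the finite direct sum of copies of `A`. -/
def HilbMod.fin (s : Finset X) (a : X → A) : C⋆ᵐᵒᵈ(A, s → A) :=
  (equiv A (s → A)).symm fun x => star (a x)

theorem HilbMod.norm_fin [PartialOrder A] [StarOrderedRing A] (s : Finset X) (a : X → A) :
    ‖HilbMod.fin s a‖ = √‖∑ x ∈ s, star (a x) * a x‖ := by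
  rw [WithCStarModule.pi_norm, ← Finset.sum_coe_sort s]
  simp [HilbMod.fin, WithCStarModule.inner_def]

theorem HilbMod.inner_fin [PartialOrder A] [StarOrderedRing A] (s : Finset X) (a b : X → A) :
    inner A (HilbMod.fin s b) (HilbMod.fin s a) = ∑ x ∈ s, star (a x) * b x := by
  rw [WithCStarModule.pi_inner, ← Finset.sum_coe_sort s]
  simp [HilbMod.fin, WithCStarModule.inner_def]

theorem HilbMod.sqrt_add_le (s : Finset X) (a b : X → A) :
    √‖∑ x ∈ s, star (a x + b x) * (a x + b x)‖ ≤
      √‖∑ x ∈ s, star (a x) * a x‖ + √‖∑ x ∈ s, star (b x) * b x‖ := by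
  let _ := CStarAlgebra.spectralOrder A
  have := CStarAlgebra.spectralOrderedRing A
  have h := norm_add_le (HilbMod.fin s a) (HilbMod.fin s b)
  have e : HilbMod.fin s a + HilbMod.fin s b = HilbMod.fin s (a + b) := by
    ext x; simp [HilbMod.fin]
  rw [e, HilbMod.norm_fin, HilbMod.norm_fin, HilbMod.norm_fin] at h
  exact h

theorem HilbMod.cauchy_schwarz (s : Finset X) (a b : X → A) :
    ‖∑ x ∈ s, star (a x) * b x‖ ≤
      √‖∑ x ∈ s, star (a x) * a x‖ * √‖∑ x ∈ s, star (b x) * b x‖ := by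
  let _ := CStarAlgebra.spectralOrder A
  have := CStarAlgebra.spectralOrderedRing A
  have h := CStarModule.norm_inner_le (A := A) _ (x := HilbMod.fin s b) (y := HilbMod.fin s a)
  rw [HilbMod.inner_fin, HilbMod.norm_fin, HilbMod.norm_fin] at h
  rw [mul_comm]
  exact h

theorem HilbMod.summable_inner {a b : X → A} (ha : Summable fun x => star (a x) * a x)
    (hb : Summable fun x => star (b x) * b x) : Summable fun x => star (a x) * b x := by
  rw [summable_iff_vanishing_norm] at ha hb ⊢
  intro ε hε
  obtain ⟨s, hs⟩ := ha ε hε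
  obtain ⟨t, ht⟩ := hb ε hε
  classical
  refine ⟨s ∪ t, fun u hu => ?_⟩
  have h1 := hs u (hu.mono_right Finset.subset_union_left)
  have h2 := ht u (hu.mono_right Finset.subset_union_right)
  refine (HilbMod.cauchy_schwarz u a b).trans_lt ?_
  calc _ < √ε * √ε := mul_lt_mul'' (Real.sqrt_lt_sqrt (norm_nonneg _) h1)
        (Real.sqrt_lt_sqrt (norm_nonneg _) h2) (Real.sqrt_nonneg _) (Real.sqrt_nonneg _)
    _ = ε := Real.mul_self_sqrt hε.le

variable (X A) in
/-- The families `(a x)` in `A` for which `∑ a x ^* a x` converges in norm. -/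
def HilbMod.carrier : Submodule ℂ (X → A) where
  carrier := {a | Summable fun x => star (a x) * a x}
  zero_mem' := by simp [summable_zero]
  add_mem' {a b} ha hb := by
    have h1 := HilbMod.summable_inner ha hb
    have h2 := HilbMod.summable_inner hb ha
    refine (((ha.add h1).add h2).add hb).congr fun x => ?_
    simp only [Pi.add_apply, star_add, add_mul, mul_add]
    abel
  smul_mem' c a ha := by
    refine (ha.const_smul (star c * c)).congr fun x => ?_
    simp [smul_mul_smul_comm]

variable (X A) in
/-- The standard Hilbert `A`-module `E` of all `∑ a x [x]` for which `∑ a x ^* a x` converges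
in norm. -/
def HilbMod : Type _ := HilbMod.carrier X A

namespace HilbMod

instance : AddCommGroup (HilbMod X A) := inferInstanceAs (AddCommGroup (HilbMod.carrier X A))
instance : Module ℂ (HilbMod X A) := inferInstanceAs (Module ℂ (HilbMod.carrier X A))

/-- The coefficients of an element of `E`. -/
def coeff (a : HilbMod X A) : X → A := Subtype.val a

theorem summable (a : HilbMod X A) : Summable fun x => star (a.coeff x) * a.coeff x := a.2

@[ext] theorem ext {a b : HilbMod X A} (h : ∀ x, a.coeff x = b.coeff x) : a = b :=
  Subtype.ext (funext h)

@[simp] theorem coeff_add (a b : HilbMod X A) (x : X) :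
    (a + b).coeff x = a.coeff x + b.coeff x := rfl
@[simp] theorem coeff_smul (c : ℂ) (a : HilbMod X A) (x : X) :
    (c • a).coeff x = c • a.coeff x := rfl
@[simp] theorem coeff_zero (x : X) : (0 : HilbMod X A).coeff x = 0 := rfl

/-- The `A`-valued inner product `⟨a, b⟩ = ∑ a x ^* b x`. -/
def inner (a b : HilbMod X A) : A := ∑' x, star (a.coeff x) * b.coeff x

theorem hasSum_inner (a b : HilbMod X A) :
    HasSum (fun x => star (a.coeff x) * b.coeff x) (inner a b) :=
  (HilbMod.summable_inner a.summable b.summable).hasSum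

instance : Norm (HilbMod X A) := ⟨fun a => √‖inner a a‖⟩

theorem norm_def (a : HilbMod X A) : ‖a‖ = √‖inner a a‖ := rfl

theorem norm_sq (a : HilbMod X A) : ‖a‖ * ‖a‖ = ‖inner a a‖ :=
  Real.mul_self_sqrt (norm_nonneg _)

theorem inner_add_right (a b c : HilbMod X A) : inner a (b + c) = inner a b + inner a c :=
  (hasSum_inner a (b + c)).unique
    (by simpa [mul_add] using (hasSum_inner a b).add (hasSum_inner a c))

theorem inner_smul_right (z : ℂ) (a b : HilbMod X A) : inner a (z • b) = z • inner a b :=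
  (hasSum_inner a (z • b)).unique
    (by simpa [mul_smul_comm] using (hasSum_inner a b).const_smul z)

theorem star_inner (a b : HilbMod X A) : star (inner a b) = inner b a :=
  ((hasSum_inner a b).star).unique (by simpa using hasSum_inner b a)

theorem inner_add_left (a b c : HilbMod X A) : inner (a + b) c = inner a c + inner b c := by
  rw [← star_inner, inner_add_right, star_add, star_inner, star_inner]

theorem inner_smul_left (z : ℂ) (a b : HilbMod X A) : inner (z • a) b = star z • inner a b := by
  rw [← star_inner, inner_smul_right, star_smul, star_inner]

theorem norm_inner_le (a b : HilbMod X A) : ‖inner a b‖ ≤ ‖a‖ * ‖b‖ := by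
  refine le_of_tendsto_of_tendsto' (hasSum_inner a b).norm
    (((hasSum_inner a a).norm.sqrt).mul (hasSum_inner b b).norm.sqrt) fun s => ?_
  exact HilbMod.cauchy_schwarz s _ _

theorem eq_zero_of_norm (a : HilbMod X A) (h : ‖a‖ = 0) : a = 0 := by
  let _ := CStarAlgebra.spectralOrder A
  have := CStarAlgebra.spectralOrderedRing A
  have h0 : inner a a = 0 := by
    have := norm_sq a
    rw [h, mul_zero] at this
    exact norm_eq_zero.mp this.symm
  ext x
  have hx : star (a.coeff x) * a.coeff x ≤ inner a a :=
    le_hasSum (hasSum_inner a a) x fun y _ => star_mul_self_nonneg _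
  rw [h0] at hx
  have := le_antisymm hx (star_mul_self_nonneg _)
  simpa using CStarRing.star_mul_self_eq_zero_iff _ |>.mp this

theorem core : NormedSpace.Core ℂ (HilbMod X A) where
  norm_nonneg a := Real.sqrt_nonneg _
  norm_smul c a := by
    have h : inner (c • a) (c • a) = (star c * c) • inner a a := by
      rw [inner_smul_left, inner_smul_right, smul_smul]
    rw [norm_def, norm_def, h, norm_smul, norm_mul, norm_star, Real.sqrt_mul (by positivity),
      Real.sqrt_mul_self (norm_nonneg _)]
  norm_triangle a b := by
    refine le_of_tendsto_of_tendsto' (hasSum_inner (a + b) (a + b)).norm.sqrt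
      (((hasSum_inner a a).norm.sqrt).add (hasSum_inner b b).norm.sqrt) fun s => ?_
    exact HilbMod.sqrt_add_le s _ _
  norm_eq_zero_iff a := ⟨eq_zero_of_norm a, fun h => by
    subst h
    have : inner (0 : HilbMod X A) 0 = 0 := by simp [inner]
    simp [norm_def, this]⟩

instance : NormedAddCommGroup (HilbMod X A) := NormedAddCommGroup.ofCore core
instance : NormedSpace ℂ (HilbMod X A) := NormedSpace.ofCore core

/-- `S'` is an adjoint of `S`. -/
def IsAdj (S S' : HilbMod X A →L[ℂ] HilbMod X A) : Prop :=
  ∀ a b, inner (S a) b = inner a (S' b)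

theorem IsAdj.symm {S S' : HilbMod X A →L[ℂ] HilbMod X A} (h : IsAdj S S') : IsAdj S' S :=
  fun a b => by rw [← star_inner, ← h b a, star_inner]

theorem IsAdj.unique {S S' S'' : HilbMod X A →L[ℂ] HilbMod X A} (h : IsAdj S S')
    (h' : IsAdj S S'') : S' = S'' := by
  ext1 b
  have h1 : ∀ a, inner a (S' b - S'' b) = 0 := fun a => by
    have e : S' b - S'' b = S' b + (-1 : ℂ) • S'' b := by rw [neg_one_smul, sub_eq_add_neg]
    rw [e, inner_add_right, inner_smul_right, ← h, ← h', neg_one_smul, add_neg_cancel]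
  have h2 := norm_sq (S' b - S'' b)
  rw [h1, norm_zero, mul_self_eq_zero] at h2
  exact sub_eq_zero.mp (eq_zero_of_norm _ h2)

theorem IsAdj.norm_le {S S' : HilbMod X A →L[ℂ] HilbMod X A} (h : IsAdj S S') :
    ‖S'‖ ≤ ‖S‖ := by
  refine ContinuousLinearMap.opNorm_le_bound _ (norm_nonneg _) fun b => ?_
  have h1 : ‖S' b‖ * ‖S' b‖ ≤ (‖S‖ * ‖b‖) * ‖S' b‖ := by
    rw [norm_sq, ← h]
    calc _ ≤ ‖S (S' b)‖ * ‖b‖ := norm_inner_le _ _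
      _ ≤ ‖S‖ * ‖S' b‖ * ‖b‖ := by gcongr; exact S.le_opNorm _
      _ = _ := by ring
  rcases (norm_nonneg (S' b)).eq_or_lt with h0 | h0
  · rw [← h0]; positivity
  · exact le_of_mul_le_mul_right h1 h0

end HilbMod

variable (X A) in
/-- The algebra `B(E)` of adjointable operators on `E`, with the operator norm; an operator with
an adjoint is automatically `A`-linear. -/
def AdjSubalgebra : Subalgebra ℂ (HilbMod X A →L[ℂ] HilbMod X A) where
  carrier := {S | ∃ S', HilbMod.IsAdj S S'}
  mul_mem' := by
    rintro S T ⟨S', hS⟩ ⟨T', hT⟩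
    exact ⟨T' * S', fun a b => by simp [hS _ _, hT _ _]⟩
  add_mem' := by
    rintro S T ⟨S', hS⟩ ⟨T', hT⟩
    exact ⟨S' + T', fun a b => by
      simp [HilbMod.inner_add_left, HilbMod.inner_add_right, hS _ _, hT _ _]⟩
  algebraMap_mem' c := ⟨algebraMap ℂ _ (star c), fun a b => by
    simp [Algebra.algebraMap_eq_smul_one, HilbMod.inner_smul_left, HilbMod.inner_smul_right]⟩

variable (X A) in
/-- The `C^*`-algebra `B(E)` of adjointable operators on `E`. -/
def Adjointable : Type _ := AdjSubalgebra X A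

namespace Adjointable

instance : NormedRing (Adjointable X A) := inferInstanceAs (NormedRing (AdjSubalgebra X A))
instance : NormedAlgebra ℂ (Adjointable X A) :=
  inferInstanceAs (NormedAlgebra ℂ (AdjSubalgebra X A))

/-- The underlying operator. -/
def op (S : Adjointable X A) : HilbMod X A →L[ℂ] HilbMod X A := Subtype.val S

@[simp] theorem op_mul (S T : Adjointable X A) : (S * T).op = S.op * T.op := rfl
@[simp] theorem op_add (S T : Adjointable X A) : (S + T).op = S.op + T.op := rfl
@[simp] theorem op_smul (c : ℂ) (S : Adjointable X A) : (c • S).op = c • S.op := rfl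
theorem norm_eq (S : Adjointable X A) : ‖S‖ = ‖S.op‖ := rfl

theorem isAdj_star_exists (S : Adjointable X A) :
    ∃ S' : Adjointable X A, HilbMod.IsAdj S.op S'.op := by
  obtain ⟨S', h⟩ := S.2
  exact ⟨⟨S', _, h.symm⟩, h⟩

instance : Star (Adjointable X A) := ⟨fun S => (isAdj_star_exists S).choose⟩

theorem isAdj_star (S : Adjointable X A) :
    HilbMod.IsAdj S.op (star S).op :=
  (isAdj_star_exists S).choose_spec

theorem eq_star {S S' : Adjointable X A}
    (h : HilbMod.IsAdj S.op S'.op) : star S = S' :=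
  Subtype.ext ((isAdj_star S).unique h)

instance : StarRing (Adjointable X A) where
  star_involutive S := eq_star (isAdj_star S).symm
  star_mul S T := eq_star fun a b => by
    have h1 := isAdj_star S
    have h2 := isAdj_star T
    simp [h1 _ _, h2 _ _]
  star_add S T := eq_star fun a b => by
    have h1 := isAdj_star S
    have h2 := isAdj_star T
    simp [HilbMod.inner_add_left, HilbMod.inner_add_right, h1 _ _, h2 _ _]

instance : StarModule ℂ (Adjointable X A) where
  star_smul c S := eq_star fun a b => by
    have h1 := isAdj_star S
    simp [HilbMod.inner_smul_left, HilbMod.inner_smul_right, h1 _ _]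

instance : CStarRing (Adjointable X A) where
  norm_mul_self_le S := by
    have h : ‖S.op‖ ≤ √‖star S * S‖ := by
      refine ContinuousLinearMap.opNorm_le_bound _ (Real.sqrt_nonneg _) fun a => ?_
      have h1 : ‖S.op a‖ * ‖S.op a‖ ≤ ‖star S * S‖ * (‖a‖ * ‖a‖) := by
        rw [HilbMod.norm_sq, isAdj_star S a (S.op a)]
        calc _ ≤ ‖a‖ * ‖(star S * S).op a‖ := HilbMod.norm_inner_le _ _
          _ ≤ ‖a‖ * (‖star S * S‖ * ‖a‖) := by
            gcongr; exact (star S * S).op.le_opNorm a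
          _ = _ := by ring
      refine Real.le_sqrt_of_sq_le ?_ |>.trans (le_of_eq ?_) (b := √(‖star S * S‖ * (‖a‖ * ‖a‖)))
      · rw [sq]; exact h1
      · have hn : 0 ≤ ‖star S * S‖ := norm_nonneg (star S * S)
        rw [Real.sqrt_mul hn, Real.sqrt_mul_self (norm_nonneg _)]
    calc ‖S‖ * ‖S‖ ≤ √‖star S * S‖ * √‖star S * S‖ :=
          mul_self_le_mul_self (norm_nonneg _) h
      _ = _ := Real.mul_self_sqrt (norm_nonneg _)

instance : NormedStarGroup (Adjointable X A) := ⟨fun S => (isAdj_star S).norm_le⟩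

end Adjointable

end HilbertModule

/-! ### Coarse geometry -/

/-- Bounded geometry: for each radius the cardinality of balls is uniformly bounded. -/
class BoundedGeometry (X : Type*) [MetricSpace X] : Prop where
  bound : ∀ r : ℝ, 0 < r → ∃ N : ℕ, ∀ x : X, (Metric.closedBall x r).encard ≤ N

theorem BoundedGeometry.finite_closedBall {X : Type*} [MetricSpace X] [BoundedGeometry X]
    (x : X) (r : ℝ) : (Metric.closedBall x r).Finite := by
  obtain ⟨N, hN⟩ := BoundedGeometry.bound (X := X) (max r 1) (by positivity)
  exact (Set.finite_of_encard_le_coe (hN x)).subset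
    (Metric.closedBall_subset_closedBall (le_max_left _ _))

/-- Equi-property A of a family of subspaces of a metric space. -/
def EquiPropertyA {X : Type*} [MetricSpace X] {ι : Type*} (P : ι → Set X) : Prop :=
  ∀ R : ℝ, 0 < R → ∀ ε : ℝ, 0 < ε → ∃ S : ℝ, 0 < S ∧
    ∃ ξ : ∀ i, P i → lp (fun _ : P i => ℝ) 2,
      (∀ i (x y : P i), ξ i x y ∈ Set.Icc (0 : ℝ) 1) ∧
      (∀ i (x : P i), ‖ξ i x‖ = 1) ∧
      (∃ δ < ε, ∀ i (x y : P i), dist x y ≤ R → ‖ξ i x - ξ i y‖ ≤ δ) ∧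
      (∀ i (x y : P i), ξ i x y ≠ 0 → y ∈ Metric.ball x S)

/-- Uniform expansiveness of a map. -/
def UniformlyExpansive {X Y : Type*} [MetricSpace X] [MetricSpace Y] (p : X → Y) : Prop :=
  ∀ r : ℝ, 0 < r → ∃ s : ℝ, 0 < s ∧ ∀ x x' : X, dist x x' < r → dist (p x) (p x') < s

/-- Coarse embeddings of metric spaces. -/
def IsCoarseEmbedding {Y H : Type*} [MetricSpace Y] [MetricSpace H] (f : Y → H) : Prop :=
  ∃ ρ₁ ρ₂ : ℝ≥0 → ℝ≥0, Monotone ρ₁ ∧ Monotone ρ₂ ∧ Tendsto ρ₁ atTop atTop ∧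
    ∀ y y' : Y, ρ₁ (nndist y y') ≤ nndist (f y) (f y') ∧
      nndist (f y) (f y') ≤ ρ₂ (nndist y y')

/-! ### The complexified Clifford algebra with its `C^*`-norm -/

section Clifford

universe w

/-- The quadratic form `v ↦ ‖v‖ ^ 2`. -/
def normSqForm (W : Type w) [NormedAddCommGroup W] [InnerProductSpace ℝ W] : QuadraticForm ℝ W :=
  LinearMap.BilinMap.toQuadraticMap (innerₗ W)

theorem normSqForm_apply (W : Type w) [NormedAddCommGroup W] [InnerProductSpace ℝ W] (v : W) :
    normSqForm W v = ‖v‖ ^ 2 := by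
  simp [normSqForm]

/-- The (nonzero, unital) `*`-representations of the complexified Clifford algebra of `W`, whose
generators `v ∈ W` are self-adjoint with `v ^ 2 = ‖v‖ ^ 2`, on complex Hilbert spaces. -/
structure CliffordRep (W : Type w) [NormedAddCommGroup W] [InnerProductSpace ℝ W] where
  K : Type w
  [normedAddCommGroup : NormedAddCommGroup K]
  [innerProductSpace : InnerProductSpace ℂ K]
  [completeSpace : CompleteSpace K]
  [nontrivial : Nontrivial K]
  hom : CliffordAlgebra (normSqForm W) →ₐ[ℝ] (K →L[ℂ] K)
  isSelfAdjoint : ∀ v, IsSelfAdjoint (hom (CliffordAlgebra.ι _ v))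

attribute [instance] CliffordRep.normedAddCommGroup CliffordRep.innerProductSpace
  CliffordRep.completeSpace CliffordRep.nontrivial

variable (W : Type w) [NormedAddCommGroup W] [InnerProductSpace ℝ W]

/-- The `C^*`-algebra of bounded families indexed by the representations of the Clifford algebra.
The complexified Clifford algebra sits in it through the family of all its representations, and
inherits from it its `C^*`-norm. -/
def CliffordAmbient : Type _ := lp (fun ρ : CliffordRep W => ρ.K →L[ℂ] ρ.K) ∞

instance : NormedRing (CliffordAmbient W) :=
  inferInstanceAs (NormedRing (lp (fun ρ : CliffordRep W => ρ.K →L[ℂ] ρ.K) ∞))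

instance : NormedAlgebra ℂ (CliffordAmbient W) :=
  inferInstanceAs (NormedAlgebra ℂ (lp (fun ρ : CliffordRep W => ρ.K →L[ℂ] ρ.K) ∞))

instance : StarRing (CliffordAmbient W) :=
  inferInstanceAs (StarRing (lp (fun ρ : CliffordRep W => ρ.K →L[ℂ] ρ.K) ∞))

instance : StarModule ℂ (CliffordAmbient W) :=
  inferInstanceAs (StarModule ℂ (lp (fun ρ : CliffordRep W => ρ.K →L[ℂ] ρ.K) ∞))

instance : CStarRing (CliffordAmbient W) :=
  inferInstanceAs (CStarRing (lp (fun ρ : CliffordRep W => ρ.K →L[ℂ] ρ.K) ∞))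

instance : CompleteSpace (CliffordAmbient W) :=
  inferInstanceAs (CompleteSpace (lp (fun ρ : CliffordRep W => ρ.K →L[ℂ] ρ.K) ∞))

instance : CStarAlgebra (CliffordAmbient W) where

theorem CliffordRep.norm_hom_ι (ρ : CliffordRep W) (v : W) :
    ‖ρ.hom (CliffordAlgebra.ι _ v)‖ = ‖v‖ := by
  have h : ρ.hom (CliffordAlgebra.ι _ v) * ρ.hom (CliffordAlgebra.ι _ v) =
      algebraMap ℝ _ (‖v‖ ^ 2) := by
    rw [← map_mul, CliffordAlgebra.ι_sq_scalar, normSqForm_apply, AlgHom.commutes]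
  have h2 := CStarRing.norm_star_mul_self (x := ρ.hom (CliffordAlgebra.ι _ v))
  rw [(ρ.isSelfAdjoint v).star_eq, h, norm_algebraMap', Real.norm_of_nonneg (by positivity)] at h2
  exact ((sq_eq_sq₀ (norm_nonneg _) (norm_nonneg _)).mp (by rw [sq, ← h2])) 

variable {W}

/-- Clifford multiplication by a vector. -/
def cliff (v : W) : CliffordAmbient W :=
  ⟨fun ρ => ρ.hom (CliffordAlgebra.ι _ v),
    memℓp_infty ⟨‖v‖, by rintro _ ⟨ρ, rfl⟩; exact (ρ.norm_hom_ι W v).le⟩⟩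

theorem norm_cliff_le (v : W) : ‖cliff v‖ ≤ ‖v‖ :=
  lp.norm_le_of_forall_le (norm_nonneg v) fun ρ => (ρ.norm_hom_ι W v).le

end Clifford

/-! ### The space `ℝ₊ × H` and the algebra `A(V)` -/

section AlgA

universe w

variable (H : Type w) [NormedAddCommGroup H] [InnerProductSpace ℝ H]

/-- The space `ℝ₊ × H`. -/
def RPlus : Type w := ℝ≥0 × H

/-- The topology of `ℝ₊ × H`: a net `(tᵢ, vᵢ)` converges to `(t, v)` iff
`tᵢ ^ 2 + ‖vᵢ‖ ^ 2 → t ^ 2 + ‖v‖ ^ 2` and `⟪vᵢ, u⟫ → ⟪v, u⟫` for all `u`. -/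
instance : TopologicalSpace (RPlus H) :=
  TopologicalSpace.induced
    (fun q : RPlus H => (((q.1 : ℝ) ^ 2 + ‖q.2‖ ^ 2, fun u => inner ℝ q.2 u) : ℝ × (H → ℝ)))
    inferInstance

/-- The ambient algebra of the Clifford algebra of `ℝ ⊕ H`. The unit vector of `ℝ` is an additional
Clifford variable `e`. It realizes the graded tensor products with `S = C₀(ℝ)`: on `ℝ₊`, a function
`g ∈ S` with even part `g₀` and odd part `g₁` becomes `g₀(t) + e g₁(t)`. -/
abbrev Coef : Type (w + 1) := CliffordAmbient (WithLp 2 (ℝ × H))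

/-- The `C^*`-algebra of bounded functions on `ℝ₊ × H` with values in `Coef H`. -/
def BddFun : Type (w + 1) := lp (fun _ : RPlus H => Coef H) ∞

instance : NonUnitalCStarAlgebra (BddFun H) :=
  inferInstanceAs (NonUnitalCStarAlgebra (lp (fun _ : RPlus H => Coef H) ∞))

variable {H}

/-- The value of a function at a point. -/
def BddFun.val (a : BddFun H) (q : RPlus H) : Coef H :=
  (show lp (fun _ : RPlus H => Coef H) ∞ from a) q

/-- Clifford multiplication by the vector `t e + h` of `ℝ ⊕ H`. -/
def cl (t : ℝ) (h : H) : Coef H := cliff (WithLp.toLp 2 (t, h))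

theorem norm_cl_le (t : ℝ) (h : H) : ‖cl t h‖ ≤ √(t ^ 2 + ‖h‖ ^ 2) := by
  refine (norm_cliff_le _).trans (le_of_eq ?_)
  rw [WithLp.prod_norm_eq_of_L2]
  simp

/-- The complexified Clifford algebra `Cliff(W)` of a linear subspace `W` of `H`. -/
def cliffOf (W : Submodule ℝ H) : StarSubalgebra ℂ (Coef H) :=
  StarAlgebra.adjoin ℂ {a | ∃ h ∈ W, a = cl 0 h}

/-- The elements of `A(W) = S ⊗̂ C(W)`, where `C(W) = C₀(W, Cliff W)`, as `C₀`-functions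
`ℝ × W → Cliff W`; the elementary tensor of `g` and `h` is the function `(s, w) ↦ g s • h w`. -/
def AFun (W : Submodule ℝ H) : Set (ZeroAtInftyContinuousMap (ℝ × W) (Coef H)) :=
  {F | ∀ q, F q ∈ cliffOf W}

section Beta

variable (W : Submodule ℝ H) [FiniteDimensional ℝ W]

/-- The distance `√(t ^ 2 + ‖v - v_W‖ ^ 2)` of a point `(t, v)` of `ℝ₊ × H` from `{0} × W`. -/
def rad (q : RPlus H) : ℝ := √((q.1 : ℝ) ^ 2 + ‖q.2 - W.orthogonalProjectionOnto q.2‖ ^ 2)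

/-- Let `v_W` be the projection of `v` to `W` and `Z = t e + (v - v_W)`, so that `Z ^ 2 = r ^ 2`
with `r = rad W (t, v)`. The value at `(t, v)` of the image of `g ⊗̂ h` is `g(Z) h(v_W)`, where
`g(Z) = g₀(r) + Z g₁(r) / r` is the functional calculus and `g₀`, `g₁` are the even and the odd
part of `g`. This is the formula for a general element of `A(W)`. -/
def betaFun (F : ZeroAtInftyContinuousMap (ℝ × W) (Coef H)) (q : RPlus H) : Coef H :=
  (2⁻¹ : ℝ) • (F (rad W q, W.orthogonalProjectionOnto q.2) +
      F (-rad W q, W.orthogonalProjectionOnto q.2)) +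
    (2⁻¹ * (rad W q)⁻¹ : ℝ) • (cl (q.1 : ℝ) (q.2 - W.orthogonalProjectionOnto q.2) *
      (F (rad W q, W.orthogonalProjectionOnto q.2) - F (-rad W q, W.orthogonalProjectionOnto q.2)))

theorem betaFun_bdd (F : ZeroAtInftyContinuousMap (ℝ × W) (Coef H)) :
    Memℓp (fun q : RPlus H => betaFun W F q) ∞ := by
  obtain ⟨C, hC⟩ : ∃ C, ∀ z, ‖F z‖ ≤ C := ⟨‖F.toBCF‖, fun z => F.toBCF.norm_coe_le_norm z⟩
  refine memℓp_infty ⟨C + C, ?_⟩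
  rintro _ ⟨q, rfl⟩
  have h1 : ∀ a b : Coef H, ‖a‖ ≤ C → ‖b‖ ≤ C → ‖(2⁻¹ : ℝ) • (a + b)‖ ≤ C := fun a b ha hb => by
    rw [norm_smul, Real.norm_of_nonneg (by norm_num)]
    linarith [norm_add_le a b]
  have h2 : ∀ a b : Coef H, ‖a‖ ≤ C → ‖b‖ ≤ C → ‖(2⁻¹ * (rad W q)⁻¹ : ℝ) •
      (cl (q.1 : ℝ) (q.2 - W.orthogonalProjectionOnto q.2) * (a - b))‖ ≤ C := fun a b ha hb => by
    have hr : 0 ≤ rad W q := Real.sqrt_nonneg _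
    have hc : ‖cl (q.1 : ℝ) (q.2 - W.orthogonalProjectionOnto q.2)‖ ≤ rad W q := norm_cl_le _ _
    rw [norm_smul, Real.norm_of_nonneg (by positivity)]
    have h3 : ‖a - b‖ ≤ 2 * C := by linarith [norm_sub_le a b]
    have hC0 : 0 ≤ C := (norm_nonneg _).trans ha
    calc _ ≤ 2⁻¹ * (rad W q)⁻¹ * (rad W q * (2 * C)) := by
          gcongr
          exact (norm_mul_le _ _).trans (by gcongr)
      _ = ((rad W q)⁻¹ * rad W q) * C := by ring
      _ ≤ 1 * C := by gcongr; exact inv_mul_le_one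
      _ = C := one_mul _
  exact (norm_add_le _ _).trans (add_le_add (h1 _ _ (hC _) (hC _)) (h2 _ _ (hC _) (hC _)))

/-- The inclusion `β : A(W) → A(V)` into the direct limit. It is injective, and the `C^*`-algebra
structure of `A(W)`, that of the graded tensor product, is the one for which `β` is an isometric
`*`-homomorphism. -/
def beta (F : ZeroAtInftyContinuousMap (ℝ × W) (Coef H)) : BddFun H :=
  ⟨betaFun W F, betaFun_bdd W F⟩

end Beta

/-- The `C^*`-algebra `A(V)`, the direct limit of the algebras `A(W)` for the finite-dimensional
subspaces `W` of `V`: the closure of the union of their images, which are directed. -/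
def AlgASub (V : Submodule ℝ H) : NonUnitalStarSubalgebra ℂ (BddFun H) :=
  (NonUnitalStarAlgebra.adjoin ℂ {a | ∃ (W : Submodule ℝ H) (_ : FiniteDimensional ℝ W), W ≤ V ∧
    ∃ F ∈ AFun W, beta W F = a}).topologicalClosure

instance (V : Submodule ℝ H) : IsClosed (AlgASub V : Set (BddFun H)) :=
  NonUnitalStarSubalgebra.isClosed_topologicalClosure _

/-- The `C^*`-algebra `A(V)`. -/
def AlgA (V : Submodule ℝ H) : Type (w + 1) := AlgASub V

instance (V : Submodule ℝ H) : NonUnitalCStarAlgebra (AlgA V) :=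
  inferInstanceAs (NonUnitalCStarAlgebra (AlgASub V))

/-- An element of `A(V)` as a function on `ℝ₊ × H`. -/
def AlgA.toFun {V : Submodule ℝ H} (a : AlgA V) : BddFun H := Subtype.val a

/-- The support of `a ∈ A(V)`: the complement of the set of all points `q` at which some
`g ∈ C₀(ℝ₊ × H)` with `g · a = 0` does not vanish. -/
def supp {V : Submodule ℝ H} (a : AlgA V) : Set (RPlus H) :=
  {q | ∃ g : ZeroAtInftyContinuousMap (RPlus H) ℂ,
    g q ≠ 0 ∧ ∀ q', g q' • a.toFun.val q' = 0}ᶜ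

/-- The subset `B(v, r)` of `ℝ₊ × H`. -/
def ballR (v : H) (r : ℝ) : Set (RPlus H) := {q | (q.1 : ℝ) ^ 2 + ‖q.2 - v‖ ^ 2 < r ^ 2}

end AlgA

/-! ### Maximal closures -/

section Max

universe u v

/-- The `*`-representations of a complex `*`-algebra on Hilbert spaces. -/
structure StarRep (B : Type v) [NonUnitalRing B] [StarRing B] [Module ℂ B] where
  K : Type u
  [normedAddCommGroup : NormedAddCommGroup K]
  [innerProductSpace : InnerProductSpace ℂ K]
  [completeSpace : CompleteSpace K]
  hom : B →⋆ₙₐ[ℂ] (K →L[ℂ] K)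

attribute [instance] StarRep.normedAddCommGroup StarRep.innerProductSpace StarRep.completeSpace

variable (B : Type v) [NonUnitalRing B] [StarRing B] [Module ℂ B]

/-- The `C^*`-algebra of bounded families of operators indexed by all representations of `B`. -/
def MaxAmbient : Type _ := lp (fun π : StarRep.{u} B => π.K →L[ℂ] π.K) ∞

instance : NonUnitalCStarAlgebra (MaxAmbient.{u} B) :=
  inferInstanceAs (NonUnitalCStarAlgebra (lp (fun π : StarRep.{u} B => π.K →L[ℂ] π.K) ∞))

variable {B}

/-- The member of a family at a representation. -/
def MaxAmbient.val (F : MaxAmbient.{u} B) (π : StarRep.{u} B) : π.K →L[ℂ] π.K :=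
  (show lp (fun π : StarRep.{u} B => π.K →L[ℂ] π.K) ∞ from F) π

/-- `F` is the image of `b` in the maximal completion of `B`: it is the family of all `π b`. Its
norm is the maximal norm `sup ‖π b‖` of `b`; it exists if and only if this is finite. -/
def IsMaxImage (b : B) (F : MaxAmbient.{u} B) : Prop := ∀ π, F.val π = π.hom b

/-- The closure of a `*`-subalgebra of `B` in the maximal completion of `B`, that is, under the
norm `sup ‖π b‖`, where `π` ranges over the representations of `B`. -/
def maxClosure (S : Set B) : NonUnitalStarSubalgebra ℂ (MaxAmbient.{u} B) :=
  (NonUnitalStarAlgebra.adjoin ℂ {F | ∃ b ∈ S, IsMaxImage b F}).topologicalClosure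

end Max

/-! ### Twisted uniform Roe algebras -/

section Twisted

universe u v w

variable {X : Type u} {Y : Type v} {H : Type w} [MetricSpace X] [MetricSpace Y]
  [NormedAddCommGroup H] [InnerProductSpace ℝ H]

/-- The subspace `W_n(y)` spanned by all `f y'` with `d(y, y') ≤ n ^ 2`. -/
def spanBall (f : Y → H) (n : ℕ) (y : Y) : Submodule ℝ H :=
  Submodule.span ℝ (f '' {y' | dist y y' ≤ (n : ℝ) ^ 2})

instance [BoundedGeometry Y] (f : Y → H) (n : ℕ) (y : Y) :
    FiniteDimensional ℝ (spanBall f n y) := by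
  refine FiniteDimensional.span_of_finite ℝ (Set.Finite.image _ ?_)
  refine (BoundedGeometry.finite_closedBall y ((n : ℝ) ^ 2)).subset fun y' hy' => ?_
  rw [Metric.mem_closedBall, dist_comm]
  exact hy'

/-- The union `V` of the increasing sequence `W_n(y)`; it does not depend on `y`. -/
def spanAll (f : Y → H) : Submodule ℝ H := Submodule.span ℝ (Set.range f)

theorem spanAll_eq (f : Y → H) (y : Y) : (spanAll f : Set H) = ⋃ n, (spanBall f n y : Set H) := by
  have hm : Monotone fun n => spanBall f n y := fun m n hmn =>
    Submodule.span_mono (Set.image_mono fun y' (hy' : dist y y' ≤ (m : ℝ) ^ 2) =>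
      show dist y y' ≤ (n : ℝ) ^ 2 from hy'.trans (by gcongr))
  rw [← Submodule.coe_iSup_of_directed _ hm.directed_le]
  congr 1
  apply le_antisymm
  · refine Submodule.span_le.mpr ?_
    rintro _ ⟨y', rfl⟩
    obtain ⟨n, hn⟩ := exists_nat_ge (dist y y')
    refine (le_iSup (fun n => spanBall f n y) (n + 1)) (Submodule.subset_span ⟨y', ?_, rfl⟩)
    change dist y y' ≤ ((n + 1 : ℕ) : ℝ) ^ 2
    push_cast
    nlinarith
  · exact iSup_le fun n => Submodule.span_mono (Set.image_subset_range _ _)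

/-- The matrices of the algebraic twisted uniform Roe algebra. Here `F` is the function `T₁(x, y)`
with `β_N(T₁(x, y)) = T(x, y)`, and `G` is its derivative in the direction `Z = (s, h)`. -/
structure IsTwisted [BoundedGeometry Y] (p : X → Y) (f : Y → H)
    (T : BandMatrix X (AlgA (spanAll f))) : Prop where
  smooth : ∃ (N : ℕ) (c : ℝ), ∀ x y, ∃ F ∈ AFun (spanBall f N (p x)),
    beta (spanBall f N (p x)) F = (T.entry x y).toFun ∧
    ∀ (s : ℝ) (h : spanBall f N (p x)), √(s ^ 2 + ‖h‖ ^ 2) ≤ 1 →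
      ∃ G ∈ AFun (spanBall f N (p x)), (∀ q, HasLineDerivAt ℝ F (G q) q (s, h)) ∧
        ‖beta (spanBall f N (p x)) G‖ ≤ c
  bounded : ∃ M : ℝ, ∀ x y, ‖T.entry x y‖ ≤ M
  propagation : ∃ r₁ : ℝ, 0 < r₁ ∧ ∀ x y, r₁ < dist x y → T.entry x y = 0
  support : ∃ r₂ : ℝ, 0 < r₂ ∧ ∀ x y, supp (T.entry x y) ⊆ ballR (f (p x)) r₂

/-- The algebraic twisted uniform Roe algebra `ℂ_u[X, A]`, a `*`-algebra of matrices. For a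
uniformly expansive `p` and a coarse embedding `f` the matrices in question form a
`*`-subalgebra, so that passing to the `*`-subalgebra which they generate adds nothing. -/
def twistedAlg [BoundedGeometry Y] (p : X → Y) (f : Y → H) :
    NonUnitalStarSubalgebra ℂ (BandMatrix X (AlgA (spanAll f))) :=
  NonUnitalStarAlgebra.adjoin ℂ {T | IsTwisted p f T}

/-- The subalgebra `ℂ_u[X, A]_O` of the elements with support in `O`. -/
def twistedOn [BoundedGeometry Y] (p : X → Y) (f : Y → H) (O : Set (RPlus H)) :
    Set (twistedAlg p f) :=
  {T | ∀ x y, supp ((T : BandMatrix X (AlgA (spanAll f))).entry x y) ⊆ O}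

/-- `S` is the operator on the Hilbert module `E` given by the matrix `T`. -/
def ActsAs {A : Type*} [NonUnitalCStarAlgebra A] (T : BandMatrix X A) (S : Adjointable X A) :
    Prop :=
  ∀ a y, (S.op a).coeff y = ∑ᶠ x, T.entry y x * a.coeff x

/-- The closure of a `*`-subalgebra of `ℂ_u[X, A]` in `B(E)`. -/
def redClosure [BoundedGeometry Y] {p : X → Y} {f : Y → H} (𝒮 : Set (twistedAlg p f)) :
    NonUnitalStarSubalgebra ℂ (Adjointable X (AlgA (spanAll f))) :=
  (NonUnitalStarAlgebra.adjoin ℂ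
    {S | ∃ T ∈ 𝒮, ActsAs (T : BandMatrix X (AlgA (spanAll f))) S}).topologicalClosure

/-- The maximal twisted uniform Roe algebra `C^*_{u,max}(X, A)`. The universe is large enough for
the representations which `E` induces. -/
abbrev CuMax [BoundedGeometry Y] (p : X → Y) (f : Y → H) :
    NonUnitalStarSubalgebra ℂ (MaxAmbient.{max u w} (twistedAlg p f)) :=
  maxClosure Set.univ

/-- The (reduced) twisted uniform Roe algebra `C^*_u(X, A)`. -/
abbrev CuRed [BoundedGeometry Y] (p : X → Y) (f : Y → H) :
    NonUnitalStarSubalgebra ℂ (Adjointable X (AlgA (spanAll f))) :=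
  redClosure (Set.univ : Set (twistedAlg p f))

/-- The closure `C^*_{u,φ}(X, A)_O` of `ℂ_u[X, A]_O` in `C^*_{u,max}(X, A)`. -/
def CuPhiOn [BoundedGeometry Y] (p : X → Y) (f : Y → H) (O : Set (RPlus H)) :
    Set (CuMax p f) :=
  {F | (F : MaxAmbient.{max u w} (twistedAlg p f)) ∈ maxClosure (twistedOn p f O)}

/-- The closure `C^*_u(X, A)_O` of `ℂ_u[X, A]_O` in `C^*_u(X, A)`. -/
def CuRedOn [BoundedGeometry Y] (p : X → Y) (f : Y → H) (O : Set (RPlus H)) :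
    Set (CuRed p f) :=
  {S | (S : Adjointable X (AlgA (spanAll f))) ∈ redClosure (twistedOn p f O)}

/-- The canonical quotient map `C^*_{u,max}(X, A) → C^*_u(X, A)`: it sends the image of each
`T ∈ ℂ_u[X, A]` to the image of `T`. -/
def IsCanonicalQuotient [BoundedGeometry Y] {p : X → Y} {f : Y → H}
    (Λ : CuMax p f →⋆ₙₐ[ℂ] CuRed p f) : Prop :=
  ∀ (T : twistedAlg p f) (F : CuMax p f) (S : CuRed p f),
    IsMaxImage T (F : MaxAmbient.{max u w} (twistedAlg p f)) →
    ActsAs (T : BandMatrix X (AlgA (spanAll f))) (S : Adjointable X (AlgA (spanAll f))) → Λ F = S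

/-- `r`-separate families of open subsets of `ℝ₊ × H`. -/
structure IsSeparate {J : Type*} (p : X → Y) (f : Y → H) (r : ℝ) (O : J → Set (RPlus H)) :
    Prop where
  isOpen : ∀ i, IsOpen (O i)
  subset_ball : ∀ i, ∃ x : X, O i ⊆ ballR (f (p x)) r
  disjoint : ∀ i j, i ≠ j → O i ∩ O j = ∅

end Twisted

end

/-! The quotient map exists because the maximal norm is finite and dominates the norm on `E`. It is
isometric over a separate family because property A compresses matrices there to block matrices of
bounded size, and on these every representation is dominated by the one on `E`.

Finiteness (`exists_norm_map_le`). A finite colouring cuts a band matrix into finitely many pieces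
with at most one nonzero entry in each row and column. For such a piece `T` the matrix `T * star T`
is diagonal. A diagonal twisted matrix whose entries have norm at most some `M < 1` has a
quasi-inverse among the twisted matrices, because inversion preserves differentiability with bounds
(`HasLift.quasiInverse`). So in any representation the spectrum of `T * star T` is controlled by its
entries, and the norm of a band matrix is at most a constant times the largest entry, with a
constant that depends only on the propagation. Domination (`norm_redHom_le`). The norm on `E` is
bounded by the norms in the representations on `ℓ²(X, K)` induced by evaluating the coefficients at
points and in Clifford representations on `K`.

The reverse inequality over the family (`norm_map_le_norm_redHom`). If `T(x, y)` does not vanish at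
a point of `O i`, then `x` and `y` lie in the preimage of a ball whose centre depends on `i` but
whose radius does not. Property A of these preimages gives functions on `X`; grouped by the colours
of a colouring, they become multipliers `m c x q` which depend on `q` only through `i` and are
therefore locally constant on the union of the `O i`. The sum `∑ c, m c x q * m c y q` is 1 for `x =
y` and close to 1 within the propagation of `T`. Hence `T` is close, entrywise and so in every
representation, to `U = ∑ m_c T_c m_c`, where `T_c` is `T` cut down to the points near centres of
colour `c`. Each `T_c` is block diagonal with blocks of bounded diameter, so the powers of `T_c *
star T_c` have bounded propagation; the finiteness estimate, applied to high powers, gives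
domination by the norm on `E` with constant 1 (`norm_map_le_of_block`). The multipliers are not in
the algebra, so a representation need not see them; but `m_c U*` and `m_c U U*` are, and a
Cauchy–Schwarz argument with these (`norm_le_of_partition`) bounds `U` by the pieces.

All this needs the twisted matrices to be an algebra. Under `hat` the product of `A(W)` becomes
pointwise, and `β` at a point becomes an automorphism of the Clifford algebra. Entries over
different subspaces are brought to a common one by `HasLift.enlarge`, where Hadamard's lemma removes
the singularity along `{0} × W`. -/

noncomputable section

set_option linter.unusedSectionVars false

universe u v w

/-! ### Clifford algebras and their reflections. -/

section Clifford

variable {W : Type w} [NormedAddCommGroup W] [InnerProductSpace ℝ W]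

/-- The member of a family at a representation. -/
def CliffordAmbient.val (a : CliffordAmbient W) (ρ : CliffordRep W) : ρ.K →L[ℂ] ρ.K :=
  (show lp (fun ρ : CliffordRep W => ρ.K →L[ℂ] ρ.K) ∞ from a) ρ

namespace CliffordAmbient

@[ext] theorem ext {a b : CliffordAmbient W} (h : ∀ ρ, a.val ρ = b.val ρ) : a = b :=
  lp.ext (funext h)

@[simp] theorem val_add (a b : CliffordAmbient W) (ρ) : (a + b).val ρ = a.val ρ + b.val ρ := rfl
@[simp] theorem val_sub (a b : CliffordAmbient W) (ρ) : (a - b).val ρ = a.val ρ - b.val ρ := rfl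
@[simp] theorem val_neg (a : CliffordAmbient W) (ρ) : (-a).val ρ = -a.val ρ := rfl
@[simp] theorem val_zero (ρ) : (0 : CliffordAmbient W).val ρ = 0 := rfl
@[simp] theorem val_one (ρ) : (1 : CliffordAmbient W).val ρ = 1 := rfl
@[simp] theorem val_mul (a b : CliffordAmbient W) (ρ) : (a * b).val ρ = a.val ρ * b.val ρ := rfl
@[simp] theorem val_star (a : CliffordAmbient W) (ρ) : (star a).val ρ = star (a.val ρ) := rfl
@[simp] theorem val_smul (c : ℂ) (a : CliffordAmbient W) (ρ) : (c • a).val ρ = c • a.val ρ := rfl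
@[simp] theorem val_real_smul (c : ℝ) (a : CliffordAmbient W) (ρ) :
    (c • a).val ρ = c • a.val ρ := rfl

theorem norm_val_le (a : CliffordAmbient W) (ρ) : ‖a.val ρ‖ ≤ ‖a‖ :=
  lp.norm_apply_le_norm (by simp) _ ρ

theorem norm_le {a : CliffordAmbient W} {C : ℝ} (hC : 0 ≤ C) (h : ∀ ρ, ‖a.val ρ‖ ≤ C) :
    ‖a‖ ≤ C :=
  lp.norm_le_of_forall_le hC h

end CliffordAmbient

@[simp] theorem val_cliff (v : W) (ρ) : (cliff v).val ρ = ρ.hom (CliffordAlgebra.ι _ v) := rfl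

theorem cliff_add (v w : W) : cliff (v + w) = cliff v + cliff w := by ext1 ρ; simp
theorem cliff_smul (c : ℝ) (v : W) : cliff (c • v) = c • cliff v := by ext1 ρ; simp
theorem cliff_neg (v : W) : cliff (-v) = -cliff v := by ext1 ρ; simp
theorem cliff_zero : cliff (0 : W) = 0 := by ext1 ρ; simp
theorem star_cliff (v : W) : star (cliff v) = cliff v := by
  ext1 ρ; simpa using (ρ.isSelfAdjoint v).star_eq

theorem cliff_mul_self (v : W) : cliff v * cliff v = ((‖v‖ ^ 2 : ℝ) • 1 : CliffordAmbient W) := by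
  ext1 ρ
  simp only [CliffordAmbient.val_mul, val_cliff, CliffordAmbient.val_real_smul,
    CliffordAmbient.val_one]
  rw [← map_mul, CliffordAlgebra.ι_sq_scalar, normSqForm_apply, AlgHom.commutes,
    Algebra.algebraMap_eq_smul_one]

theorem cliff_mul_add (v w : W) :
    cliff v * cliff w + cliff w * cliff v = ((2 * inner ℝ v w : ℝ) • 1 : CliffordAmbient W) := by
  have h := cliff_mul_self (v + w)
  rw [cliff_add, mul_add, add_mul, add_mul, cliff_mul_self, cliff_mul_self, norm_add_sq_real,
    add_smul, add_smul] at h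
  have : cliff v * cliff w + cliff w * cliff v =
    (((‖v‖ ^ 2 : ℝ) • 1 + cliff w * cliff v) + (cliff v * cliff w + (‖w‖ ^ 2 : ℝ) • 1)) -
      (‖v‖ ^ 2 : ℝ) • 1 - (‖w‖ ^ 2 : ℝ) • 1 := by abel
  rw [this, h]
  abel

/-- The quadratic-form isometry underlying a linear isometry. -/
def isometryOfLinearIsometry (U : W →ₗᵢ[ℝ] W) : normSqForm W →qᵢ normSqForm W where
  toLinearMap := U.toLinearMap
  map_app' v := by simp [normSqForm_apply]

/-- Restriction of a representation of the Clifford algebra along a linear isometry. -/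
def CliffordRep.comp (ρ : CliffordRep W) (U : W →ₗᵢ[ℝ] W) : CliffordRep W where
  K := ρ.K
  hom := ρ.hom.comp (CliffordAlgebra.map (isometryOfLinearIsometry U))
  isSelfAdjoint v := by
    simpa [isometryOfLinearIsometry] using! ρ.isSelfAdjoint (U v)

/-- The `*`-homomorphism of Clifford algebras induced by a linear isometry. -/
def CliffordAmbient.map (U : W →ₗᵢ[ℝ] W) : CliffordAmbient W →⋆ₐ[ℂ] CliffordAmbient W where
  toFun a := ⟨fun ρ => a.val (ρ.comp U), memℓp_infty ⟨‖a‖, by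
    rintro _ ⟨ρ, rfl⟩; exact a.norm_val_le (ρ.comp U)⟩⟩
  map_one' := rfl
  map_mul' _ _ := rfl
  map_zero' := rfl
  map_add' _ _ := rfl
  commutes' _ := rfl
  map_star' _ := rfl

theorem CliffordAmbient.map_val (U : W →ₗᵢ[ℝ] W) (a : CliffordAmbient W) (ρ) :
    (CliffordAmbient.map U a).val ρ = a.val (ρ.comp U) := rfl

theorem CliffordAmbient.norm_map_le (U : W →ₗᵢ[ℝ] W) (a : CliffordAmbient W) :
    ‖CliffordAmbient.map U a‖ ≤ ‖a‖ :=
  norm_le (norm_nonneg _) fun ρ => a.norm_val_le (ρ.comp U)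

theorem CliffordAmbient.map_cliff (U : W →ₗᵢ[ℝ] W) (v : W) :
    CliffordAmbient.map U (cliff v) = cliff (U v) := by
  ext1 ρ
  rw [map_val, val_cliff, val_cliff]
  change ρ.hom (CliffordAlgebra.map (isometryOfLinearIsometry U) (CliffordAlgebra.ι _ v)) = _
  rw [CliffordAlgebra.map_apply_ι]
  rfl

/-- The reflection in the hyperplane orthogonal to `x`, as a linear isometry. -/
def hyperRefl (x : W) : W →ₗᵢ[ℝ] W := ((ℝ ∙ x)ᗮ.reflection).toLinearIsometry

theorem hyperRefl_hyperRefl (x v : W) : hyperRefl x (hyperRefl x v) = v :=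
  (ℝ ∙ x)ᗮ.reflection_reflection v

theorem hyperRefl_of_inner {x v : W} (h : inner ℝ x v = 0) : hyperRefl x v = v :=
  Submodule.reflection_mem_subspace_eq_self (Submodule.mem_orthogonal_singleton_iff_inner_right.mpr h)

theorem hyperRefl_self (x : W) : hyperRefl x x = -x :=
  Submodule.reflection_orthogonalComplement_singleton_eq_neg x

theorem hyperRefl_sub {v w : W} (h : ‖v‖ = ‖w‖) : hyperRefl (v - w) v = w :=
  Submodule.reflection_sub h

/-- The `*`-automorphism of the Clifford algebra induced by a reflection. -/
def cliffRefl (x : W) : CliffordAmbient W →⋆ₐ[ℂ] CliffordAmbient W :=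
  CliffordAmbient.map (hyperRefl x)

theorem cliffRefl_cliff (x v : W) : cliffRefl x (cliff v) = cliff (hyperRefl x v) :=
  CliffordAmbient.map_cliff _ _

/-- An equality of representations is needed, not just an equivalence: elements of the ambient
algebra are arbitrary families indexed by representations, and only this makes `cliffRefl x` an
involution, hence isometric, on all of them. -/
theorem CliffordRep.comp_hyperRefl (ρ : CliffordRep W) (x : W) :
    (ρ.comp (hyperRefl x)).comp (hyperRefl x) = ρ := by
  obtain ⟨K, hom, sa⟩ := ρ
  have h : (hom.comp (CliffordAlgebra.map (isometryOfLinearIsometry (hyperRefl x)))).comp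
      (CliffordAlgebra.map (isometryOfLinearIsometry (hyperRefl x))) = hom := by
    refine CliffordAlgebra.hom_ext (LinearMap.ext fun v => ?_)
    simp only [AlgHom.comp_toLinearMap, LinearMap.comp_apply, AlgHom.toLinearMap_apply]
    rw [CliffordAlgebra.map_apply_ι, CliffordAlgebra.map_apply_ι]
    congr 2
    exact hyperRefl_hyperRefl x v
  simp only [CliffordRep.comp]
  congr

theorem cliffRefl_cliffRefl (x : W) (a : CliffordAmbient W) : cliffRefl x (cliffRefl x a) = a := by
  ext1 ρ
  unfold cliffRefl
  rw [CliffordAmbient.map_val, CliffordAmbient.map_val]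
  -- The type of a value depends on the index, so the index is changed under heterogeneous equality.
  have : ∀ ρ' ρ'' : CliffordRep W, ρ' = ρ'' → HEq (a.val ρ') (a.val ρ'') := by rintro _ _ rfl; rfl
  exact eq_of_heq (this _ _ (ρ.comp_hyperRefl x))

theorem norm_cliffRefl (x : W) (a : CliffordAmbient W) : ‖cliffRefl x a‖ = ‖a‖ := by
  refine le_antisymm (CliffordAmbient.norm_map_le _ _) ?_
  conv_lhs => rw [← cliffRefl_cliffRefl x a]
  exact CliffordAmbient.norm_map_le _ _

end Clifford

/-! ### Clifford subalgebras generated by subspaces of `H`. -/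

section CliffOf

variable {H : Type w} [NormedAddCommGroup H] [InnerProductSpace ℝ H]

/-- The vector `t e + h` of `ℝ ⊕ H`. -/
def vec (t : ℝ) (h : H) : WithLp 2 (ℝ × H) := WithLp.toLp 2 (t, h)

theorem inner_vec (s t : ℝ) (g h : H) : inner ℝ (vec s g) (vec t h) = s * t + inner ℝ g h := by
  simp [vec, WithLp.prod_inner_apply, mul_comm s]

theorem norm_vec_sq (t : ℝ) (h : H) : ‖vec t h‖ ^ 2 = t ^ 2 + ‖h‖ ^ 2 := by
  rw [← real_inner_self_eq_norm_sq, inner_vec, real_inner_self_eq_norm_sq, sq t]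

theorem norm_vec (t : ℝ) (h : H) : ‖vec t h‖ = √(t ^ 2 + ‖h‖ ^ 2) := by
  rw [← norm_vec_sq, Real.sqrt_sq (norm_nonneg _)]

theorem cl_eq (t : ℝ) (h : H) : cl t h = cliff (vec t h) := rfl

/-- The additional Clifford variable. -/
def cliffE : Coef H := cliff (vec 1 0)

theorem cl_add (s t : ℝ) (g h : H) : cl (s + t) (g + h) = cl s g + cl t h := cliff_add (vec s g) (vec t h)
theorem cl_smul (c t : ℝ) (h : H) : cl (c * t) (c • h) = c • cl t h := cliff_smul c (vec t h)
theorem star_cl (t : ℝ) (h : H) : star (cl t h) = cl t h := star_cliff _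

theorem cliffE_mul_self : (cliffE * cliffE : Coef H) = 1 := by
  rw [cliffE, cliff_mul_self, norm_vec_sq]; simp

theorem cliffE_mul_mul (a : Coef H) : cliffE * (cliffE * a) = a := by
  rw [← mul_assoc, cliffE_mul_self, one_mul]

theorem norm_cliffE_le : ‖(cliffE : Coef H)‖ ≤ 1 :=
  (norm_cliff_le _).trans (by rw [norm_vec]; simp)

theorem norm_cliffE_mul_le (a : Coef H) : ‖cliffE * a‖ ≤ ‖a‖ := by
  refine (norm_mul_le _ _).trans ?_
  nlinarith [norm_cliffE_le (H := H), norm_nonneg a]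

theorem cl_eq_add (t : ℝ) (h : H) : cl t h = t • cliffE + cl 0 h := by
  have := cl_add t 0 (0 : H) h
  rw [add_zero, zero_add] at this
  rw [this]
  congr 1
  have := cl_smul t 1 (0 : H)
  rwa [mul_one, smul_zero] at this

theorem real_smul_mem (S : StarSubalgebra ℂ (Coef H)) (c : ℝ) {a : Coef H} (h : a ∈ S) :
    c • a ∈ S := S.smul_mem h (c : ℂ)

theorem cl_mem_cliffOf {W : Submodule ℝ H} {h : H} (hh : h ∈ W) : cl 0 h ∈ cliffOf W :=
  StarAlgebra.subset_adjoin _ _ ⟨h, hh, rfl⟩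

theorem cliffOf_mono {W W' : Submodule ℝ H} (h : W ≤ W') : cliffOf W ≤ cliffOf W' :=
  StarAlgebra.adjoin_mono fun _ ⟨v, hv, e⟩ => ⟨v, h hv, e⟩

-- The generators are self-adjoint, so they generate the same algebra with or without the star, and
-- no case for the star arises.
@[elab_as_elim]
theorem cliffOf_induction {W : Submodule ℝ H} {P : ∀ c : Coef H, c ∈ cliffOf W → Prop}
    (mem : ∀ h (hh : h ∈ W), P (cl 0 h) (cl_mem_cliffOf hh))
    (algebraMap : ∀ z : ℂ, P (algebraMap ℂ _ z) (algebraMap_mem _ z))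
    (add : ∀ c d hc hd, P c hc → P d hd → P (c + d) (add_mem hc hd))
    (mul : ∀ c d hc hd, P c hc → P d hd → P (c * d) (mul_mem hc hd)) {c : Coef H}
    (hc : c ∈ cliffOf W) : P c hc := by
  have e : (cliffOf W).toSubalgebra = Algebra.adjoin ℂ {a | ∃ h ∈ W, a = cl 0 h} := by
    rw [cliffOf, StarAlgebra.adjoin_toSubalgebra, Set.union_eq_left.mpr]
    rintro a ⟨h, hh, e⟩
    refine ⟨h, hh, ?_⟩
    rw [← star_star a, e, star_cl]
  have key : ∀ {d}, d ∈ Algebra.adjoin ℂ {a : Coef H | ∃ h ∈ W, a = cl 0 h} ↔ d ∈ cliffOf W := by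
    intro d
    rw [← e]; rfl
  suffices h : ∀ d ∈ Algebra.adjoin ℂ {a : Coef H | ∃ h ∈ W, a = cl 0 h},
      ∀ hd : d ∈ cliffOf W, P d hd from h c (key.mpr hc) hc
  intro d hd
  induction hd using Algebra.adjoin_induction with
  | mem c hc => obtain ⟨h, hh, rfl⟩ := hc; exact fun _ => mem h hh
  | algebraMap z => exact fun _ => algebraMap z
  | add c d hc hd ihc ihd =>
    exact fun _ => add c d (key.mp hc) (key.mp hd) (ihc _) (ihd _)
  | mul c d hc hd ihc ihd =>
    exact fun _ => mul c d (key.mp hc) (key.mp hd) (ihc _) (ihd _)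

/-- Anticommutation moves `x` to the left at the cost of a scalar. This normal form makes `cliffOf W
+ x * cliffOf W` an algebra, so finite dimension follows by adding one vector at a time. -/
theorem mul_cliff_mem (W : Submodule ℝ H) (x : WithLp 2 (ℝ × H)) {c : Coef H} (hc : c ∈ cliffOf W) :
    ∃ a ∈ cliffOf W, ∃ b ∈ cliffOf W, c * cliff x = a + cliff x * b := by
  induction hc using cliffOf_induction with
  | mem h hh =>
    refine ⟨(2 * inner ℝ (vec 0 h) x : ℝ) • 1, real_smul_mem _ _ (one_mem _), -cl 0 h,
      neg_mem (cl_mem_cliffOf hh), ?_⟩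
    rw [cl_eq, ← cliff_mul_add, mul_neg]
    abel
  | algebraMap z =>
    exact ⟨0, zero_mem _, algebraMap ℂ _ z, algebraMap_mem _ z, by
      rw [zero_add, Algebra.commutes]⟩
  | add c d hc hd ihc ihd =>
    obtain ⟨a, ha, b, hb, e⟩ := ihc
    obtain ⟨a', ha', b', hb', e'⟩ := ihd
    exact ⟨a + a', add_mem ha ha', b + b', add_mem hb hb', by rw [add_mul, e, e', mul_add]; abel⟩
  | mul c d hc hd ihc ihd =>
    obtain ⟨a, ha, b, hb, e⟩ := ihc
    obtain ⟨a', ha', b', hb', e'⟩ := ihd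
    refine ⟨c * a' + a * b', add_mem (mul_mem hc ha') (mul_mem ha hb'), b * b', mul_mem hb hb', ?_⟩
    rw [mul_assoc, e', mul_add, ← mul_assoc, e]
    noncomm_ring

/-- The `*`-algebra generated by `cliffOf W` and a further vector `x`. -/
def cliffExt (W : Submodule ℝ H) (x : WithLp 2 (ℝ × H)) : StarSubalgebra ℂ (Coef H) where
  carrier := {c | ∃ a ∈ cliffOf W, ∃ b ∈ cliffOf W, c = a + cliff x * b}
  mul_mem' := by
    rintro _ _ ⟨a, ha, b, hb, rfl⟩ ⟨c, hc, d, hd, rfl⟩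
    obtain ⟨a₁, ha₁, a₂, ha₂, e⟩ := mul_cliff_mem W x ha
    obtain ⟨b₁, hb₁, b₂, hb₂, e'⟩ := mul_cliff_mem W x hb
    refine ⟨a * c + a₁ * d + (‖x‖ ^ 2 : ℝ) • (b₂ * d), add_mem (add_mem (mul_mem ha hc)
      (mul_mem ha₁ hd)) (real_smul_mem _ _ (mul_mem hb₂ hd)), a₂ * d + b * c + b₁ * d,
      add_mem (add_mem (mul_mem ha₂ hd) (mul_mem hb hc)) (mul_mem hb₁ hd), ?_⟩
    have h1 : (a + cliff x * b) * (c + cliff x * d) =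
        a * c + (a * cliff x) * d + cliff x * (b * c) + cliff x * ((b * cliff x) * d) := by
      noncomm_ring
    have h2 : (‖x‖ ^ 2 : ℝ) • (b₂ * d) = cliff x * cliff x * (b₂ * d) := by
      rw [cliff_mul_self, smul_mul_assoc, one_mul]
    rw [h1, e, e', h2]
    noncomm_ring
  add_mem' := by
    rintro _ _ ⟨a, ha, b, hb, rfl⟩ ⟨c, hc, d, hd, rfl⟩
    exact ⟨a + c, add_mem ha hc, b + d, add_mem hb hd, by rw [mul_add]; abel⟩
  algebraMap_mem' z := ⟨algebraMap ℂ _ z, algebraMap_mem _ z, 0, zero_mem _, by simp⟩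
  star_mem' := by
    rintro _ ⟨a, ha, b, hb, rfl⟩
    obtain ⟨b₁, hb₁, b₂, hb₂, e⟩ := mul_cliff_mem W x (star_mem hb)
    refine ⟨star a + b₁, add_mem (star_mem ha) hb₁, b₂, hb₂, ?_⟩
    rw [star_add, star_mul, star_cliff, e, add_assoc]

theorem cliffOf_le_cliffExt (W : Submodule ℝ H) (x : WithLp 2 (ℝ × H)) :
    cliffOf W ≤ cliffExt W x := fun a ha => ⟨a, ha, 0, zero_mem _, by simp⟩

theorem cliff_mem_cliffExt (W : Submodule ℝ H) (x : WithLp 2 (ℝ × H)) :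
    cliff x ∈ cliffExt W x := ⟨0, zero_mem _, 1, one_mem _, by simp⟩

theorem cliffExt_finiteDimensional (W : Submodule ℝ H) (x : WithLp 2 (ℝ × H))
    [FiniteDimensional ℂ (cliffOf W)] : FiniteDimensional ℂ (cliffExt W x) := by
  let A := Subalgebra.toSubmodule (cliffOf W).toSubalgebra
  have hA : FiniteDimensional ℂ A := inferInstanceAs (FiniteDimensional ℂ (cliffOf W))
  let B := A.map (LinearMap.mulLeft ℂ (cliff x))
  have hle : Subalgebra.toSubmodule (cliffExt W x).toSubalgebra ≤ A ⊔ B := by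
    rintro _ ⟨a, ha, b, hb, rfl⟩
    exact Submodule.add_mem_sup ha ⟨b, hb, rfl⟩
  exact Submodule.finiteDimensional_of_le hle

theorem cliffOf_finiteDimensional (W : Submodule ℝ H) [FiniteDimensional ℝ W] :
    FiniteDimensional ℂ (cliffOf W) := by
  classical
  obtain ⟨s, rfl⟩ : W.FG := (Submodule.fg_iff_finiteDimensional W).mpr ‹_›
  induction s using Finset.induction_on with
  | empty =>
    have hle : Subalgebra.toSubmodule (cliffOf (Submodule.span ℝ ((∅ : Finset H) : Set H))).toSubalgebra ≤
        Submodule.span ℂ {(1 : Coef H)} := by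
      intro c hc
      induction hc using cliffOf_induction with
      | mem h hh =>
        have : h = 0 := by simpa using hh
        rw [this, cl_eq_add, cl_eq]
        have : (vec 0 0 : WithLp 2 (ℝ × H)) = 0 := rfl
        simp [this, cliff_zero]
      | algebraMap z =>
        exact Submodule.mem_span_singleton.mpr ⟨z, (Algebra.algebraMap_eq_smul_one z).symm⟩
      | add c d hc hd ihc ihd => exact add_mem ihc ihd
      | mul c d hc hd ihc ihd =>
        obtain ⟨y, rfl⟩ := Submodule.mem_span_singleton.mp ihc
        obtain ⟨z, rfl⟩ := Submodule.mem_span_singleton.mp ihd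
        exact Submodule.mem_span_singleton.mpr ⟨y * z, by rw [smul_mul_smul_comm, one_mul]⟩
    exact Submodule.finiteDimensional_of_le hle
  | insert v s hv ih =>
    have := cliffExt_finiteDimensional (Submodule.span ℝ (s : Set H)) (vec 0 v)
    have hle : cliffOf (Submodule.span ℝ ((insert v s : Finset H) : Set H)) ≤
        cliffExt (Submodule.span ℝ (s : Set H)) (vec 0 v) := by
      refine StarAlgebra.adjoin_le ?_
      rintro _ ⟨h, hh, rfl⟩
      rw [Finset.coe_insert, Submodule.mem_span_insert] at hh
      obtain ⟨c, g, hg, rfl⟩ := hh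
      have e := cl_add 0 0 (c • v) g
      have e' := cl_smul c 0 v
      rw [mul_zero] at e'
      rw [add_zero, e'] at e
      rw [SetLike.mem_coe, e]
      exact add_mem (real_smul_mem _ _ (cliff_mem_cliffExt _ _))
        (cliffOf_le_cliffExt _ _ (cl_mem_cliffOf hg))
    have hle' : Subalgebra.toSubmodule (cliffOf (Submodule.span ℝ
        ((insert v s : Finset H) : Set H))).toSubalgebra ≤ Subalgebra.toSubmodule
        (cliffExt (Submodule.span ℝ (s : Set H)) (vec 0 v)).toSubalgebra := hle
    exact Submodule.finiteDimensional_of_le hle'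

/-- Closedness keeps derivatives, as limits of difference quotients, in `Cliff(W)`; its analogue for
`cliffHat` does the same for Neumann series. -/
theorem isClosed_cliffOf (W : Submodule ℝ H) [FiniteDimensional ℝ W] :
    IsClosed (cliffOf W : Set (Coef H)) := by
  have := cliffOf_finiteDimensional W
  exact Submodule.closed_of_finiteDimensional (Subalgebra.toSubmodule (cliffOf W).toSubalgebra)

/-- The Clifford algebra of `ℝ ⊕ W`. -/
abbrev cliffHat (W : Submodule ℝ H) : StarSubalgebra ℂ (Coef H) := cliffExt W (vec 1 0)

theorem isClosed_cliffHat (W : Submodule ℝ H) [FiniteDimensional ℝ W] :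
    IsClosed (cliffHat W : Set (Coef H)) := by
  have := cliffOf_finiteDimensional W
  have := cliffExt_finiteDimensional W (vec 1 0)
  exact Submodule.closed_of_finiteDimensional (Subalgebra.toSubmodule (cliffHat W).toSubalgebra)

theorem cliffRefl_of_mem {W : Submodule ℝ H} {x : WithLp 2 (ℝ × H)}
    (hx : ∀ h ∈ W, inner ℝ x (vec 0 h) = 0) {a : Coef H} (ha : a ∈ cliffOf W) :
    cliffRefl x a = a := by
  induction ha using cliffOf_induction with
  | mem h hh => rw [cl_eq, cliffRefl_cliff, hyperRefl_of_inner (hx h hh)]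
  | algebraMap z => exact (cliffRefl x).toAlgHom.commutes z
  | add c d hc hd ihc ihd => rw [map_add, ihc, ihd]
  | mul c d hc hd ihc ihd => rw [map_mul, ihc, ihd]

/-- The automorphism of the Clifford algebra which changes the sign of the additional variable. -/
def cliffSign : Coef H →⋆ₐ[ℂ] Coef H := cliffRefl (vec 1 0)

theorem cliffSign_of_mem {W : Submodule ℝ H} {a : Coef H} (ha : a ∈ cliffOf W) : cliffSign a = a :=
  cliffRefl_of_mem (fun h _ => by rw [inner_vec]; simp) ha

theorem cliffSign_cliffE : cliffSign (cliffE : Coef H) = -cliffE := by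
  rw [cliffSign, cliffE, cliffRefl_cliff, hyperRefl_self, cliff_neg]

end CliffOf

/-! ### Elements of `A(W)` as functions with pointwise product. -/

section Lift

variable {H : Type w} [NormedAddCommGroup H] [InnerProductSpace ℝ H]

@[ext] theorem BddFun.ext {a b : BddFun H} (h : ∀ q, a.val q = b.val q) : a = b :=
  lp.ext (funext h)

theorem BddFun.norm_val_le (a : BddFun H) (q : RPlus H) : ‖a.val q‖ ≤ ‖a‖ :=
  lp.norm_apply_le_norm (by simp) _ q

theorem BddFun.norm_le {a : BddFun H} {C : ℝ} (hC : 0 ≤ C) (h : ∀ q, ‖a.val q‖ ≤ C) : ‖a‖ ≤ C :=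
  lp.norm_le_of_forall_le hC h

@[simp] theorem BddFun.val_add (a b : BddFun H) (q) : (a + b).val q = a.val q + b.val q := rfl
@[simp] theorem BddFun.val_sub (a b : BddFun H) (q) : (a - b).val q = a.val q - b.val q := rfl
@[simp] theorem BddFun.val_neg (a : BddFun H) (q) : (-a).val q = -a.val q := rfl
@[simp] theorem BddFun.val_mul (a b : BddFun H) (q) : (a * b).val q = a.val q * b.val q := rfl
@[simp] theorem BddFun.val_star (a : BddFun H) (q) : (star a).val q = star (a.val q) := rfl
@[simp] theorem BddFun.val_smul (c : ℂ) (a : BddFun H) (q) : (c • a).val q = c • a.val q := rfl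
@[simp] theorem BddFun.val_zero (q) : (0 : BddFun H).val q = 0 := rfl

section Lin

variable (W : Submodule ℝ H)

/-- `C₀`-functions on `ℝ × W` with values in the ambient Clifford algebra. -/
abbrev C0W : Type _ := ZeroAtInftyContinuousMap (ℝ × W) (Coef H)

variable {W}

theorem tendsto_negFst : Tendsto (fun q : ℝ × W => ((-q.1, q.2) : ℝ × W))
    (cocompact _) (cocompact _) :=
  ((Homeomorph.neg ℝ).prodCongr (Homeomorph.refl W)).isClosedEmbedding.tendsto_cocompact

/-- Pull-back along `(s, w) ↦ (-s, w)`. -/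
def negFst (F : C0W W) : C0W W where
  toFun q := F (-q.1, q.2)
  continuous_toFun := by fun_prop
  zero_at_infty' := F.zero_at_infty'.comp tendsto_negFst

@[simp] theorem negFst_apply (F : C0W W) (q) : negFst F q = F (-q.1, q.2) := rfl

/-- Left multiplication by a constant. -/
def constMul (a : Coef H) (F : C0W W) : C0W W where
  toFun q := a * F q
  continuous_toFun := by fun_prop
  zero_at_infty' := by simpa using! F.zero_at_infty'.const_mul a

@[simp] theorem constMul_apply (a : Coef H) (F : C0W W) (q) : constMul a F q = a * F q := rfl

/-- The even part in the first variable. -/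
def evenPart (F : C0W W) (q : ℝ × W) : Coef H := (2⁻¹ : ℝ) • (F q + F (-q.1, q.2))

/-- The odd part in the first variable. -/
def oddPart (F : C0W W) (q : ℝ × W) : Coef H := (2⁻¹ : ℝ) • (F q - F (-q.1, q.2))

theorem evenPart_add_oddPart (F : C0W W) (q) : evenPart F q + oddPart F q = F q := by
  simp only [evenPart, oddPart]; module

theorem evenPart_neg (F : C0W W) (s w) : evenPart F (-s, w) = evenPart F (s, w) := by
  simp only [evenPart, neg_neg]; module

theorem oddPart_neg (F : C0W W) (s w) : oddPart F (-s, w) = -oddPart F (s, w) := by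
  simp only [oddPart, neg_neg]; module

/-- The transformation which multiplies the odd part of a function by the additional Clifford
variable. It turns the graded tensor product into the pointwise one. -/
def hat (F : C0W W) : C0W W :=
  (2⁻¹ : ℂ) • (F + negFst F) + constMul cliffE ((2⁻¹ : ℂ) • (F - negFst F))

theorem hat_apply (F : C0W W) (q) : hat F q = evenPart F q + cliffE * oddPart F q := by
  have (a : Coef H) : (2⁻¹ : ℂ) • a = (2⁻¹ : ℝ) • a := by
    rw [← Complex.coe_smul]; simp
  simp [hat, evenPart, oddPart, this]

theorem evenPart_hat (F : C0W W) (q) : evenPart (hat F) q = evenPart F q := by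
  obtain ⟨s, w⟩ := q
  rw [evenPart]
  simp only [hat_apply, evenPart_neg, oddPart_neg, mul_neg]
  module

theorem oddPart_hat (F : C0W W) (q) : oddPart (hat F) q = cliffE * oddPart F q := by
  obtain ⟨s, w⟩ := q
  rw [oddPart]
  simp only [hat_apply, evenPart_neg, oddPart_neg, mul_neg]
  module

/-- Left multiplication by `cliffE` squares to the identity, so `hat` is its own inverse. -/
theorem hat_hat (F : C0W W) : hat (hat F) = F := by
  ext1 q
  rw [hat_apply, evenPart_hat, oddPart_hat, cliffE_mul_mul, evenPart_add_oddPart]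

theorem evenPart_mem {F : C0W W} (hF : F ∈ AFun W) (q) : evenPart F q ∈ cliffOf W :=
  real_smul_mem _ _ (add_mem (hF _) (hF _))

theorem oddPart_mem {F : C0W W} (hF : F ∈ AFun W) (q) : oddPart F q ∈ cliffOf W :=
  real_smul_mem _ _ (sub_mem (hF _) (hF _))

theorem norm_hat_le {F : C0W W} {c : ℝ} (h : ∀ q, ‖F q‖ ≤ c) (q) : ‖hat F q‖ ≤ 2 * c := by
  have h1 : ‖evenPart F q‖ ≤ c := by
    rw [evenPart, norm_smul, Real.norm_of_nonneg (by norm_num)]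
    linarith [norm_add_le (F q) (F (-q.1, q.2)), h q, h (-q.1, q.2)]
  have h2 : ‖oddPart F q‖ ≤ c := by
    rw [oddPart, norm_smul, Real.norm_of_nonneg (by norm_num)]
    linarith [norm_sub_le (F q) (F (-q.1, q.2)), h q, h (-q.1, q.2)]
  rw [hat_apply]
  linarith [norm_add_le (evenPart F q) (cliffE * oddPart F q), norm_cliffE_mul_le (oddPart F q)]

/-- The functions on `ℝ × W` which correspond to elements of `A(W)` in such a way that their
products are pointwise. -/
structure IsHat (Φ : C0W W) : Prop where
  mem : ∀ q, Φ q ∈ cliffHat W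
  symm : ∀ s w, Φ (-s, w) = cliffSign (Φ (s, w))

theorem isHat_hat {F : C0W W} (hF : F ∈ AFun W) : IsHat (hat F) where
  mem q := ⟨_, evenPart_mem hF q, _, oddPart_mem hF q, hat_apply F q⟩
  symm s w := by
    rw [hat_apply, hat_apply, map_add, map_mul, cliffSign_of_mem (evenPart_mem hF _),
      cliffSign_of_mem (oddPart_mem hF _), cliffSign_cliffE, evenPart_neg, oddPart_neg]
    simp

/-- The symmetry forces the even part into `cliffOf W` and the odd part into `cliffE * cliffOf W`,
because `cliffSign` fixes the former and negates the latter. -/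
theorem IsHat.hat_mem {Φ : C0W W} (h : IsHat Φ) : hat Φ ∈ AFun W := by
  rintro ⟨s, w⟩
  obtain ⟨a, ha, b, hb, e⟩ := h.mem (s, w)
  have e' : Φ (-s, w) = a - cliffE * b := by
    rw [h.symm, e, map_add, map_mul, cliffSign_of_mem ha, cliffSign_of_mem hb]
    change a + cliffSign cliffE * b = _
    rw [cliffSign_cliffE]; simp [sub_eq_add_neg]
  have h1 : evenPart Φ (s, w) = a := by
    simp only [evenPart, e, e']
    change (2⁻¹ : ℝ) • (a + cliffE * b + (a - cliffE * b)) = a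
    module
  have h2 : oddPart Φ (s, w) = cliffE * b := by
    simp only [oddPart, e, e']
    change (2⁻¹ : ℝ) • (a + cliffE * b - (a - cliffE * b)) = cliffE * b
    module
  rw [hat_apply, h1, h2, cliffE_mul_mul]
  exact add_mem ha hb

theorem IsHat.norm_neg {Φ : C0W W} (h : IsHat Φ) (s w) : ‖Φ (-s, w)‖ = ‖Φ (s, w)‖ := by
  rw [h.symm]; exact norm_cliffRefl _ _

theorem IsHat.norm_abs {Φ : C0W W} (h : IsHat Φ) (s w) : ‖Φ (|s|, w)‖ = ‖Φ (s, w)‖ := by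
  rcases abs_choice s with e | e <;> rw [e]
  exact h.norm_neg s w

theorem IsHat.zero : IsHat (0 : C0W W) where
  mem _ := zero_mem _
  symm _ _ := (map_zero _).symm

theorem IsHat.add {Φ Ψ : C0W W} (h : IsHat Φ) (h' : IsHat Ψ) : IsHat (Φ + Ψ) where
  mem q := add_mem (h.mem q) (h'.mem q)
  symm s w := by simp [h.symm, h'.symm]

theorem IsHat.mul {Φ Ψ : C0W W} (h : IsHat Φ) (h' : IsHat Ψ) : IsHat (Φ * Ψ) where
  mem q := mul_mem (h.mem q) (h'.mem q)
  symm s w := by simp [h.symm, h'.symm]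

theorem IsHat.star {Φ : C0W W} (h : IsHat Φ) : IsHat (star Φ) where
  mem q := star_mem (h.mem q)
  symm s w := by simp [h.symm, map_star]

theorem IsHat.smul {Φ : C0W W} (h : IsHat Φ) (c : ℂ) : IsHat (c • Φ) where
  mem q := (cliffHat W).smul_mem (h.mem q) c
  symm s w := by simp [h.symm, map_smul]

end Lin

section Beta

variable (W : Submodule ℝ H) [FiniteDimensional ℝ W]

/-- The unit vector onto which the additional variable is moved at the point `q`. -/
def unitAt (q : RPlus H) : WithLp 2 (ℝ × H) :=
  -- At radius zero any unit vector orthogonal to `W` would do, since odd parts vanish there.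
  open Classical in if rad W q = 0 then vec 1 0 else
    (rad W q)⁻¹ • vec (q.1 : ℝ) (q.2 - W.orthogonalProjectionOnto q.2)

theorem norm_unitAt (q : RPlus H) : ‖unitAt W q‖ = 1 := by
  unfold unitAt
  split_ifs with h
  · rw [norm_vec]; simp
  · have hr : ‖rad W q‖ = rad W q := Real.norm_of_nonneg (Real.sqrt_nonneg _)
    rw [norm_smul, norm_vec, norm_inv, hr]
    exact inv_mul_cancel₀ h

theorem inner_unitAt (q : RPlus H) {h : H} (hh : h ∈ W) : inner ℝ (unitAt W q) (vec 0 h) = 0 := by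
  have h1 : inner ℝ (q.2 - W.orthogonalProjectionOnto q.2) h = 0 := by
    exact W.starProjection_inner_eq_zero q.2 h hh
  unfold unitAt
  split_ifs with h
  · rw [inner_vec]; simp
  · rw [inner_smul_left, inner_vec, h1]; simp

/-- The rotation of the Clifford algebra at the point `q`. -/
def rotAt (q : RPlus H) : Coef H →⋆ₐ[ℂ] Coef H := cliffRefl (vec 1 0 - unitAt W q)

/-- `vec 1 0` and `unitAt W q` are unit vectors orthogonal to `W`, so the reflection along their
difference exchanges them and fixes `W`. The functional calculus in `beta` thus becomes an
automorphism at each point, which makes `beta` multiplicative and isometric on functions in `hat`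
form. -/
theorem rotAt_of_mem (q : RPlus H) {a : Coef H} (ha : a ∈ cliffOf W) : rotAt W q a = a :=
  cliffRefl_of_mem (fun h hh => by
    rw [inner_sub_left, inner_unitAt W q hh, inner_vec]; simp) ha

theorem rotAt_cliffE (q : RPlus H) : rotAt W q cliffE = cliff (unitAt W q) := by
  rw [rotAt, cliffE, cliffRefl_cliff, hyperRefl_sub]
  rw [norm_unitAt, norm_vec]; simp

theorem norm_rotAt (q : RPlus H) (a : Coef H) : ‖rotAt W q a‖ = ‖a‖ := norm_cliffRefl _ _

/-- The value at `q` of the image of an element of `A(W)` in `A(V)`, in terms of the function to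
which it corresponds under `hat`. -/
def hatAt (Φ : C0W W) (q : RPlus H) : Coef H :=
  rotAt W q (Φ (rad W q, W.orthogonalProjectionOnto q.2))

theorem norm_hatAt (Φ : C0W W) (q : RPlus H) :
    ‖hatAt W Φ q‖ = ‖Φ (rad W q, W.orthogonalProjectionOnto q.2)‖ := norm_rotAt _ _ _

theorem rad_mul_cliff_unitAt (q : RPlus H) :
    rad W q • cliff (unitAt W q) = cl (q.1 : ℝ) (q.2 - W.orthogonalProjectionOnto q.2) := by
  by_cases h : rad W q = 0
  · have h2 := norm_cl_le (q.1 : ℝ) (q.2 - W.orthogonalProjectionOnto q.2)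
    rw [h, zero_smul, eq_comm, ← norm_eq_zero]
    exact le_antisymm (h2.trans h.le) (norm_nonneg _)
  · rw [← cliff_smul, unitAt, if_neg h, smul_inv_smul₀ h]
    rfl

theorem betaFun_eq (F : C0W W) (q : RPlus H) :
    betaFun W F q = evenPart F (rad W q, W.orthogonalProjectionOnto q.2) +
      cliff (unitAt W q) * oddPart F (rad W q, W.orthogonalProjectionOnto q.2) := by
  rw [betaFun, evenPart, oddPart]
  congr 1
  rw [← rad_mul_cliff_unitAt, smul_mul_assoc, smul_smul, mul_smul_comm]
  by_cases h : rad W q = 0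
  · simp [h]
  · rw [mul_assoc, inv_mul_cancel₀ h, mul_one]

theorem beta_val_eq {F : C0W W} (hF : F ∈ AFun W) (q : RPlus H) :
    (beta W F).val q = hatAt W (hat F) q := by
  rw [hatAt, hat_apply, map_add, map_mul, rotAt_of_mem _ _ (evenPart_mem hF _),
    rotAt_of_mem _ _ (oddPart_mem hF _), rotAt_cliffE]
  exact betaFun_eq W F q

theorem IsHat.beta_val {Φ : C0W W} (h : IsHat Φ) (q : RPlus H) :
    (beta W (hat Φ)).val q = hatAt W Φ q := by
  rw [beta_val_eq W h.hat_mem, hat_hat]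

/-- The point `(|s|, w)` of `ℝ₊ × H`. -/
def absPt {W : Submodule ℝ H} (q : ℝ × W) : RPlus H := (⟨|q.1|, abs_nonneg _⟩, (q.2 : H))

theorem rad_absPt (q : ℝ × W) : rad W (absPt q) = |q.1| := by
  have : (absPt q).2 = q.2 := rfl
  rw [rad, this, W.orthogonalProjectionOnto_mem_subspace_eq_self, sub_self, norm_zero]
  change √(|q.1| ^ 2 + 0 ^ 2) = |q.1|
  simp [Real.sqrt_sq_eq_abs]

theorem proj_absPt (q : ℝ × W) : W.orthogonalProjectionOnto (absPt q).2 = q.2 :=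
  W.orthogonalProjectionOnto_mem_subspace_eq_self q.2

/-- At the points of `ℝ₊ × W` radius and projection are the coordinates themselves, so all norms of
values of `Φ` can be read off from its image. -/
theorem IsHat.norm_hatAt_absPt {Φ : C0W W} (h : IsHat Φ) (q : ℝ × W) :
    ‖hatAt W Φ (absPt q)‖ = ‖Φ q‖ := by
  rw [norm_hatAt, rad_absPt, proj_absPt]
  exact h.norm_abs _ _

end Beta

section C1

variable {W : Submodule ℝ H}

/-- All directional derivatives of `Φ` in unit directions exist, are `C₀`-functions and are bounded
by `c`. -/
def C1Bound (c : ℝ) (Φ : C0W W) : Prop :=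
  ∀ (s : ℝ) (h : W), √(s ^ 2 + ‖h‖ ^ 2) ≤ 1 → ∃ Ψ : C0W W,
    (∀ q, HasLineDerivAt ℝ Φ (Ψ q) q (s, h)) ∧ ∀ q, ‖Ψ q‖ ≤ c

theorem HasLineDerivAt.negFst {Φ : C0W W} {d : Coef H} {q : ℝ × W} {s : ℝ} {h : W}
    (hd : HasLineDerivAt ℝ Φ d (-q.1, q.2) (-s, h)) :
    HasLineDerivAt ℝ (_root_.negFst Φ) d q (s, h) := by
  unfold HasLineDerivAt at *
  refine hd.congr_of_eventuallyEq (Eventually.of_forall fun t => ?_)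
  change Φ _ = Φ _
  congr 1
  ext <;> simp; ring

/-- Even and odd part each contribute `c`. The reflected function is differentiated in the reflected
direction `(-s, v)`. -/
theorem C1Bound.hat {c : ℝ} {Φ : C0W W} (h : C1Bound c Φ) : C1Bound (2 * c) (hat Φ) := by
  intro s v hv
  obtain ⟨Ψ, h1, h2⟩ := h s v hv
  obtain ⟨Ψ', h1', h2'⟩ := h (-s) v (by simpa using hv)
  refine ⟨(2⁻¹ : ℂ) • (Ψ + negFst Ψ') + constMul cliffE ((2⁻¹ : ℂ) • (Ψ - negFst Ψ')),
    fun q => ?_, fun q => ?_⟩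
  · have e1 := h1 q
    have e2 := (h1' (-q.1, q.2)).negFst
    exact ((e1.add e2).const_smul (2⁻¹ : ℂ)).add
      (((e1.sub e2).const_smul (2⁻¹ : ℂ)).const_mul cliffE)
  · have e1 := h2 q
    have e2 := h2' (-q.1, q.2)
    have hn : ‖(2⁻¹ : ℂ)‖ = 2⁻¹ := by simp
    have n1 : ‖(2⁻¹ : ℂ) • (Ψ q + Ψ' (-q.1, q.2))‖ ≤ c := by
      rw [norm_smul, hn]; linarith [norm_add_le (Ψ q) (Ψ' (-q.1, q.2))]
    have n2 : ‖(2⁻¹ : ℂ) • (Ψ q - Ψ' (-q.1, q.2))‖ ≤ c := by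
      rw [norm_smul, hn]; linarith [norm_sub_le (Ψ q) (Ψ' (-q.1, q.2))]
    change ‖(2⁻¹ : ℂ) • (Ψ q + Ψ' (-q.1, q.2)) + cliffE * ((2⁻¹ : ℂ) • (Ψ q - Ψ' (-q.1, q.2)))‖ ≤ _
    refine (norm_add_le _ _).trans ?_
    linarith [norm_cliffE_mul_le ((2⁻¹ : ℂ) • (Ψ q - Ψ' (-q.1, q.2)))]

theorem C1Bound.mono {c c' : ℝ} {Φ : C0W W} (h : C1Bound c Φ) (hc : c ≤ c') : C1Bound c' Φ :=
  fun s v hv => (h s v hv).imp fun _ hΨ => ⟨hΨ.1, fun q => (hΨ.2 q).trans hc⟩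

theorem C1Bound.nonneg {c : ℝ} {Φ : C0W W} (h : C1Bound c Φ) : 0 ≤ c := by
  obtain ⟨Ψ, -, h⟩ := h 0 0 (by simp)
  exact (norm_nonneg _).trans (h 0)

theorem C1Bound.zero : C1Bound 0 (0 : C0W W) := fun s h _ =>
  ⟨0, fun q => hasDerivAt_const _ _, fun q => by simp⟩

theorem C1Bound.add {c c' : ℝ} {Φ Φ' : C0W W} (h : C1Bound c Φ) (h' : C1Bound c' Φ') :
    C1Bound (c + c') (Φ + Φ') := by
  intro s v hv
  obtain ⟨Ψ, h1, h2⟩ := h s v hv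
  obtain ⟨Ψ', h1', h2'⟩ := h' s v hv
  exact ⟨Ψ + Ψ', fun q => HasDerivAt.add (h1 q) (h1' q), fun q =>
    (norm_add_le _ _).trans (add_le_add (h2 q) (h2' q))⟩

theorem C1Bound.smul {c : ℝ} {Φ : C0W W} (h : C1Bound c Φ) (z : ℂ) :
    C1Bound (‖z‖ * c) (z • Φ) := by
  intro s v hv
  obtain ⟨Ψ, h1, h2⟩ := h s v hv
  refine ⟨z • Ψ, fun q => HasDerivAt.const_smul z (h1 q), fun q => ?_⟩
  change ‖z • Ψ q‖ ≤ _
  rw [norm_smul]; gcongr; exact h2 q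

theorem C1Bound.star {c : ℝ} {Φ : C0W W} (h : C1Bound c Φ) : C1Bound c (star Φ) := by
  intro s v hv
  obtain ⟨Ψ, h1, h2⟩ := h s v hv
  exact ⟨Star.star Ψ, fun q => HasDerivAt.star (h1 q), fun q => (norm_star (Ψ q)).trans_le (h2 q)⟩

theorem C1Bound.mul {c c' M M' : ℝ} {Φ Φ' : C0W W} (h : C1Bound c Φ) (h' : C1Bound c' Φ')
    (hM : ∀ q, ‖Φ q‖ ≤ M) (hM' : ∀ q, ‖Φ' q‖ ≤ M') : C1Bound (c * M' + M * c') (Φ * Φ') := by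
  intro s v hv
  have hc := h.nonneg
  have hM0 : 0 ≤ M := (norm_nonneg _).trans (hM 0)
  obtain ⟨Ψ, h1, h2⟩ := h s v hv
  obtain ⟨Ψ', h1', h2'⟩ := h' s v hv
  refine ⟨Ψ * Φ' + Φ * Ψ', fun q => ?_, fun q => ?_⟩
  · have := HasDerivAt.mul (h1 q) (h1' q)
    simpa [HasLineDerivAt] using! this
  · change ‖Ψ q * Φ' q + Φ q * Ψ' q‖ ≤ _
    refine (norm_add_le _ _).trans (add_le_add ((norm_mul_le _ _).trans ?_)
      ((norm_mul_le _ _).trans ?_))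
    · gcongr; exacts [h2 q, hM' q]
    · gcongr; exacts [hM q, h2' q]

end C1

/-! ### Quasi-inverses of differentiable elements. -/

section QuasiInverse

variable {A : Type*} [NormedRing A] [CompleteSpace A]

theorem quasiInverse_eq_left {a : A} (h : ‖a‖ < 1) :
    Ring.inverse (1 - a) = 1 + a * Ring.inverse (1 - a) := by
  have := Ring.mul_inverse_cancel (1 - a) (isUnit_one_sub_of_norm_lt_one h)
  rw [sub_mul, one_mul, sub_eq_iff_eq_add] at this
  exact this

theorem quasiInverse_eq_right {a : A} (h : ‖a‖ < 1) :
    Ring.inverse (1 - a) = 1 + Ring.inverse (1 - a) * a := by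
  have := Ring.inverse_mul_cancel (1 - a) (isUnit_one_sub_of_norm_lt_one h)
  rw [mul_sub, mul_one, sub_eq_iff_eq_add] at this
  exact this

theorem norm_inverse_one_sub_le (h1 : ‖(1 : A)‖ ≤ 1) {a : A} {M : ℝ} (hM : M < 1) (h : ‖a‖ ≤ M) :
    ‖Ring.inverse (1 - a)‖ ≤ (1 - M)⁻¹ := by
  have h2 : ‖Ring.inverse (1 - a)‖ ≤ 1 + M * ‖Ring.inverse (1 - a)‖ := by
    conv_lhs => rw [quasiInverse_eq_left (h.trans_lt hM)]
    refine (norm_add_le _ _).trans (add_le_add h1 ((norm_mul_le _ _).trans ?_))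
    gcongr
  rw [← one_div, le_div_iff₀ (by linarith)]
  linarith

theorem inverse_one_sub_mem {S : Type*} [SetLike S A] [SubringClass S A] {T : S}
    (hT : IsClosed (T : Set A)) {a : A} (ha : a ∈ T) (h : ‖a‖ < 1) :
    Ring.inverse (1 - a) ∈ T := by
  rw [NormedRing.inverse_one_sub a h]
  have hs : HasSum (fun n : ℕ => a ^ n) (∑' n : ℕ, a ^ n) :=
    (summable_geometric_of_norm_lt_one h).hasSum
  exact hT.mem_of_tendsto hs (Eventually.of_forall fun s => sum_mem fun n _ => pow_mem ha n)

end QuasiInverse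

section HasLift

variable {W : Submodule ℝ H} [FiniteDimensional ℝ W]

theorem norm_one_coef_le : ‖(1 : Coef H)‖ ≤ 1 :=
  CliffordAmbient.norm_le zero_le_one fun _ => ContinuousLinearMap.norm_id_le

variable (W) in
/-- `a` is the image of a continuously differentiable element of `A(W)` with derivatives bounded
by `c`. -/
def HasLift (c : ℝ) (a : BddFun H) : Prop :=
  ∃ Φ : C0W W, IsHat Φ ∧ C1Bound c Φ ∧ ∀ q, a.val q = hatAt W Φ q

theorem IsHat.norm_le {Φ : C0W W} (h : IsHat Φ) {a : BddFun H} (e : ∀ q, a.val q = hatAt W Φ q)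
    {M : ℝ} (hM : ‖a‖ ≤ M) (q) : ‖Φ q‖ ≤ M := by
  rw [← h.norm_hatAt_absPt, ← e]
  exact (a.norm_val_le _).trans hM

theorem HasLift.nonneg {c : ℝ} {a : BddFun H} (h : HasLift W c a) : 0 ≤ c := by
  obtain ⟨Φ, -, h, -⟩ := h
  exact h.nonneg

theorem HasLift.mono {c c' : ℝ} {a : BddFun H} (h : HasLift W c a) (hc : c ≤ c') :
    HasLift W c' a := by
  obtain ⟨Φ, h1, h2, h3⟩ := h
  exact ⟨Φ, h1, h2.mono hc, h3⟩

theorem HasLift.zero : HasLift W 0 0 :=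
  ⟨0, IsHat.zero, C1Bound.zero, fun _ => (map_zero _).symm⟩

theorem HasLift.add {c c' : ℝ} {a a' : BddFun H} (h : HasLift W c a) (h' : HasLift W c' a') :
    HasLift W (c + c') (a + a') := by
  obtain ⟨Φ, h1, h2, h3⟩ := h
  obtain ⟨Φ', h1', h2', h3'⟩ := h'
  refine ⟨Φ + Φ', h1.add h1', h2.add h2', fun q => ?_⟩
  rw [BddFun.val_add, h3, h3']
  exact (map_add _ _ _).symm

theorem HasLift.sum {ι : Type*} {c : ℝ} (s : Finset ι) {a : ι → BddFun H}
    (h : ∀ i ∈ s, HasLift W c (a i)) : HasLift W (s.card * c) (∑ i ∈ s, a i) := by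
  classical
  induction s using Finset.induction_on with
  | empty => simpa using HasLift.zero
  | insert i s hi ih =>
    rw [Finset.sum_insert hi, Finset.card_insert_of_notMem hi]
    refine ((h i (by simp)).add (ih fun j hj => h j (by simp [hj]))).mono (le_of_eq ?_)
    push_cast; ring

theorem HasLift.smul {c : ℝ} {a : BddFun H} (h : HasLift W c a) (z : ℂ) :
    HasLift W (‖z‖ * c) (z • a) := by
  obtain ⟨Φ, h1, h2, h3⟩ := h
  refine ⟨z • Φ, h1.smul z, h2.smul z, fun q => ?_⟩
  rw [BddFun.val_smul, h3]
  exact (map_smul _ _ _).symm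

theorem HasLift.star {c : ℝ} {a : BddFun H} (h : HasLift W c a) : HasLift W c (star a) := by
  obtain ⟨Φ, h1, h2, h3⟩ := h
  refine ⟨Star.star Φ, h1.star, h2.star, fun q => ?_⟩
  rw [BddFun.val_star, h3]
  exact (map_star _ _).symm

theorem HasLift.mul {c c' M M' : ℝ} {a a' : BddFun H} (h : HasLift W c a) (h' : HasLift W c' a')
    (hM : ‖a‖ ≤ M) (hM' : ‖a'‖ ≤ M') : HasLift W (c * M' + M * c') (a * a') := by
  obtain ⟨Φ, h1, h2, h3⟩ := h
  obtain ⟨Φ', h1', h2', h3'⟩ := h'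
  refine ⟨Φ * Φ', h1.mul h1', h2.mul h2' (h1.norm_le h3 hM) (h1'.norm_le h3' hM'), fun q => ?_⟩
  rw [BddFun.val_mul, h3, h3']
  exact (map_mul _ _ _).symm

/-- `b` is `(1 - a)⁻¹ - 1`. In `hat` form inversion is pointwise, and the derivative `R * Ψ * R` of
the resolvent `R` is again bounded. This stability under inversion is what controls spectra in
arbitrary representations of the uncompleted algebra. -/
theorem HasLift.quasiInverse {c M : ℝ} {a : BddFun H} (h : HasLift W c a)
    (hM : ‖a‖ ≤ M) (hM1 : M < 1) :
    ∃ b, HasLift W ((1 - M)⁻¹ * c * (1 - M)⁻¹) b ∧ b = a + a * b ∧ b = a + b * a ∧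
      ‖b‖ ≤ (1 - M)⁻¹ * M := by
  obtain ⟨Φ, h1, h2, h3⟩ := h
  have hΦ : ∀ q, ‖Φ q‖ ≤ M := h1.norm_le h3 hM
  have hΦ1 : ∀ q, ‖Φ q‖ < 1 := fun q => (hΦ q).trans_lt hM1
  let R : ℝ × W → Coef H := fun q => Ring.inverse (1 - Φ q)
  have hR : ∀ q, ‖R q‖ ≤ (1 - M)⁻¹ := fun q => norm_inverse_one_sub_le norm_one_coef_le hM1 (hΦ q)
  have hR1 : ∀ q, R q = 1 + Φ q * R q := fun q => quasiInverse_eq_left (hΦ1 q)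
  have hR2 : ∀ q, R q = 1 + R q * Φ q := fun q => quasiInverse_eq_right (hΦ1 q)
  have hinv : ∀ x : Coef H, ‖x‖ < 1 → ContinuousAt Ring.inverse (1 - x) := fun x hx =>
    NormedRing.inverse_continuousAt (Units.oneSub x hx)
  have hRc : Continuous R := continuous_iff_continuousAt.mpr fun q =>
    ContinuousAt.comp (f := fun q => 1 - Φ q) (g := Ring.inverse) (hinv _ (hΦ1 q))
      (by fun_prop)
  have hM0 : 0 < (1 - M)⁻¹ := inv_pos.mpr (by linarith)
  -- `R - 1`, written as `R * Φ` so that it visibly vanishes at infinity.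
  let Q : C0W W :=
    { toFun := fun q => R q * Φ q
      continuous_toFun := by fun_prop
      zero_at_infty' := by
        refine squeeze_zero_norm (a := fun q => (1 - M)⁻¹ * ‖Φ q‖) (fun q => ?_) ?_
        · exact (norm_mul_le _ _).trans (by gcongr; exact hR q)
        · simpa using! Φ.zero_at_infty'.norm.const_mul ((1 - M)⁻¹) }
  have hQ : ∀ q, Q q = R q * Φ q := fun q => rfl
  have hQR : ∀ q, R q = 1 + Q q := hR2
  have hQ1 : ∀ q, Q q = Φ q + Φ q * Q q := fun q => by
    have := hR1 q
    rw [hQR, add_right_inj, mul_add, mul_one] at this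
    exact this
  have hQ2 : ∀ q, Q q = Φ q + Q q * Φ q := fun q => by
    have := hR2 q
    rw [hQR, add_right_inj, add_mul, one_mul] at this
    exact this
  have hQn : ∀ q, ‖Q q‖ ≤ (1 - M)⁻¹ * M := fun q => by
    rw [hQ]
    exact (norm_mul_le _ _).trans (mul_le_mul (hR q) (hΦ q) (norm_nonneg _) hM0.le)
  have hQhat : IsHat Q := by
    constructor
    · intro q
      exact mul_mem (inverse_one_sub_mem (isClosed_cliffHat W) (h1.mem q) (hΦ1 q)) (h1.mem q)
    · intro s w
      -- Both sides of the symmetry solve the same equation, whose coefficient `1 - Φ (-s, w)` is a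
      -- unit.
      have e1 : Q (-s, w) * (1 - Φ (-s, w)) = Φ (-s, w) := by
        rw [mul_sub, mul_one, sub_eq_iff_eq_add]; exact hQ2 _
      have e2 : cliffSign (Q (s, w)) * (1 - Φ (-s, w)) = Φ (-s, w) := by
        rw [h1.symm, mul_sub, mul_one, sub_eq_iff_eq_add, ← map_mul, ← map_add, ← hQ2]
      exact (isUnit_one_sub_of_norm_lt_one (hΦ1 (-s, w))).mul_right_cancel (e1.trans e2.symm)
  have hv : ∀ q, ‖hatAt W Q q‖ ≤ (1 - M)⁻¹ * M := fun q => by rw [norm_hatAt]; exact hQn _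
  have hMn : 0 ≤ (1 - M)⁻¹ * M := (norm_nonneg _).trans (hv (0, 0))
  let b : BddFun H := ⟨hatAt W Q, memℓp_infty ⟨(1 - M)⁻¹ * M, by
    rintro _ ⟨q, rfl⟩; exact hv q⟩⟩
  have hb : ∀ q, b.val q = hatAt W Q q := fun q => rfl
  refine ⟨b, ⟨Q, hQhat, ?_, hb⟩, ?_, ?_, BddFun.norm_le hMn hv⟩
  · intro s v hsv
    obtain ⟨Ψ, hd, hΨ⟩ := h2 s v hsv
    let D : C0W W :=
      { toFun := fun q => R q * Ψ q * R q
        continuous_toFun := by fun_prop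
        zero_at_infty' := by
          refine squeeze_zero_norm (a := fun q => (1 - M)⁻¹ * ‖Ψ q‖ * (1 - M)⁻¹) (fun q => ?_) ?_
          · refine (norm_mul_le _ _).trans ?_
            gcongr
            · exact (norm_mul_le _ _).trans (by gcongr; exact hR q)
            · exact hR q
          · simpa using! (Ψ.zero_at_infty'.norm.const_mul ((1 - M)⁻¹)).mul_const ((1 - M)⁻¹) }
    refine ⟨D, fun q => ?_, fun q => ?_⟩
    · have hΨ' : HasDerivAt (fun t : ℝ => 1 - Φ (q + t • (s, v))) (-Ψ q) 0 := by
        simpa using! (hasDerivAt_const (0 : ℝ) (1 : Coef H)).sub (hd q)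
      have hf := hasFDerivAt_ringInverse (𝕜 := ℝ) (Units.oneSub (Φ q) (hΦ1 q))
      have hval : ((Units.oneSub (Φ q) (hΦ1 q) : (Coef H)ˣ) : Coef H) =
          (fun t : ℝ => 1 - Φ (q + t • (s, v))) 0 := by simp
      rw [hval] at hf
      have hc := hf.comp_hasDerivAt (0 : ℝ) hΨ'
      have hRv : ((Units.oneSub (Φ q) (hΦ1 q))⁻¹ : (Coef H)ˣ) = R q := by
        rw [← Ring.inverse_unit]; rfl
      rw [hRv] at hc
      have hc' : HasDerivAt (fun t : ℝ => Ring.inverse (1 - Φ (q + t • (s, v)))) (D q) 0 := by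
        convert! hc using 1
        change R q * Ψ q * R q = _
        simp [ContinuousLinearMap.mulLeftRight_apply]
      have hfun : (fun t : ℝ => Q (q + t • (s, v))) =
          fun t : ℝ => Ring.inverse (1 - Φ (q + t • (s, v))) - 1 := by
        funext t
        have := hQR (q + t • (s, v))
        rw [eq_sub_iff_add_eq, add_comm, ← this]
      unfold HasLineDerivAt
      rw [hfun]
      exact hc'.sub_const 1
    · change ‖R q * Ψ q * R q‖ ≤ _
      refine (norm_mul_le _ _).trans ?_
      exact mul_le_mul ((norm_mul_le _ _).trans (mul_le_mul (hR q) (hΨ q) (norm_nonneg _) hM0.le))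
        (hR q) (norm_nonneg _) (mul_nonneg hM0.le h2.nonneg)
  · ext q
    rw [BddFun.val_add, BddFun.val_mul, hb, h3, hatAt, hatAt, ← map_mul, ← map_add, ← hQ1]
  · ext q
    rw [BddFun.val_add, BddFun.val_mul, hb, h3, hatAt, hatAt, ← map_mul, ← map_add, ← hQ2]

/-- The bound on `beta W G` bounds `hat G` by `c`, hence `G = hat (hat G)` by `2 * c`, and `hat`
doubles the derivative bound once more. -/
theorem hasLift_of_derivs {F : C0W W} (hF : F ∈ AFun W) {c : ℝ}
    (h : ∀ (s : ℝ) (v : W), √(s ^ 2 + ‖v‖ ^ 2) ≤ 1 → ∃ G ∈ AFun W,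
      (∀ q, HasLineDerivAt ℝ F (G q) q (s, v)) ∧ ‖beta W G‖ ≤ c) :
    HasLift W (4 * c) (beta W F) := by
  refine ⟨hat F, isHat_hat hF, ?_, beta_val_eq W hF⟩
  have : C1Bound (2 * c) F := fun s v hv => by
    obtain ⟨G, hG, h1, h2⟩ := h s v hv
    refine ⟨G, h1, fun q => ?_⟩
    rw [← hat_hat G]
    exact norm_hat_le ((isHat_hat hG).norm_le (beta_val_eq W hG) h2) q
  exact this.hat.mono (by linarith)

theorem AFun_of_hasLineDerivAt {F G : C0W W} (hF : F ∈ AFun W) {z : ℝ × W}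
    (h : ∀ q, HasLineDerivAt ℝ F (G q) q z) : G ∈ AFun W := fun q => by
  have h1 := (h q).tendsto_slope_zero
  refine (isClosed_cliffOf W).mem_of_tendsto h1 (Eventually.of_forall fun t => ?_)
  exact real_smul_mem _ _ (sub_mem (hF _) (hF _))

theorem HasLift.exists_derivs {a : BddFun H} {c : ℝ} (h : HasLift W c a) :
    ∃ F ∈ AFun W, beta W F = a ∧ ∀ (s : ℝ) (v : W), √(s ^ 2 + ‖v‖ ^ 2) ≤ 1 →
      ∃ G ∈ AFun W, (∀ q, HasLineDerivAt ℝ F (G q) q (s, v)) ∧ ‖beta W G‖ ≤ 4 * c := by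
  obtain ⟨Φ, h1, h2, h3⟩ := h
  refine ⟨hat Φ, h1.hat_mem, BddFun.ext fun q => by rw [h1.beta_val, h3], fun s v hv => ?_⟩
  obtain ⟨G, hG, hc⟩ := h2.hat s v hv
  have hGA := AFun_of_hasLineDerivAt h1.hat_mem hG
  refine ⟨G, hGA, hG, BddFun.norm_le (by linarith [h2.nonneg]) fun q => ?_⟩
  rw [beta_val_eq W hGA, norm_hatAt]
  exact (norm_hat_le hc _).trans (by linarith)

end HasLift

end Lift

/-! ### Change of the subspace: from `A(W)` to `A(W')`. -/

section Enlarge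

variable {H : Type w} [NormedAddCommGroup H] [InnerProductSpace ℝ H]

section Parity

variable {W : Submodule ℝ H}

/-- The even part, as a `C₀`-function. -/
def evenC (F : C0W W) : C0W W := (2⁻¹ : ℂ) • (F + negFst F)

/-- The odd part, as a `C₀`-function. -/
def oddC (F : C0W W) : C0W W := (2⁻¹ : ℂ) • (F - negFst F)

theorem two_inv_smul (a : Coef H) : (2⁻¹ : ℂ) • a = (2⁻¹ : ℝ) • a := by
  rw [← Complex.coe_smul]; simp

theorem evenC_apply (F : C0W W) (q) : evenC F q = (2⁻¹ : ℝ) • (F q + F (-q.1, q.2)) := by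
  simp [evenC, two_inv_smul]

theorem oddC_apply (F : C0W W) (q) : oddC F q = (2⁻¹ : ℝ) • (F q - F (-q.1, q.2)) := by
  simp [oddC, two_inv_smul]

theorem oddC_zero (F : C0W W) (w : W) : oddC F (0, w) = 0 := by simp [oddC_apply]

theorem norm_evenC_le {F : C0W W} {c : ℝ} (h : ∀ q, ‖F q‖ ≤ c) (q) : ‖evenC F q‖ ≤ c := by
  rw [evenC_apply, norm_smul, Real.norm_of_nonneg (by norm_num)]
  linarith [norm_add_le (F q) (F (-q.1, q.2)), h q, h (-q.1, q.2)]

theorem norm_oddC_le {F : C0W W} {c : ℝ} (h : ∀ q, ‖F q‖ ≤ c) (q) : ‖oddC F q‖ ≤ c := by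
  rw [oddC_apply, norm_smul, Real.norm_of_nonneg (by norm_num)]
  linarith [norm_sub_le (F q) (F (-q.1, q.2)), h q, h (-q.1, q.2)]

/-- The chain rule along a curve whose component in `W` is affine. -/
theorem hasDerivAt_comp_curve {F Gs Gh : C0W W} {h : W}
    (hs : ∀ q, HasLineDerivAt ℝ F (Gs q) q (1, 0)) (hh : ∀ q, HasLineDerivAt ℝ F (Gh q) q (0, h))
    {r : ℝ → ℝ} {r' : ℝ} (hr : HasDerivAt r r' 0) (w : W) :
    HasDerivAt (fun t : ℝ => F (r t, w + t • h)) (r' • Gs (r 0, w) + Gh (r 0, w)) 0 := by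
  let f : ℝ → ℝ → Coef H := fun a b => F (a, w + b • h)
  let f₁ : ℝ → ℝ → ℝ →L[ℝ] Coef H := fun a b =>
    ContinuousLinearMap.toSpanSingleton ℝ (Gs (a, w + b • h))
  let f₂ : ℝ → ℝ → ℝ →L[ℝ] Coef H := fun a b =>
    ContinuousLinearMap.toSpanSingleton ℝ (Gh (a, w + b • h))
  have d1 : ∀ v : ℝ × ℝ, HasFDerivAt (f · v.2) (f₁ v.1 v.2) v.1 := fun v => by
    have h1 := hs (v.1, w + v.2 • h)
    have h2 : HasDerivAt (fun t : ℝ => F ((v.1, w + v.2 • h) + (t - v.1) • ((1 : ℝ), (0 : W))))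
        (Gs (v.1, w + v.2 • h)) v.1 := by
      refine HasDerivAt.comp_sub_const (f := fun t : ℝ => F ((v.1, w + v.2 • h) + t •
        ((1 : ℝ), (0 : W)))) v.1 v.1 ?_
      rw [sub_self]; exact h1
    refine HasDerivAt.hasFDerivAt (h2.congr_of_eventuallyEq (Eventually.of_forall fun t => ?_))
    simp [f]
  have d2 : ∀ v : ℝ × ℝ, HasFDerivAt (f v.1 ·) (f₂ v.1 v.2) v.2 := fun v => by
    have h1 := hh (v.1, w + v.2 • h)
    have h2 : HasDerivAt (fun t : ℝ => F ((v.1, w + v.2 • h) + (t - v.2) • ((0 : ℝ), h)))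
        (Gh (v.1, w + v.2 • h)) v.2 := by
      refine HasDerivAt.comp_sub_const (f := fun t : ℝ => F ((v.1, w + v.2 • h) + t •
        ((0 : ℝ), h))) v.2 v.2 ?_
      rw [sub_self]; exact h1
    refine HasDerivAt.hasFDerivAt (h2.congr_of_eventuallyEq (Eventually.of_forall fun t => ?_))
    change F _ = F _
    congr 1
    ext
    · simp
    · simp [sub_smul]
  have c1 : Continuous ↿f₁ := by
    have : Continuous fun v : ℝ × ℝ => Gs (v.1, w + v.2 • h) := by fun_prop
    exact (ContinuousLinearMap.toSpanSingletonLIE ℝ (Coef H)).continuous.comp this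
  have c2 : Continuous ↿f₂ := by
    have : Continuous fun v : ℝ × ℝ => Gh (v.1, w + v.2 • h) := by fun_prop
    exact (ContinuousLinearMap.toSpanSingletonLIE ℝ (Coef H)).continuous.comp this
  -- Continuity of the two partial derivatives gives joint differentiability in the two real
  -- parameters, which the chain rule needs.
  have hf : HasStrictFDerivAt ↿f ((↿f₁ (r 0, (0 : ℝ))).coprod (↿f₂ (r 0, (0 : ℝ)))) (r 0, (0 : ℝ)) :=
    hasStrictFDerivAt_uncurry_coprod (Eventually.of_forall d1) (Eventually.of_forall d2)
      c1.continuousAt c2.continuousAt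
  have hcurve : HasDerivAt (fun t : ℝ => (r t, t)) (r', (1 : ℝ)) 0 := hr.prodMk (hasDerivAt_id 0)
  have := hf.hasFDerivAt.comp_hasDerivAt (f := fun t : ℝ => (r t, t)) (0 : ℝ) hcurve
  refine HasDerivAt.congr_deriv this ?_
  simp [Function.HasUncurry.uncurry, f₁, f₂]

/-- The derivative in `s` of an even function is odd, whence the change of parity in the first term.
-/
theorem hasDerivAt_evenC_comp_curve {F Gs Gh : C0W W} {h : W}
    (hs : ∀ q, HasLineDerivAt ℝ F (Gs q) q (1, 0)) (hh : ∀ q, HasLineDerivAt ℝ F (Gh q) q (0, h))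
    {r : ℝ → ℝ} {r' : ℝ} (hr : HasDerivAt r r' 0) (w : W) :
    HasDerivAt (fun t : ℝ => evenC F (r t, w + t • h)) (r' • oddC Gs (r 0, w) + evenC Gh (r 0, w)) 0 := by
  have h1 := hasDerivAt_comp_curve hs hh hr w
  have h2 := hasDerivAt_comp_curve hs hh hr.neg w
  simp only [evenC_apply, oddC_apply]
  refine ((h1.add h2).const_smul (2⁻¹ : ℝ)).congr_deriv ?_
  simp only [Pi.neg_apply]
  module

theorem hasDerivAt_oddC_comp_curve {F Gs Gh : C0W W} {h : W}
    (hs : ∀ q, HasLineDerivAt ℝ F (Gs q) q (1, 0)) (hh : ∀ q, HasLineDerivAt ℝ F (Gh q) q (0, h))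
    {r : ℝ → ℝ} {r' : ℝ} (hr : HasDerivAt r r' 0) (w : W) :
    HasDerivAt (fun t : ℝ => oddC F (r t, w + t • h)) (r' • evenC Gs (r 0, w) + oddC Gh (r 0, w)) 0 := by
  have h1 := hasDerivAt_comp_curve hs hh hr w
  have h2 := hasDerivAt_comp_curve hs hh hr.neg w
  simp only [evenC_apply, oddC_apply]
  refine ((h1.sub h2).const_smul (2⁻¹ : ℝ)).congr_deriv ?_
  simp only [Pi.neg_apply]
  module

/-- Hadamard's lemma for the odd part. -/
theorem exists_oddC_eq_smul [FiniteDimensional ℝ W] {F Gs : C0W W}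
    (hs : ∀ q, HasLineDerivAt ℝ F (Gs q) q (1, 0)) {c : ℝ} (hc : ∀ q, ‖Gs q‖ ≤ c) :
    ∃ E : C0W W, (∀ a w, oddC F (a, w) = a • E (a, w)) ∧ (∀ w, E (0, w) = evenC Gs (0, w)) ∧
      ∀ q, ‖E q‖ ≤ c := by
  -- The mean of the `s`-derivative of the odd part over the segment from `(0, w)` to `(a, w)`.
  let e : ℝ × W → Coef H := fun q => ∫ t in (0 : ℝ)..1, evenC Gs (t * q.1, q.2)
  have he : Continuous e := by
    refine intervalIntegral.continuous_parametric_intervalIntegral_of_continuous' ?_ 0 1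
    have : Continuous fun z : (ℝ × W) × ℝ => evenC Gs (z.2 * z.1.1, z.1.2) := by fun_prop
    exact this
  have hn : ∀ (q : ℝ × W) (b : ℝ), (∀ t : ℝ, ‖evenC Gs (t * q.1, q.2)‖ ≤ b) → ‖e q‖ ≤ b :=
    fun q b hb => by
      have := intervalIntegral.norm_integral_le_of_norm_le_const (a := (0 : ℝ)) (b := 1)
        (f := fun t => evenC Gs (t * q.1, q.2)) (C := b) fun t _ => hb t
      simpa using this
  have hfund : ∀ a w, oddC F (a, w) = a • e (a, w) := fun a w => by
    have hd : ∀ t : ℝ, HasDerivAt (fun t : ℝ => oddC F (t * a, w)) (a • evenC Gs (t * a, w)) t := by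
      intro t
      have hr : HasDerivAt (fun u : ℝ => (t + u) * a) a 0 := by
        simpa using! ((hasDerivAt_id (0 : ℝ)).const_add t).mul_const a
      have h0 : ∀ q, HasLineDerivAt ℝ F ((0 : C0W W) q) q (0, (0 : W)) := fun q =>
        (hasDerivAt_const (0 : ℝ) (F q)).congr_of_eventuallyEq
          (Eventually.of_forall fun t => by
            change F _ = F _
            congr 1
            ext <;> simp)
      have h1 := hasDerivAt_oddC_comp_curve hs h0 hr w
      have h2 : HasDerivAt (fun u : ℝ => oddC F ((t + u) * a, w)) (a • evenC Gs (t * a, w)) 0 := by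
        simpa [oddC_apply (0 : C0W W)] using h1
      have h3 := HasDerivAt.comp_sub_const (f := fun u : ℝ => oddC F ((t + u) * a, w))
        (f' := a • evenC Gs (t * a, w)) t t (by rw [sub_self]; exact h2)
      refine h3.congr_of_eventuallyEq (Eventually.of_forall fun u => ?_)
      simp
    have := intervalIntegral.integral_eq_sub_of_hasDerivAt (a := (0 : ℝ)) (b := 1)
      (fun t _ => hd t) (Continuous.intervalIntegrable (by fun_prop) _ _)
    rw [intervalIntegral.integral_smul] at this
    simp only [one_mul, zero_mul, oddC_zero, sub_zero] at this
    exact this.symm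
  have hprop : ProperSpace W := FiniteDimensional.proper ℝ W
  have small : ∀ (G : C0W W) (ε : ℝ), 0 < ε → ∃ M : ℝ, ∀ q : ℝ × W, M < ‖q‖ → ‖G q‖ < ε := by
    intro G ε hε
    have h1 := G.zero_at_infty'
    rw [← Metric.cobounded_eq_cocompact, ← comap_norm_atTop] at h1
    have h2 := h1.eventually (Metric.ball_mem_nhds (0 : Coef H) hε)
    obtain ⟨t, ht, hs⟩ := h2
    obtain ⟨M, hM⟩ := mem_atTop_sets.mp ht
    refine ⟨M, fun q hq => ?_⟩
    simpa using! hs (show ‖q‖ ∈ t from hM _ hq.le)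
  refine ⟨⟨⟨e, he⟩, ?_⟩, hfund, fun w => ?_, fun q => hn q c fun t => norm_evenC_le hc _⟩
  · change Tendsto e (cocompact _) (𝓝 0)
    rw [Metric.tendsto_nhds]
    intro ε hε
    obtain ⟨M₁, h1⟩ := small (oddC F) ε hε
    obtain ⟨M₂, h2⟩ := small (evenC Gs) (ε / 2) (by positivity)
    have hco : ∀ᶠ q : ℝ × W in cocompact _, max (max M₁ M₂) 1 < ‖q‖ :=
      (tendsto_norm_cocompact_atTop).eventually_gt_atTop _
    filter_upwards [hco] with q hq
    rw [dist_zero_right]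
    obtain ⟨a, w⟩ := q
    have hq1 : M₁ < ‖(a, w)‖ := ((le_max_left _ _).trans (le_max_left _ _)).trans_lt hq
    have hq2 : M₂ < ‖(a, w)‖ := ((le_max_right _ _).trans (le_max_left _ _)).trans_lt hq
    have hq3 : 1 < ‖(a, w)‖ := (le_max_right _ _).trans_lt hq
    -- For large `|a|` decay comes from `oddC F = a • E`, for large `‖w‖` from the integrand.
    rcases le_total ‖w‖ ‖a‖ with hle | hle
    · have hna : ‖(a, w)‖ = ‖a‖ := max_eq_left hle
      have h4 : ‖a‖ * ‖e (a, w)‖ < ε := by rw [← norm_smul, ← hfund]; exact h1 _ hq1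
      rw [hna] at hq3
      nlinarith [norm_nonneg (e (a, w))]
    · have hnw : ‖(a, w)‖ = ‖w‖ := max_eq_right hle
      refine (hn (a, w) (ε / 2) fun t => (h2 _ ?_).le).trans_lt (by linarith)
      rw [hnw] at hq2
      exact hq2.trans_le (le_max_right _ _)
  · change e (0, w) = _
    simp [e]

end Parity

section Change

variable {W W' : Submodule ℝ H} [FiniteDimensional ℝ W]

/-- The component of `v ∈ W'` orthogonal to `W`. -/
def orthPart (W : Submodule ℝ H) [FiniteDimensional ℝ W] {W' : Submodule ℝ H} : W' →L[ℝ] H :=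
  (ContinuousLinearMap.id ℝ H - W.subtypeL ∘L W.orthogonalProjectionOnto) ∘L W'.subtypeL

/-- The projection of `W'` to `W`. -/
def projPart (W : Submodule ℝ H) [FiniteDimensional ℝ W] {W' : Submodule ℝ H} : W' →L[ℝ] W :=
  W.orthogonalProjectionOnto ∘L W'.subtypeL

/-- The distance of `(s, v)` from `{0} × W`. -/
def radOf (W : Submodule ℝ H) [FiniteDimensional ℝ W] {W' : Submodule ℝ H} (q : ℝ × W') : ℝ :=
  √(q.1 ^ 2 + ‖orthPart W q.2‖ ^ 2)

theorem orthPart_apply (v : W') :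
    orthPart W v = (v : H) - W.orthogonalProjectionOnto (v : H) := rfl

theorem projPart_apply (v : W') : projPart W v = W.orthogonalProjectionOnto (v : H) := rfl

theorem norm_projPart_le (v : W') : ‖projPart W v‖ ≤ ‖v‖ :=
  W.norm_orthogonalProjectionOnto_apply_le (v : H)

theorem norm_sq_eq (v : H) : ‖v‖ ^ 2 = ‖(W.orthogonalProjectionOnto v)‖ ^ 2 +
    ‖v - W.orthogonalProjectionOnto v‖ ^ 2 := by
  have h1 : inner ℝ (W.orthogonalProjectionOnto v : H) (v - W.orthogonalProjectionOnto v) = 0 := by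
    rw [real_inner_comm]
    exact W.starProjection_inner_eq_zero v _ (W.orthogonalProjectionOnto v).2
  have h2 := norm_add_sq_real (W.orthogonalProjectionOnto v : H) (v - W.orthogonalProjectionOnto v)
  rw [h1, add_sub_cancel] at h2
  rw [h2, Submodule.coe_norm]; ring

theorem norm_orthPart_le (v : W') : ‖orthPart W v‖ ≤ ‖v‖ := by
  have h := norm_sq_eq (W := W) (v : H)
  rw [orthPart_apply, Submodule.coe_norm]
  refine le_of_sq_le_sq ?_ (norm_nonneg _)
  nlinarith [sq_nonneg ‖W.orthogonalProjectionOnto (v : H)‖]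

theorem orthPart_mem (hW : W ≤ W') (v : W') : orthPart W v ∈ W' :=
  sub_mem v.2 (hW (W.orthogonalProjectionOnto (v : H)).2)

theorem radOf_nonneg (q : ℝ × W') : 0 ≤ radOf W q := Real.sqrt_nonneg _

theorem radOf_sq (q : ℝ × W') : radOf W q ^ 2 = q.1 ^ 2 + ‖orthPart W q.2‖ ^ 2 :=
  Real.sq_sqrt (by positivity)

theorem continuous_radOf : Continuous (radOf W : ℝ × W' → ℝ) := by
  unfold radOf; fun_prop

theorem abs_fst_le_radOf (q : ℝ × W') : |q.1| ≤ radOf W q :=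
  Real.abs_le_sqrt (by nlinarith [sq_nonneg ‖orthPart W q.2‖])

theorem norm_orthPart_le_radOf (q : ℝ × W') : ‖orthPart W q.2‖ ≤ radOf W q :=
  Real.le_sqrt_of_sq_le (by nlinarith [sq_nonneg q.1])

/-- The map `(s, v) ↦ (r, v_W)`, where `r` is the distance of `(s, v)` from `{0} × W`. -/
def polar (W : Submodule ℝ H) [FiniteDimensional ℝ W] {W' : Submodule ℝ H} (q : ℝ × W') : ℝ × W :=
  (radOf W q, projPart W q.2)

theorem continuous_polar : Continuous (polar W : ℝ × W' → ℝ × W) :=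
  continuous_radOf.prodMk (by fun_prop)

/-- Radius and projection together control the norm, `‖q‖ ≤ 2 * ‖polar W q‖`; so `C₀`-functions pull
back to `C₀`-functions. -/
theorem tendsto_polar [FiniteDimensional ℝ W'] : Tendsto (polar W : ℝ × W' → ℝ × W) (cocompact _) (cocompact _) := by
  have h1 : ProperSpace W := FiniteDimensional.proper ℝ W
  have h2 : ProperSpace W' := FiniteDimensional.proper ℝ W'
  rw [← Metric.cobounded_eq_cocompact, ← Metric.cobounded_eq_cocompact,
    ← tendsto_norm_atTop_iff_cobounded]
  have hle : ∀ q : ℝ × W', 2⁻¹ * ‖q‖ ≤ ‖polar W q‖ := fun q => by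
    have e1 : radOf W q ≤ ‖polar W q‖ := (le_abs_self _).trans (le_max_left _ _)
    have e2 : ‖projPart W q.2‖ ≤ ‖polar W q‖ := le_max_right _ _
    have e3 := abs_fst_le_radOf (W := W) q
    have e4 := norm_orthPart_le_radOf (W := W) q
    have e5 : ‖q.2‖ ≤ ‖projPart W q.2‖ + ‖orthPart W q.2‖ := by
      have := norm_add_le (projPart W q.2 : H) (orthPart W q.2)
      rw [projPart_apply, orthPart_apply, add_sub_cancel] at this
      exact this
    have e6 : ‖q‖ ≤ 2 * ‖polar W q‖ := by
      refine max_le ?_ ?_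
      · rw [Real.norm_eq_abs]; linarith [radOf_nonneg (W := W) q]
      · linarith
    linarith
  refine tendsto_atTop_mono hle ?_
  exact (tendsto_norm_cobounded_atTop).const_mul_atTop (by norm_num)

/-- The product of the pull-back of a `C₀`-function with a bounded function which is continuous
wherever this pull-back does not vanish. -/
def mulPolar [FiniteDimensional ℝ W'] (m : ℝ × W' → Coef H) (M : ℝ) (hm : ∀ q, ‖m q‖ ≤ M) (B : C0W W)
    (hB : ∀ q, radOf W q ≠ 0 → ContinuousAt m q)
    (hB0 : (∀ w, B (0, w) = 0) ∨ Continuous m) : C0W W' where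
  toFun q := m q * B (polar W q)
  continuous_toFun := by
    refine continuous_iff_continuousAt.mpr fun q => ?_
    have hc : Continuous fun q : ℝ × W' => B (polar W q) := B.continuous.comp continuous_polar
    by_cases h0 : radOf W q = 0
    · rcases hB0 with hB0 | hB0
      · have hz : B (polar W q) = 0 := by rw [polar, h0]; exact hB0 _
        rw [ContinuousAt, hz, mul_zero]
        refine squeeze_zero_norm (a := fun q => M * ‖B (polar W q)‖) (fun q => ?_) ?_
        · exact (norm_mul_le _ _).trans (by gcongr; exact hm q)
        · have := (hc.norm.const_mul M).tendsto q
          simpa [hz] using this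
      · exact (hB0.mul hc).continuousAt
    · exact (hB q h0).mul hc.continuousAt
  zero_at_infty' := by
    refine squeeze_zero_norm (a := fun q => M * ‖B (polar W q)‖) (fun q => ?_) ?_
    · exact (norm_mul_le _ _).trans (by gcongr; exact hm q)
    · simpa using! (B.zero_at_infty'.comp tendsto_polar).norm.const_mul M

/-- The Clifford element `(s + (v - v_W)) / r`. -/
def sigma (W : Submodule ℝ H) [FiniteDimensional ℝ W] {W' : Submodule ℝ H} (q : ℝ × W') : Coef H :=
  (radOf W q)⁻¹ • (q.1 • 1 + cl 0 (orthPart W q.2))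

theorem norm_real_add_cl_le {s b : ℝ} {v : H} (hs : |s| ≤ b) (hv : ‖v‖ ≤ b) :
    ‖s • (1 : Coef H) + cl 0 v‖ ≤ 2 * b := by
  have h1 : ‖s • (1 : Coef H)‖ ≤ b := by
    rw [norm_smul, Real.norm_eq_abs]
    nlinarith [norm_one_coef_le (H := H), abs_nonneg s]
  have h2 : ‖(cl 0 v : Coef H)‖ ≤ b := by
    refine (norm_cl_le _ _).trans ?_
    simpa using hv
  linarith [norm_add_le (s • (1 : Coef H)) (cl 0 v)]

theorem norm_sigma_le (q : ℝ × W') : ‖sigma W q‖ ≤ 2 := by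
  rw [sigma, norm_smul, norm_inv, Real.norm_of_nonneg (radOf_nonneg q)]
  calc (radOf W q)⁻¹ * _ ≤ (radOf W q)⁻¹ * (2 * radOf W q) := by
        gcongr
        · exact inv_nonneg.mpr (radOf_nonneg q)
        · exact norm_real_add_cl_le (abs_fst_le_radOf q) (norm_orthPart_le_radOf q)
    _ = 2 * ((radOf W q)⁻¹ * radOf W q) := by ring
    _ ≤ 2 * 1 := by gcongr; exact inv_mul_le_one
    _ = 2 := by norm_num

theorem continuous_cl_zero : Continuous (cl 0 : H → Coef H) := by
  let L : H →ₗ[ℝ] Coef H :=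
    { toFun := cl 0
      map_add' := fun v w => by simpa using cl_add 0 0 v w
      map_smul' := fun c v => by simpa using cl_smul c 0 v }
  exact AddMonoidHomClass.continuous_of_bound L 1 fun v => by
    simpa [L] using norm_cl_le 0 v

theorem continuousAt_sigma {q : ℝ × W'} (hq : radOf W q ≠ 0) : ContinuousAt (sigma W) q := by
  unfold sigma
  have hi : ContinuousAt (fun q : ℝ × W' => (radOf W q)⁻¹) q :=
    continuous_radOf.continuousAt.inv₀ hq
  have : Continuous fun q : ℝ × W' => q.1 • (1 : Coef H) + cl 0 (orthPart W q.2) :=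
    (continuous_fst.smul continuous_const).add (continuous_cl_zero.comp (by fun_prop))
  exact hi.smul this.continuousAt

/-- The derivative of the distance from `{0} × W` in the direction `z`. -/
def radDeriv (W : Submodule ℝ H) [FiniteDimensional ℝ W] {W' : Submodule ℝ H} (z q : ℝ × W') : ℝ :=
  (radOf W q)⁻¹ * (q.1 * z.1 + inner ℝ (orthPart W q.2) (orthPart W z.2))

/-- A distance function is 1-Lipschitz; here this is Cauchy–Schwarz in `ℝ ⊕ H`. -/
theorem abs_radDeriv_le {z : ℝ × W'} (hz : √(z.1 ^ 2 + ‖z.2‖ ^ 2) ≤ 1) (q : ℝ × W') :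
    |radDeriv W z q| ≤ 1 := by
  have h1 : |q.1 * z.1 + inner ℝ (orthPart W q.2) (orthPart W z.2)| ≤ radOf W q := by
    have e1 := abs_real_inner_le_norm (vec q.1 (orthPart W q.2)) (vec z.1 (orthPart W z.2))
    rw [inner_vec, norm_vec, norm_vec] at e1
    have e2 : √(z.1 ^ 2 + ‖orthPart W z.2‖ ^ 2) ≤ 1 := by
      refine le_trans (Real.sqrt_le_sqrt ?_) hz
      gcongr
      exact norm_orthPart_le z.2
    have e3 := radOf_nonneg (W := W) q
    rw [radOf] at e3 ⊢
    nlinarith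
  rw [radDeriv, abs_mul, abs_inv, abs_of_nonneg (radOf_nonneg q)]
  calc _ ≤ (radOf W q)⁻¹ * radOf W q := by
        gcongr; exact inv_nonneg.mpr (radOf_nonneg q)
    _ ≤ 1 := inv_mul_le_one

theorem continuousAt_radDeriv (z : ℝ × W') {q : ℝ × W'} (hq : radOf W q ≠ 0) :
    ContinuousAt (radDeriv W z) q := by
  unfold radDeriv
  refine ContinuousAt.mul (continuous_radOf.continuousAt.inv₀ hq) ?_
  exact Continuous.continuousAt (by fun_prop)

theorem hasDerivAt_radOf (z : ℝ × W') {q : ℝ × W'} (hq : radOf W q ≠ 0) :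
    HasDerivAt (fun t : ℝ => radOf W (q + t • z)) (radDeriv W z q) 0 := by
  have e : ∀ t : ℝ, (q + t • z).1 ^ 2 + ‖orthPart W (q + t • z).2‖ ^ 2 =
      radOf W q ^ 2 + (2 * (q.1 * z.1 + inner ℝ (orthPart W q.2) (orthPart W z.2))) * t +
        (z.1 ^ 2 + ‖orthPart W z.2‖ ^ 2) * t ^ 2 := fun t => by
    have : (q + t • z).2 = q.2 + t • z.2 := rfl
    rw [this, map_add, map_smul, norm_add_sq_real, inner_smul_right, norm_smul, radOf_sq, mul_pow,
      Real.norm_eq_abs, sq_abs]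
    simp only [Prod.fst_add, Prod.smul_fst, smul_eq_mul]
    ring
  have hp : HasDerivAt (fun t : ℝ => radOf W q ^ 2 + (2 * (q.1 * z.1 +
      inner ℝ (orthPart W q.2) (orthPart W z.2))) * t + (z.1 ^ 2 + ‖orthPart W z.2‖ ^ 2) * t ^ 2)
      (2 * (q.1 * z.1 + inner ℝ (orthPart W q.2) (orthPart W z.2))) 0 := by
    have h1 := ((hasDerivAt_id (0 : ℝ)).const_mul (2 * (q.1 * z.1 +
      inner ℝ (orthPart W q.2) (orthPart W z.2)))).const_add (radOf W q ^ 2)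
    have h2 := (hasDerivAt_pow 2 (0 : ℝ)).const_mul (z.1 ^ 2 + ‖orthPart W z.2‖ ^ 2)
    simpa using! h1.add h2
  have hs := hp.sqrt (by simpa using hq)
  have : (fun t : ℝ => radOf W (q + t • z)) = fun t : ℝ => √(radOf W q ^ 2 + (2 * (q.1 * z.1 +
      inner ℝ (orthPart W q.2) (orthPart W z.2))) * t +
        (z.1 ^ 2 + ‖orthPart W z.2‖ ^ 2) * t ^ 2) := by
    funext t; rw [radOf, e]
  rw [this]
  refine hs.congr_deriv ?_
  simp only [mul_zero, add_zero, ne_eq, OfNat.ofNat_ne_zero, not_false_eq_true, zero_pow]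
  rw [Real.sqrt_sq (radOf_nonneg q), radDeriv]
  field_simp

theorem hasDerivAt_sigma (z : ℝ × W') {q : ℝ × W'} (hq : radOf W q ≠ 0) :
    HasDerivAt (fun t : ℝ => sigma W (q + t • z)) ((radOf W q)⁻¹ •
      ((z.1 • 1 + cl 0 (orthPart W z.2)) - radDeriv W z q • sigma W q)) 0 := by
  have h1 : HasDerivAt (fun t : ℝ => ((q + t • z).1 • (1 : Coef H) + cl 0 (orthPart W (q + t • z).2)))
      (z.1 • 1 + cl 0 (orthPart W z.2)) 0 := by
    have e : (fun t : ℝ => ((q + t • z).1 • (1 : Coef H) + cl 0 (orthPart W (q + t • z).2))) =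
        fun t : ℝ => (q.1 • (1 : Coef H) + cl 0 (orthPart W q.2)) +
          t • (z.1 • (1 : Coef H) + cl 0 (orthPart W z.2)) := by
      funext t
      have : (q + t • z).2 = q.2 + t • z.2 := rfl
      have e1 := cl_add 0 0 (orthPart W q.2) (t • orthPart W z.2)
      have e2 := cl_smul t 0 (orthPart W z.2)
      rw [add_zero] at e1
      rw [mul_zero] at e2
      rw [this, map_add, map_smul, e1, e2]
      simp only [Prod.fst_add, Prod.smul_fst, smul_eq_mul]
      module
    rw [e]
    simpa using! ((hasDerivAt_id (0 : ℝ)).smul_const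
      (z.1 • (1 : Coef H) + cl 0 (orthPart W z.2))).const_add
      (q.1 • (1 : Coef H) + cl 0 (orthPart W q.2))
  have h2 := (hasDerivAt_radOf z hq).inv (by simpa using hq)
  refine (h2.smul h1).congr_deriv ?_
  simp only [sigma, Pi.inv_apply, zero_smul, add_zero]
  rw [smul_sub, smul_smul, smul_smul]
  have : (radOf W q)⁻¹ * radDeriv W z q * (radOf W q)⁻¹ = radDeriv W z q / radOf W q ^ 2 := by
    field_simp
  rw [this, neg_div]
  module

variable [FiniteDimensional ℝ W']

/-- The function on `ℝ × W'` with the same image in `A(V)` as the function `F` on `ℝ × W`. -/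
def enlarge (F : C0W W) : C0W W' :=
  mulPolar (fun _ => 1) 1 (fun _ => norm_one_coef_le) (evenC F) (fun _ _ => continuousAt_const)
      (Or.inr continuous_const) +
    mulPolar (sigma W) 2 norm_sigma_le (oddC F) (fun _ => continuousAt_sigma) (Or.inl (oddC_zero F))

theorem enlarge_apply (F : C0W W) (q : ℝ × W') :
    enlarge F q = evenC F (polar W q) + sigma W q * oddC F (polar W q) := by
  change 1 * evenC F (polar W q) + sigma W q * oddC F (polar W q) = _
  rw [one_mul]

theorem evenC_mem {F : C0W W} (hF : F ∈ AFun W) (q) : evenC F q ∈ cliffOf W := by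
  rw [evenC_apply]; exact evenPart_mem hF q

theorem oddC_mem {F : C0W W} (hF : F ∈ AFun W) (q) : oddC F q ∈ cliffOf W := by
  rw [oddC_apply]; exact oddPart_mem hF q

theorem enlarge_mem (hW : W ≤ W') {F : C0W W} (hF : F ∈ AFun W) :
    (enlarge F : C0W W') ∈ AFun W' := fun q => by
  rw [enlarge_apply]
  refine add_mem (cliffOf_mono hW (evenC_mem hF _)) (mul_mem ?_ (cliffOf_mono hW (oddC_mem hF _)))
  exact real_smul_mem _ _ (add_mem (real_smul_mem _ _ (one_mem _))
    (cl_mem_cliffOf (orthPart_mem hW _)))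

theorem radOf_neg (s : ℝ) (w : W') : radOf W (-s, w) = radOf W (s, w) := by
  simp [radOf]

theorem polar_neg (s : ℝ) (w : W') : polar W (-s, w) = polar W (s, w) := by
  simp [polar, radOf_neg]

/-- The coordinates of a point with respect to `W` in terms of those with respect to `W'`. -/
theorem projection_comp (hW : W ≤ W') (v : H) :
    W.orthogonalProjectionOnto (W'.orthogonalProjectionOnto v : H) = W.orthogonalProjectionOnto v :=
  Submodule.orthogonalProjectionOnto_starProjection_of_le hW v

/-- Pythagoras: `v - v_W` is the orthogonal sum of `v - v_{W'}` and `v_{W'} - v_W`. -/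
theorem polar_rad (hW : W ≤ W') (q : RPlus H) :
    polar W (rad W' q, W'.orthogonalProjectionOnto q.2) =
      (rad W q, W.orthogonalProjectionOnto q.2) := by
  refine Prod.ext ?_ (projection_comp hW q.2)
  change √((rad W' q) ^ 2 + ‖(W'.orthogonalProjectionOnto q.2 : H) -
    W.orthogonalProjectionOnto (W'.orthogonalProjectionOnto q.2 : H)‖ ^ 2) = rad W q
  rw [projection_comp hW]
  have h1 : rad W' q ^ 2 = (q.1 : ℝ) ^ 2 + ‖q.2 - W'.orthogonalProjectionOnto q.2‖ ^ 2 :=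
    Real.sq_sqrt (by positivity)
  have h2 := norm_sq_eq (W := W') (q.2 - W.orthogonalProjectionOnto q.2)
  have h3 : W'.orthogonalProjectionOnto (q.2 - W.orthogonalProjectionOnto q.2) =
      W'.orthogonalProjectionOnto q.2 -
        ⟨W.orthogonalProjectionOnto q.2, hW (W.orthogonalProjectionOnto q.2).2⟩ := by
    rw [map_sub]
    congr 1
    exact W'.orthogonalProjectionOnto_mem_subspace_eq_self ⟨_, _⟩
  rw [h3] at h2
  have h4 : (q.2 - W.orthogonalProjectionOnto q.2 : H) - ((W'.orthogonalProjectionOnto q.2 -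
      ⟨W.orthogonalProjectionOnto q.2, hW (W.orthogonalProjectionOnto q.2).2⟩ : W') : H) =
      q.2 - W'.orthogonalProjectionOnto q.2 := by
    simp
  rw [h4, Submodule.coe_norm, Submodule.coe_sub] at h2
  rw [h1]
  refine congrArg Real.sqrt ?_
  change _ = (q.1 : ℝ) ^ 2 + ‖q.2 - W.orthogonalProjectionOnto q.2‖ ^ 2
  rw [h2]
  ring

/-- Up to the factor `1 / rad W q`, the part of `sigma` even in `s` contributes `v_{W'} - v_W`, and
the odd part, multiplied by the unit vector for `W'`, contributes `t e + (v - v_{W'})`. The sum is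
`t e + (v - v_W)`, which gives the unit vector for `W`. -/
theorem beta_enlarge (hW : W ≤ W') (F : C0W W) :
    beta W' (enlarge F) = beta W F := by
  refine BddFun.ext fun q => ?_
  change betaFun W' _ q = betaFun W _ q
  have hs : ∀ (s : ℝ) (w : W'), sigma W (s, w) + sigma W (-s, w) =
      (radOf W (s, w))⁻¹ • (2 : ℝ) • (cl 0 (orthPart W w) : Coef H) := fun s w => by
    simp only [sigma, radOf_neg]; module
  have hd : ∀ (s : ℝ) (w : W'), sigma W (s, w) - sigma W (-s, w) =
      (radOf W (s, w))⁻¹ • (2 * s) • (1 : Coef H) := fun s w => by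
    simp only [sigma, radOf_neg]; module
  set z : ℝ × W' := (rad W' q, W'.orthogonalProjectionOnto q.2) with hz
  have hpz : polar W z = (rad W q, W.orthogonalProjectionOnto q.2) := polar_rad hW q
  have hrz : radOf W z = rad W q := congrArg Prod.fst hpz
  have he : evenPart (enlarge F) z = evenC F (polar W z) +
      ((rad W q)⁻¹ • (cl 0 (orthPart W z.2) : Coef H)) * oddC F (polar W z) := by
    rw [evenPart, enlarge_apply, enlarge_apply, polar_neg]
    have h := hs z.1 z.2
    rw [show (z.1, z.2) = z from rfl] at h ⊢
    rw [hrz] at h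
    have : (evenC F (polar W z) + sigma W z * oddC F (polar W z) +
        (evenC F (polar W z) + sigma W (-z.1, z.2) * oddC F (polar W z))) =
        (2 : ℝ) • evenC F (polar W z) + (sigma W z + sigma W (-z.1, z.2)) * oddC F (polar W z) := by
      rw [add_mul]; module
    rw [this, h, smul_add, smul_smul, ← smul_mul_assoc, smul_comm _ (2 : ℝ), smul_smul]
    norm_num
  have ho : oddPart (enlarge F) z = ((rad W q)⁻¹ * rad W' q) • oddC F (polar W z) := by
    rw [oddPart, enlarge_apply, enlarge_apply, polar_neg]
    have h := hd z.1 z.2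
    rw [show (z.1, z.2) = z from rfl] at h ⊢
    rw [hrz] at h
    have : (evenC F (polar W z) + sigma W z * oddC F (polar W z) -
        (evenC F (polar W z) + sigma W (-z.1, z.2) * oddC F (polar W z))) =
        (sigma W z - sigma W (-z.1, z.2)) * oddC F (polar W z) := by
      rw [sub_mul]; abel
    rw [this, h, smul_smul, smul_mul_assoc, one_mul, smul_smul]
    congr 1
    change 2⁻¹ * ((rad W q)⁻¹ * (2 * rad W' q)) = _
    ring
  rw [betaFun_eq, betaFun_eq, ← hz, he, ho, hpz]
  rw [evenPart, oddPart, ← evenC_apply, ← oddC_apply, add_assoc]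
  congr 1
  rw [mul_smul_comm, ← smul_mul_assoc, ← add_mul]
  by_cases h0 : rad W q = 0
  · rw [h0, oddC_zero, mul_zero, mul_zero]
  congr 1
  have e1 := rad_mul_cliff_unitAt W q
  have e2 := rad_mul_cliff_unitAt W' q
  have e3 := cl_add 0 (q.1 : ℝ) (orthPart W z.2) (q.2 - W'.orthogonalProjectionOnto q.2)
  have e4 : orthPart W z.2 + (q.2 - W'.orthogonalProjectionOnto q.2) =
      q.2 - W.orthogonalProjectionOnto q.2 := by
    change ((W'.orthogonalProjectionOnto q.2 : H) -
      W.orthogonalProjectionOnto (W'.orthogonalProjectionOnto q.2 : H)) + _ = _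
    rw [projection_comp hW]; abel
  rw [e4, zero_add, ← e1, ← e2] at e3
  rw [← inv_smul_smul₀ h0 (cliff (unitAt W q)), e3, smul_add, smul_smul]

/-- The derivative of `enlarge F` in the direction `z`. -/
def enlargeDeriv (z : ℝ × W') (hz : √(z.1 ^ 2 + ‖z.2‖ ^ 2) ≤ 1) (Gs Gh E : C0W W)
    (hE : ∀ w, E (0, w) = evenC Gs (0, w)) : C0W W' :=
  mulPolar (fun _ => 1) 1 (fun _ => norm_one_coef_le) (evenC Gh) (fun _ _ => continuousAt_const)
      (Or.inr continuous_const) +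
    mulPolar (fun q => radDeriv W z q • 1) 1 (fun q => by
      rw [norm_smul, Real.norm_eq_abs]
      exact mul_le_one₀ (abs_radDeriv_le hz q) (norm_nonneg _) norm_one_coef_le) (oddC Gs)
      (fun _ hq => (continuousAt_radDeriv z hq).smul continuousAt_const) (Or.inl (oddC_zero Gs)) +
    mulPolar (fun _ => z.1 • 1 + cl 0 (orthPart W z.2)) ‖z.1 • (1 : Coef H) + cl 0 (orthPart W z.2)‖
      (fun _ => le_rfl) E (fun _ _ => continuousAt_const) (Or.inr continuous_const) +
    mulPolar (fun q => radDeriv W z q • sigma W q) (1 * 2) (fun q => by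
      rw [norm_smul, Real.norm_eq_abs]
      exact mul_le_mul (abs_radDeriv_le hz q) (norm_sigma_le q) (norm_nonneg _) zero_le_one)
      (evenC Gs - E)
      (fun _ hq => (continuousAt_radDeriv z hq).smul (continuousAt_sigma hq))
      (Or.inl fun w => sub_eq_zero.mpr (hE w).symm) +
    mulPolar (sigma W) 2 norm_sigma_le (oddC Gh) (fun _ => continuousAt_sigma)
      (Or.inl (oddC_zero Gh))

theorem enlargeDeriv_apply (z : ℝ × W') (hz : √(z.1 ^ 2 + ‖z.2‖ ^ 2) ≤ 1) (Gs Gh E : C0W W)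
    (hE : ∀ w, E (0, w) = evenC Gs (0, w)) (q : ℝ × W') :
    enlargeDeriv z hz Gs Gh E hE q = evenC Gh (polar W q) + radDeriv W z q • oddC Gs (polar W q) +
      (z.1 • 1 + cl 0 (orthPart W z.2)) * E (polar W q) +
      radDeriv W z q • (sigma W q * (evenC Gs (polar W q) - E (polar W q))) +
      sigma W q * oddC Gh (polar W q) := by
  change 1 * _ + (radDeriv W z q • 1) * _ + _ + (radDeriv W z q • sigma W q) * _ + _ = _
  rw [one_mul, smul_mul_assoc, one_mul, smul_mul_assoc]
  rfl

theorem polar_line (z q : ℝ × W') (t : ℝ) :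
    polar W (q + t • z) = (radOf W (q + t • z), projPart W q.2 + t • projPart W z.2) := by
  refine Prod.ext rfl ?_
  change projPart W (q.2 + t • z.2) = _
  rw [map_add, map_smul]

/-- The derivative of `sigma` carries a factor `(radOf W q)⁻¹`, which cancels against `oddC F =
radOf W q • E`. The resulting formula has no unbounded factor and stays continuous across the set of
radius zero. -/
theorem hasLineDerivAt_enlarge_of_ne {F Gs Gh E : C0W W} {z : ℝ × W'}
    (hz : √(z.1 ^ 2 + ‖z.2‖ ^ 2) ≤ 1) (hs : ∀ q, HasLineDerivAt ℝ F (Gs q) q (1, 0))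
    (hh : ∀ q, HasLineDerivAt ℝ F (Gh q) q (0, projPart W z.2))
    (hE1 : ∀ a w, oddC F (a, w) = a • E (a, w)) (hE : ∀ w, E (0, w) = evenC Gs (0, w))
    {q : ℝ × W'} (hq : radOf W q ≠ 0) :
    HasLineDerivAt ℝ (enlarge F) (enlargeDeriv z hz Gs Gh E hE q) q z := by
  have hr := hasDerivAt_radOf z hq
  have d1 := hasDerivAt_evenC_comp_curve hs hh hr (projPart W q.2)
  have d2 := hasDerivAt_oddC_comp_curve hs hh hr (projPart W q.2)
  have d3 := d1.add ((hasDerivAt_sigma z hq).mul d2)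
  unfold HasLineDerivAt
  have hfun : (fun t : ℝ => enlarge F (q + t • z)) = fun t : ℝ =>
      evenC F (radOf W (q + t • z), projPart W q.2 + t • projPart W z.2) +
      sigma W (q + t • z) * oddC F (radOf W (q + t • z), projPart W q.2 + t • projPart W z.2) := by
    funext t
    rw [enlarge_apply, polar_line]
  rw [hfun]
  refine d3.congr_deriv ?_
  simp only [zero_smul, add_zero]
  rw [enlargeDeriv_apply, hE1, mul_smul_comm, ← smul_mul_assoc, smul_smul, mul_inv_cancel₀ hq,
    one_smul, show polar W q = (radOf W q, projPart W q.2) from rfl, sub_mul, smul_mul_assoc,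
    mul_add, mul_smul_comm, mul_sub, smul_sub]
  abel

theorem HasLineDerivAt.of_translate {E F : Type*} [AddCommGroup E] [Module ℝ E]
    [NormedAddCommGroup F] [NormedSpace ℝ F] {f : E → F} {q z : E} {t : ℝ} {d : F}
    (h : HasLineDerivAt ℝ f d (q + t • z) z) : HasDerivAt (fun t : ℝ => f (q + t • z)) d t := by
  have h3 := HasDerivAt.comp_sub_const (f := fun u : ℝ => f (q + t • z + u • z)) (f' := d) t t
    (by rw [sub_self]; exact h)
  refine h3.congr_of_eventuallyEq (Eventually.of_forall fun u => ?_)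
  change f _ = f _
  congr 1
  module

theorem hasLineDerivAt_enlarge {F Gs Gh E : C0W W} {z : ℝ × W'}
    (hz : √(z.1 ^ 2 + ‖z.2‖ ^ 2) ≤ 1) (hs : ∀ q, HasLineDerivAt ℝ F (Gs q) q (1, 0))
    (hh : ∀ q, HasLineDerivAt ℝ F (Gh q) q (0, projPart W z.2))
    (hE1 : ∀ a w, oddC F (a, w) = a • E (a, w)) (hE : ∀ w, E (0, w) = evenC Gs (0, w))
    (q : ℝ × W') :
    HasLineDerivAt ℝ (enlarge F) (enlargeDeriv z hz Gs Gh E hE q) q z := by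
  by_cases hq : radOf W q = 0
  swap
  · exact hasLineDerivAt_enlarge_of_ne hz hs hh hE1 hE hq
  have hq1 : q.1 = 0 := abs_nonpos_iff.mp ((abs_fst_le_radOf q).trans hq.le)
  have hq2 : orthPart W q.2 = 0 := norm_le_zero_iff.mp ((norm_orthPart_le_radOf q).trans hq.le)
  have hline : ∀ t : ℝ, radOf W (q + t • z) = |t| * radOf W z := fun t => by
    have h1 : (q + t • z).1 = t * z.1 := by simp [hq1]
    have h2 : orthPart W (q + t • z).2 = t • orthPart W z.2 := by
      change orthPart W (q.2 + t • z.2) = _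
      rw [map_add, map_smul, hq2, zero_add]
    rw [radOf, h1, h2, norm_smul, mul_pow, mul_pow, Real.norm_eq_abs, sq_abs, ← mul_add,
      Real.sqrt_mul (sq_nonneg t), Real.sqrt_sq_eq_abs]
    rfl
  -- A line through a point of radius zero either stays at radius zero, where only the even part is
  -- seen, or leaves at once, and then the derivative at 0 is the limit of the derivatives at `t ≠
  -- 0`.
  by_cases hz0 : radOf W z = 0
  · have hz1 : z.1 = 0 := abs_nonpos_iff.mp ((abs_fst_le_radOf z).trans hz0.le)
    have hz2 : orthPart W z.2 = 0 := norm_le_zero_iff.mp ((norm_orthPart_le_radOf z).trans hz0.le)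
    have hcl : (cl 0 0 : Coef H) = 0 := by
      have : (vec 0 0 : WithLp 2 (ℝ × H)) = 0 := rfl
      rw [cl_eq, this, cliff_zero]
    have d1 := hasDerivAt_evenC_comp_curve hs hh (hasDerivAt_const (0 : ℝ) (0 : ℝ)) (projPart W q.2)
    have hp : polar W q = (0, projPart W q.2) := by rw [polar, hq]
    have hval : enlargeDeriv z hz Gs Gh E hE q = evenC Gh (0, projPart W q.2) := by
      rw [enlargeDeriv_apply, hp, hz1, hz2, hcl, oddC_zero, oddC_zero, radDeriv, hq]
      simp
    rw [hval]
    unfold HasLineDerivAt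
    have hfun : (fun t : ℝ => enlarge F (q + t • z)) = fun t : ℝ =>
        evenC F (0, projPart W q.2 + t • projPart W z.2) := by
      funext t
      rw [enlarge_apply, polar_line, hline, hz0, mul_zero, oddC_zero, mul_zero, add_zero]
    rw [hfun]
    simpa using d1
  · have hcont : Continuous fun t : ℝ => q + t • z := by fun_prop
    have := hasDerivAt_of_hasDerivAt_of_ne (f := fun t : ℝ => enlarge F (q + t • z))
      (g := fun t : ℝ => enlargeDeriv z hz Gs Gh E hE (q + t • z)) (x := 0) (fun t ht =>
        (hasLineDerivAt_enlarge_of_ne hz hs hh hE1 hE (by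
          rw [hline]; exact mul_ne_zero (abs_ne_zero.mpr ht) hz0)).of_translate)
      ((enlarge F).continuous.comp hcont).continuousAt
      ((enlargeDeriv z hz Gs Gh E hE).continuous.comp hcont).continuousAt
    simpa [HasLineDerivAt] using this

theorem norm_add_five_le {E : Type*} [SeminormedAddCommGroup E] (x₁ x₂ x₃ x₄ x₅ : E) :
    ‖x₁ + x₂ + x₃ + x₄ + x₅‖ ≤ ‖x₁‖ + ‖x₂‖ + ‖x₃‖ + ‖x₄‖ + ‖x₅‖ := by
  linarith [norm_add_le (x₁ + x₂ + x₃ + x₄) x₅, norm_add_le (x₁ + x₂ + x₃) x₄,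
    norm_add₃_le (a := x₁) (b := x₂) (c := x₃)]

/-- The five terms contribute `c`, `c`, `2 * c`, `4 * c` and `2 * c`. -/
theorem norm_enlargeDeriv_le {Gs Gh E : C0W W} {z : ℝ × W'} {c : ℝ}
    (hz : √(z.1 ^ 2 + ‖z.2‖ ^ 2) ≤ 1) (hE : ∀ w, E (0, w) = evenC Gs (0, w))
    (hsc : ∀ q, ‖Gs q‖ ≤ c) (hhc : ∀ q, ‖Gh q‖ ≤ c) (hEc : ∀ q, ‖E q‖ ≤ c) (q : ℝ × W') :
    ‖enlargeDeriv z hz Gs Gh E hE q‖ ≤ 10 * c := by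
  rw [enlargeDeriv_apply]
  have hv : ‖z.2‖ ≤ 1 := (Real.le_sqrt_of_sq_le (by nlinarith [sq_nonneg z.1])).trans hz
  have hs1 : |z.1| ≤ 1 := (Real.abs_le_sqrt (by nlinarith [sq_nonneg ‖z.2‖])).trans hz
  have hr := abs_radDeriv_le (W := W) hz q
  have hσ := norm_sigma_le (W := W) q
  have h2 := norm_real_add_cl_le (H := H) hs1 ((norm_orthPart_le (W := W) z.2).trans hv)
  have b1 := norm_evenC_le hhc (polar W q)
  have b2 := norm_oddC_le hsc (polar W q)
  have b3 := norm_evenC_le hsc (polar W q)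
  have b4 := norm_oddC_le hhc (polar W q)
  have b5 := hEc (polar W q)
  have hc : 0 ≤ c := (norm_nonneg _).trans b5
  generalize radDeriv W z q = ρ at *
  generalize sigma W q = σ at *
  generalize z.1 • 1 + cl 0 (orthPart W z.2) = ζ at *
  generalize evenC Gh (polar W q) = x₁ at *
  generalize oddC Gs (polar W q) = x₂ at *
  generalize evenC Gs (polar W q) = x₃ at *
  generalize oddC Gh (polar W q) = x₄ at *
  generalize E (polar W q) = x₅ at *
  have n2 : ‖ρ • x₂‖ ≤ c := by
    rw [norm_smul, Real.norm_eq_abs]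
    exact (mul_le_of_le_one_left (norm_nonneg _) hr).trans b2
  have n3 : ‖ζ * x₅‖ ≤ 2 * c :=
    (norm_mul_le _ _).trans (mul_le_mul (by linarith) b5 (norm_nonneg _) (by norm_num))
  have n4 : ‖ρ • (σ * (x₃ - x₅))‖ ≤ 2 * (2 * c) := by
    rw [norm_smul, Real.norm_eq_abs]
    refine (mul_le_of_le_one_left (norm_nonneg _) hr).trans ((norm_mul_le _ _).trans ?_)
    exact mul_le_mul hσ ((norm_sub_le _ _).trans (by linarith)) (norm_nonneg _) (by norm_num)
  have n5 : ‖σ * x₄‖ ≤ 2 * c :=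
    (norm_mul_le _ _).trans (mul_le_mul hσ b4 (norm_nonneg _) (by norm_num))
  refine (norm_add_five_le _ _ _ _ _).trans ?_
  linarith only [b1, n2, n3, n4, n5]

theorem C1Bound.enlarge {c : ℝ} {F : C0W W} (h : C1Bound c F) :
    C1Bound (10 * c) (_root_.enlarge F : C0W W') := by
  intro s v hsv
  obtain ⟨Gs, hs, hsc⟩ := h 1 0 (by simp)
  have hv : ‖v‖ ≤ 1 := (Real.le_sqrt_of_sq_le (by nlinarith [sq_nonneg s])).trans hsv
  obtain ⟨Gh, hh, hhc⟩ := h 0 (projPart W v) (by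
    rw [zero_pow two_ne_zero, zero_add, Real.sqrt_sq (norm_nonneg _)]
    exact (norm_projPart_le v).trans hv)
  obtain ⟨E, hE1, hE, hEc⟩ := exists_oddC_eq_smul hs hsc
  exact ⟨enlargeDeriv (s, v) hsv Gs Gh E hE,
    hasLineDerivAt_enlarge (z := (s, v)) hsv hs hh hE1 hE,
    norm_enlargeDeriv_le (z := (s, v)) hsv hE hsc hhc hEc⟩

/-- The constant is `2 * 10 * 2`: out of `hat` form, enlargement, back into `hat` form. It depends
neither on `W` nor on `W'`, which keeps derivative bounds uniform over all entries of a matrix. -/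
theorem HasLift.enlarge (hW : W ≤ W') {c : ℝ} {a : BddFun H} (h : HasLift W c a) :
    HasLift W' (40 * c) a := by
  obtain ⟨Φ, h1, h2, h3⟩ := h
  have hF := h1.hat_mem
  have hF' := enlarge_mem hW hF
  refine ⟨hat (_root_.enlarge (hat Φ)), isHat_hat hF', h2.hat.enlarge.hat.mono (by linarith),
    fun q => ?_⟩
  rw [← beta_val_eq W' hF', beta_enlarge hW, h1.beta_val, h3]

end Change

end Enlarge

/-! ### The topology of `ℝ₊ × H`. -/

section Points

variable {H : Type w} [NormedAddCommGroup H] [InnerProductSpace ℝ H]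

theorem RPlus.isInducing : Topology.IsInducing (fun q : RPlus H =>
    (((q.1 : ℝ) ^ 2 + ‖q.2‖ ^ 2, fun u => inner ℝ q.2 u) : ℝ × (H → ℝ))) := ⟨rfl⟩

theorem RPlus.continuous_normSq : Continuous fun q : RPlus H => (q.1 : ℝ) ^ 2 + ‖q.2‖ ^ 2 :=
  continuous_fst.comp RPlus.isInducing.continuous

theorem RPlus.continuous_mk {Z : Type*} [TopologicalSpace Z] {t : Z → ℝ≥0} {h : Z → H}
    (h1 : Continuous t) (h2 : Continuous h) : Continuous (Y := RPlus H) fun z => (t z, h z) := by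
  refine RPlus.isInducing.continuous_iff.mpr ?_
  refine Continuous.prodMk ?_ (continuous_pi fun u => ?_)
  · exact ((NNReal.continuous_coe.comp h1).pow 2).add (h2.norm.pow 2)
  · exact h2.inner continuous_const

/-- A form of Banach–Alaoglu. By Riesz, points yield exactly the pairs of a number `L` and a linear
functional bounded by `√L`, a closed subset of a product of compact intervals; the coordinate in
`ℝ₊` is recovered as `√(L - ‖v‖ ^ 2)`. -/
theorem RPlus.isCompact_closedBall [CompleteSpace H] (R : ℝ) :
    IsCompact {q : RPlus H | (q.1 : ℝ) ^ 2 + ‖q.2‖ ^ 2 ≤ R} := by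
  rw [RPlus.isInducing.isCompact_iff]
  have himg : (fun q : RPlus H => (((q.1 : ℝ) ^ 2 + ‖q.2‖ ^ 2, fun u => inner ℝ q.2 u) :
      ℝ × (H → ℝ))) '' {q : RPlus H | (q.1 : ℝ) ^ 2 + ‖q.2‖ ^ 2 ≤ R} =
      {z : ℝ × (H → ℝ) | 0 ≤ z.1 ∧ z.1 ≤ R ∧ (∀ u u', z.2 (u + u') = z.2 u + z.2 u') ∧
        (∀ (c : ℝ) u, z.2 (c • u) = c * z.2 u) ∧ ∀ u, |z.2 u| ≤ √z.1 * ‖u‖} := by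
    ext ⟨L, φ⟩
    constructor
    · rintro ⟨q, hq, e⟩
      rw [Prod.mk.injEq] at e
      obtain ⟨rfl, rfl⟩ := e
      refine ⟨by positivity, hq, fun u u' => inner_add_right _ _ _, fun c u =>
        inner_smul_right _ _ _, fun u => (abs_real_inner_le_norm _ _).trans ?_⟩
      gcongr
      exact Real.le_sqrt_of_sq_le (by nlinarith [sq_nonneg (q.1 : ℝ)])
    · rintro ⟨h0, h1, h2, h3, h4⟩
      let ψ : H →L[ℝ] ℝ := LinearMap.mkContinuous ⟨⟨φ, h2⟩, h3⟩ (√L) h4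
      have hψ : ∀ u, ψ u = φ u := fun u => rfl
      let v : H := (InnerProductSpace.toDual ℝ H).symm ψ
      have hv : ∀ u, inner ℝ v u = φ u := fun u => by
        rw [InnerProductSpace.toDual_symm_apply, hψ]
      have hvn : ‖v‖ ^ 2 ≤ L := by
        have : ‖v‖ ≤ √L := by
          rw [LinearIsometryEquiv.norm_map]
          exact LinearMap.mkContinuous_norm_le _ (Real.sqrt_nonneg _) _
        calc ‖v‖ ^ 2 ≤ √L ^ 2 := by gcongr
          _ = L := Real.sq_sqrt h0
      have e : ((⟨√(L - ‖v‖ ^ 2), Real.sqrt_nonneg _⟩ : ℝ≥0) : ℝ) ^ 2 + ‖v‖ ^ 2 = L := by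
        change √(L - ‖v‖ ^ 2) ^ 2 + _ = _
        rw [Real.sq_sqrt (by linarith)]; ring
      exact ⟨(⟨√(L - ‖v‖ ^ 2), Real.sqrt_nonneg _⟩, v), e.le.trans h1, Prod.ext e (funext hv)⟩
  rw [himg]
  have hK : IsCompact ((Set.Icc 0 R) ×ˢ Set.univ.pi fun u : H =>
      Set.Icc (-(√R * ‖u‖)) (√R * ‖u‖)) :=
    isCompact_Icc.prod (isCompact_univ_pi fun u => isCompact_Icc)
  refine hK.of_isClosed_subset ?_ ?_
  · simp only [Set.ofPred_and, Set.ofPred_forall]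
    refine (isClosed_le (by fun_prop) (by fun_prop)).inter
      ((isClosed_le (by fun_prop) (by fun_prop)).inter (IsClosed.inter ?_ (IsClosed.inter ?_ ?_)))
    · exact isClosed_iInter fun u => isClosed_iInter fun u' =>
        isClosed_eq (by fun_prop) (by fun_prop)
    · exact isClosed_iInter fun c => isClosed_iInter fun u =>
        isClosed_eq (by fun_prop) (by fun_prop)
    · exact isClosed_iInter fun u => isClosed_le (by fun_prop) (by fun_prop)
  · rintro ⟨L, φ⟩ ⟨h0, h1, h2, h3, h4⟩
    refine ⟨⟨h0, h1⟩, fun u _ => ?_⟩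
    exact abs_le.mp ((h4 u).trans (by gcongr))

/-- At every point some `C₀`-function does not vanish. -/
theorem RPlus.exists_ne_zero [CompleteSpace H] (q : RPlus H) :
    ∃ g : ZeroAtInftyContinuousMap (RPlus H) ℂ, g q ≠ 0 := by
  let R : ℝ := (q.1 : ℝ) ^ 2 + ‖q.2‖ ^ 2 + 1
  let g : RPlus H → ℂ := fun q' => ((max 0 (R - ((q'.1 : ℝ) ^ 2 + ‖q'.2‖ ^ 2)) : ℝ) : ℂ)
  have hg : Continuous g := Complex.continuous_ofReal.comp
    (continuous_const.max (continuous_const.sub RPlus.continuous_normSq))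
  have hc : HasCompactSupport g := by
    refine HasCompactSupport.intro' (RPlus.isCompact_closedBall R)
      (isClosed_le RPlus.continuous_normSq continuous_const) fun q' hq' => ?_
    have : R < (q'.1 : ℝ) ^ 2 + ‖q'.2‖ ^ 2 := not_le.mp hq'
    simp only [g]
    rw [max_eq_left (by linarith)]; simp
  refine ⟨⟨⟨g, hg⟩, hc.is_zero_at_infty⟩, ?_⟩
  change g q ≠ 0
  simp [g, R]

end Points

/-! ### Supports of elements of `A(V)`. -/

section Supp

variable {H : Type w} [NormedAddCommGroup H] [InnerProductSpace ℝ H] {V : Submodule ℝ H}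

namespace AlgA

theorem ext {a b : AlgA V} (h : ∀ q, a.toFun.val q = b.toFun.val q) : a = b :=
  Subtype.ext (BddFun.ext h)

@[simp] theorem toFun_add (a b : AlgA V) : (a + b).toFun = a.toFun + b.toFun := rfl
@[simp] theorem toFun_sub (a b : AlgA V) : (a - b).toFun = a.toFun - b.toFun := rfl
@[simp] theorem toFun_mul (a b : AlgA V) : (a * b).toFun = a.toFun * b.toFun := rfl
@[simp] theorem toFun_star (a : AlgA V) : (star a).toFun = star a.toFun := rfl
@[simp] theorem toFun_smul (c : ℂ) (a : AlgA V) : (c • a).toFun = c • a.toFun := rfl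
@[simp] theorem toFun_zero : (0 : AlgA V).toFun = 0 := rfl

/-- `AlgA.toFun` as an additive homomorphism. -/
def toFunHom : AlgA V →+ BddFun H where
  toFun := AlgA.toFun
  map_zero' := rfl
  map_add' _ _ := rfl

theorem toFun_sum {ι : Type*} (s : Finset ι) (a : ι → AlgA V) :
    (∑ i ∈ s, a i).toFun = ∑ i ∈ s, (a i).toFun := map_sum toFunHom a s

end AlgA

theorem mem_supp_of_ne_zero {a : AlgA V} {q : RPlus H} (h : a.toFun.val q ≠ 0) : q ∈ supp a := by
  rintro ⟨g, hg, hz⟩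
  exact h ((smul_eq_zero.mp (hz q)).resolve_left hg)

/-- At a point outside both supports, the product of the two witnessing `C₀`-functions annihilates
`c`. -/
theorem supp_subset_union {a b c : AlgA V}
    (h : ∀ q, a.toFun.val q = 0 → b.toFun.val q = 0 → c.toFun.val q = 0) :
    supp c ⊆ supp a ∪ supp b := by
  intro q hq
  by_contra hn
  simp only [Set.mem_union, not_or, supp, Set.mem_compl_iff, not_not] at hn
  obtain ⟨⟨g, hg, hgz⟩, g', hg', hgz'⟩ := hn
  refine hq ⟨g * g', mul_ne_zero hg hg', fun q' => ?_⟩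
  change (g q' * g' q') • _ = _
  by_cases h1 : g q' = 0
  · rw [h1, zero_mul, zero_smul]
  by_cases h2 : g' q' = 0
  · rw [h2, mul_zero, zero_smul]
  rw [h q' ((smul_eq_zero.mp (hgz q')).resolve_left h1)
    ((smul_eq_zero.mp (hgz' q')).resolve_left h2), smul_zero]

theorem supp_subset_supp {a c : AlgA V}
    (h : ∀ q, a.toFun.val q = 0 → c.toFun.val q = 0) : supp c ⊆ supp a := by
  simpa using supp_subset_union (a := a) (b := a) fun q h1 _ => h q h1

theorem supp_star_subset (a : AlgA V) : supp (star a) ⊆ supp a :=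
  supp_subset_supp fun q h => by simp [h]

theorem supp_mul_subset_left (a b : AlgA V) : supp (a * b) ⊆ supp a :=
  supp_subset_supp fun q h => by simp [h]

/-- Without a nonvanishing `C₀`-function at a point, even zero would have that point in its support;
completeness of `H` enters here. -/
theorem supp_zero [CompleteSpace H] : supp (0 : AlgA V) = ∅ := by
  refine Set.eq_empty_of_forall_notMem fun q hq => hq ?_
  obtain ⟨g, hg⟩ := RPlus.exists_ne_zero q
  exact ⟨g, hg, fun q' => by simp⟩

theorem supp_sum_subset [CompleteSpace H] {ι : Type*} (s : Finset ι) (a : ι → AlgA V)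
    {O : Set (RPlus H)} (h : ∀ i ∈ s, supp (a i) ⊆ O) : supp (∑ i ∈ s, a i) ⊆ O := by
  classical
  induction s using Finset.induction_on with
  | empty => simp [supp_zero]
  | insert i s hi ih =>
    rw [Finset.sum_insert hi]
    refine (supp_subset_union (a := a i) (b := ∑ i ∈ s, a i) fun q h1 h2 => ?_).trans
      (Set.union_subset (h i (by simp)) (ih fun j hj => h j (by simp [hj])))
    simp only [AlgA.toFun_add, BddFun.val_add, h1, h2, add_zero]

theorem mem_ballR_iff {x : H} {r : ℝ} (hr : 0 < r) {q : RPlus H} :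
    q ∈ ballR x r ↔ ‖vec (q.1 : ℝ) (q.2 - x)‖ < r := by
  rw [← sq_lt_sq₀ (norm_nonneg _) hr.le, norm_vec_sq]
  rfl

theorem ballR_subset {x x' : H} {r r' : ℝ} (hr : 0 < r) (h : ‖x - x'‖ + r ≤ r') :
    ballR x r ⊆ ballR x' r' := by
  intro q hq
  rw [mem_ballR_iff hr] at hq
  rw [mem_ballR_iff (hr.trans_le (by linarith [norm_nonneg (x - x')]))]
  have e : vec (q.1 : ℝ) (q.2 - x') = vec (q.1 : ℝ) (q.2 - x) + vec 0 (x - x') := by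
    have : vec (q.1 : ℝ) (q.2 - x) + vec 0 (x - x') = vec ((q.1 : ℝ) + 0) (q.2 - x + (x - x')) := rfl
    rw [this, add_zero, sub_add_sub_cancel]
  have h2 : ‖(vec 0 (x - x') : WithLp 2 (ℝ × H))‖ = ‖x - x'‖ := by rw [norm_vec]; simp
  rw [e]
  linarith [norm_add_le (vec (q.1 : ℝ) (q.2 - x)) (vec 0 (x - x'))]

theorem norm_sub_lt_of_mem_ballR {x x' : H} {r r' : ℝ} (hr : 0 < r) (hr' : 0 < r') {q : RPlus H}
    (h : q ∈ ballR x r) (h' : q ∈ ballR x' r') : ‖x - x'‖ < r + r' := by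
  rw [mem_ballR_iff hr] at h
  rw [mem_ballR_iff hr'] at h'
  have e : vec 0 (x - x') = vec (q.1 : ℝ) (q.2 - x') - vec (q.1 : ℝ) (q.2 - x) := by
    have : vec (q.1 : ℝ) (q.2 - x') - vec (q.1 : ℝ) (q.2 - x) =
      vec ((q.1 : ℝ) - q.1) (q.2 - x' - (q.2 - x)) := rfl
    rw [this, sub_self, sub_sub_sub_cancel_left]
  have h2 : ‖(vec 0 (x - x') : WithLp 2 (ℝ × H))‖ = ‖x - x'‖ := by rw [norm_vec]; simp
  rw [← h2, e]
  linarith [norm_sub_le (vec (q.1 : ℝ) (q.2 - x')) (vec (q.1 : ℝ) (q.2 - x))]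

theorem HasLift.mem_algASub {W : Submodule ℝ H} [FiniteDimensional ℝ W] (hW : W ≤ V) {c : ℝ}
    {a : BddFun H} (h : HasLift W c a) : a ∈ AlgASub V := by
  obtain ⟨F, hF, rfl, -⟩ := h.exists_derivs
  exact NonUnitalStarSubalgebra.le_topologicalClosure _
    (NonUnitalStarAlgebra.subset_adjoin ℂ _ ⟨W, ‹_›, hW, F, hF, rfl⟩)

end Supp

/-! ### The twisted matrices form a `*`-algebra. -/

section Twisted

variable {X : Type u} {Y : Type v} {H : Type w} [MetricSpace X] [MetricSpace Y]
  [NormedAddCommGroup H] [InnerProductSpace ℝ H] [BoundedGeometry Y] {p : X → Y} {f : Y → H}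
  {T S : BandMatrix X (AlgA (spanAll f))}

theorem spanBall_le {f : Y → H} {N N' : ℕ} {y y' : Y} (h : dist y y' + (N : ℝ) ^ 2 ≤ (N' : ℝ) ^ 2) :
    spanBall f N y ≤ spanBall f N' y' :=
  Submodule.span_mono (Set.image_mono fun z (hz : dist y z ≤ (N : ℝ) ^ 2) => by
    change dist y' z ≤ _
    linarith [dist_triangle y' y z, dist_comm y y'])

theorem spanBall_le_spanAll (f : Y → H) (N : ℕ) (y : Y) : spanBall f N y ≤ spanAll f :=
  Submodule.span_mono (Set.image_subset_range _ _)

theorem exists_nat_sq_ge (a : ℝ) : ∃ N : ℕ, a ≤ (N : ℝ) ^ 2 := by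
  obtain ⟨n, hn⟩ := exists_nat_ge a
  refine ⟨n + 1, ?_⟩
  push_cast
  nlinarith

/-- All entries of `T` in the row `x` have continuously differentiable representatives over
`W_N(p x)` with derivatives bounded by `c`. -/
def HasLifts (p : X → Y) (f : Y → H) (N : ℕ) (c : ℝ) (T : BandMatrix X (AlgA (spanAll f))) : Prop :=
  ∀ x y, HasLift (spanBall f N (p x)) c (T.entry x y).toFun

theorem IsTwisted.exists_hasLifts (h : IsTwisted p f T) : ∃ N c, HasLifts p f N c T := by
  obtain ⟨N, c, h⟩ := h.smooth
  refine ⟨N, 4 * c, fun x y => ?_⟩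
  obtain ⟨F, hF, e, hd⟩ := h x y
  rw [← e]
  exact hasLift_of_derivs hF hd

theorem HasLifts.smooth {N : ℕ} {c : ℝ} (h : HasLifts p f N c T) : ∃ (N : ℕ) (c : ℝ), ∀ x y,
    ∃ F ∈ AFun (spanBall f N (p x)), beta (spanBall f N (p x)) F = (T.entry x y).toFun ∧
    ∀ (s : ℝ) (h : spanBall f N (p x)), √(s ^ 2 + ‖h‖ ^ 2) ≤ 1 →
      ∃ G ∈ AFun (spanBall f N (p x)), (∀ q, HasLineDerivAt ℝ F (G q) q (s, h)) ∧
        ‖beta (spanBall f N (p x)) G‖ ≤ c :=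
  ⟨N, 4 * c, fun x y => (h x y).exists_derivs⟩

theorem IsTwisted.bounded' (h : IsTwisted p f T) : ∃ M : ℝ, 0 ≤ M ∧ ∀ x y, ‖T.entry x y‖ ≤ M := by
  obtain ⟨M, hM⟩ := h.bounded
  exact ⟨max M 0, le_max_right _ _, fun x y => (hM x y).trans (le_max_left _ _)⟩

theorem exists_dist_image_le (hp : UniformlyExpansive p) (r : ℝ) :
    ∃ s : ℝ, 0 ≤ s ∧ ∀ x x', dist x x' ≤ r → dist (p x) (p x') ≤ s := by
  obtain ⟨s, hs, h⟩ := hp (max r 0 + 1) (by positivity)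
  exact ⟨s, hs.le, fun x x' hx => (h x x' (by linarith [le_max_left r 0])).le⟩

theorem exists_norm_image_le (hf : IsCoarseEmbedding f) (s : ℝ) :
    ∃ t : ℝ, 0 ≤ t ∧ ∀ y y', dist y y' ≤ s → ‖f y - f y'‖ ≤ t := by
  obtain ⟨ρ₁, ρ₂, -, h2, -, h⟩ := hf
  refine ⟨ρ₂ s.toNNReal, NNReal.coe_nonneg _, fun y y' hy => ?_⟩
  rw [← dist_eq_norm, ← coe_nndist, NNReal.coe_le_coe]
  refine (h y y').2.trans (h2 ?_)
  rw [← NNReal.coe_le_coe, coe_nndist]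
  exact hy.trans (Real.le_coe_toNNReal s)

theorem exists_dist_lt_of_norm_image_lt (hf : IsCoarseEmbedding f) (t : ℝ) :
    ∃ s : ℝ, 0 < s ∧ ∀ y y', ‖f y - f y'‖ < t → dist y y' < s := by
  obtain ⟨ρ₁, ρ₂, h1, -, h3, h⟩ := hf
  obtain ⟨s, hs⟩ := (h3.eventually_ge_atTop t.toNNReal).exists
  refine ⟨s + 1, by positivity, fun y y' hy => ?_⟩
  by_contra! hn
  have h4 : s ≤ nndist y y' := by
    rw [← NNReal.coe_le_coe, coe_nndist]; linarith
  have h5 := (hs.trans (h1 h4)).trans (h y y').1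
  rw [← NNReal.coe_le_coe, coe_nndist, dist_eq_norm] at h5
  linarith [Real.le_coe_toNNReal t]

theorem HasLifts.mono {N N' : ℕ} {c c' : ℝ} (h : HasLifts p f N c T) (hN : N ≤ N')
    (hc : 40 * c ≤ c') : HasLifts p f N' c' T := fun x y =>
  ((h x y).enlarge (spanBall_le (by rw [dist_self, zero_add]; gcongr))).mono hc

theorem IsTwisted.zero [CompleteSpace H] : IsTwisted p f 0 where
  smooth := HasLifts.smooth (N := 0) (c := 0) fun _ _ => HasLift.zero
  bounded := ⟨0, fun x y => by simp⟩
  propagation := ⟨1, one_pos, fun _ _ _ => rfl⟩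
  support := ⟨1, one_pos, fun x y => by simp [supp_zero]⟩

theorem IsTwisted.add (hT : IsTwisted p f T) (hS : IsTwisted p f S) : IsTwisted p f (T + S) where
  smooth := by
    obtain ⟨N, c, h⟩ := hT.exists_hasLifts
    obtain ⟨N', c', h'⟩ := hS.exists_hasLifts
    exact HasLifts.smooth fun x y => (h.mono (le_max_left N N') le_rfl x y).add
      (h'.mono (le_max_right N N') le_rfl x y)
  bounded := by
    obtain ⟨M, h⟩ := hT.bounded
    obtain ⟨M', h'⟩ := hS.bounded
    exact ⟨M + M', fun x y => (norm_add_le _ _).trans (add_le_add (h x y) (h' x y))⟩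
  propagation := by
    obtain ⟨r, hr, h⟩ := hT.propagation
    obtain ⟨r', hr', h'⟩ := hS.propagation
    exact ⟨max r r', by positivity, fun x y hxy => by
      simp [h x y ((le_max_left _ _).trans_lt hxy), h' x y ((le_max_right _ _).trans_lt hxy)]⟩
  support := by
    obtain ⟨r, hr, h⟩ := hT.support
    obtain ⟨r', hr', h'⟩ := hS.support
    refine ⟨max r r', by positivity, fun x y => ?_⟩
    refine (supp_subset_union (a := T.entry x y) (b := S.entry x y) fun q h1 h2 => ?_).trans
      (Set.union_subset ((h x y).trans (ballR_subset hr ?_)) ((h' x y).trans (ballR_subset hr' ?_)))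
    · simp [h1, h2]
    · simp
    · simp

theorem IsTwisted.smul (hT : IsTwisted p f T) (z : ℂ) : IsTwisted p f (z • T) where
  smooth := by
    obtain ⟨N, c, h⟩ := hT.exists_hasLifts
    exact HasLifts.smooth fun x y => (h x y).smul z
  bounded := by
    obtain ⟨M, h⟩ := hT.bounded
    exact ⟨‖z‖ * M, fun x y => by
      rw [BandMatrix.smul_entry, norm_smul]; gcongr; exact h x y⟩
  propagation := by
    obtain ⟨r, hr, h⟩ := hT.propagation
    exact ⟨r, hr, fun x y hxy => by simp [h x y hxy]⟩
  support := by
    obtain ⟨r, hr, h⟩ := hT.support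
    exact ⟨r, hr, fun x y => (supp_subset_supp fun q hq => by simp [hq]).trans (h x y)⟩

theorem IsTwisted.star [CompleteSpace H] (hp : UniformlyExpansive p) (hf : IsCoarseEmbedding f)
    (hT : IsTwisted p f T) : IsTwisted p f (star T) := by
  obtain ⟨r, hr, hprop⟩ := hT.propagation
  obtain ⟨s, hs, hps⟩ := exists_dist_image_le hp r
  refine ⟨?_, ?_, ⟨r, hr, fun x y hxy => ?_⟩, ?_⟩
  · obtain ⟨N, c, h⟩ := hT.exists_hasLifts
    -- The entry `(x, y)` of the adjoint lives over `W_N(p y)`, which lies in `W_N'(p x)` since `p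
    -- x` and `p y` are within `s`.
    obtain ⟨N', hN'⟩ := exists_nat_sq_ge (s + (N : ℝ) ^ 2)
    refine HasLifts.smooth (N := N') (c := 40 * max c 0) fun x y => ?_
    rcases le_or_gt (dist y x) r with hxy | hxy
    · exact ((h y x).star.enlarge (spanBall_le (by linarith [hps _ _ hxy]))).mono
        (by gcongr; exact le_max_left _ _)
    · have : (Star.star T).entry x y = 0 := by rw [BandMatrix.star_entry, hprop _ _ hxy, star_zero]
      rw [this]
      exact HasLift.zero.mono (by positivity)
  · obtain ⟨M, h⟩ := hT.bounded
    exact ⟨M, fun x y => (norm_star _).trans_le (h y x)⟩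
  · rw [BandMatrix.star_entry, hprop _ _ (by rwa [dist_comm]), star_zero]
  · obtain ⟨r', hr', h⟩ := hT.support
    obtain ⟨t, ht, hft⟩ := exists_norm_image_le hf s
    refine ⟨t + r', by positivity, fun x y => ?_⟩
    rcases le_or_gt (dist y x) r with hxy | hxy
    · exact (supp_star_subset _).trans ((h y x).trans (ballR_subset hr'
        (by linarith [hft _ _ (hps _ _ hxy)])))
    · rw [BandMatrix.star_entry, hprop _ _ hxy, star_zero, supp_zero]
      exact Set.empty_subset _

/-- The closed ball as a finite set. -/
def ballFinset [BoundedGeometry X] (x : X) (r : ℝ) : Finset X :=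
  (BoundedGeometry.finite_closedBall x r).toFinset

theorem mem_ballFinset [BoundedGeometry X] {x z : X} {r : ℝ} :
    z ∈ ballFinset x r ↔ dist x z ≤ r := by
  rw [ballFinset, Set.Finite.mem_toFinset, Metric.mem_closedBall, dist_comm]

theorem exists_card_ballFinset_le [BoundedGeometry X] (r : ℝ) :
    ∃ N : ℕ, ∀ x : X, (ballFinset x r).card ≤ N := by
  obtain ⟨N, hN⟩ := BoundedGeometry.bound (X := X) (max r 1) (by positivity)
  refine ⟨N, fun x => ?_⟩
  have h1 := (Set.encard_le_encard (Metric.closedBall_subset_closedBall (x := x)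
    (le_max_left r 1))).trans (hN x)
  rw [(BoundedGeometry.finite_closedBall x r).encard_eq_coe_toFinset_card] at h1
  exact_mod_cast h1

theorem mul_entry_eq_sum_ball [BoundedGeometry X] {A : Type*} [NonUnitalRing A]
    {T : BandMatrix X A} {r : ℝ} (h : ∀ x y, r < dist x y → T.entry x y = 0) (S : BandMatrix X A)
    (x y : X) : (T * S).entry x y = ∑ z ∈ ballFinset x r, T.entry x z * S.entry z y :=
  BandMatrix.mul_entry_eq_sum _ _ _ _ _ fun z hz => mem_ballFinset.mpr (by
    by_contra! hn; exact hz (h x z hn))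

theorem norm_sum_le_card_mul {ι E : Type*} [SeminormedAddCommGroup E] (s : Finset ι) (g : ι → E)
    {K : ℝ} {N : ℕ} (hK : 0 ≤ K) (hN : s.card ≤ N) (h : ∀ i ∈ s, ‖g i‖ ≤ K) :
    ‖∑ i ∈ s, g i‖ ≤ N * K := by
  refine (norm_sum_le _ _).trans ((Finset.sum_le_card_nsmul _ _ _ h).trans ?_)
  rw [nsmul_eq_mul]
  gcongr

theorem mul_propagation {A : Type*} [NonUnitalRing A]
    {T S : BandMatrix X A} {r r' : ℝ} (h : ∀ x y, r < dist x y → T.entry x y = 0)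
    (h' : ∀ x y, r' < dist x y → S.entry x y = 0) (x y : X) (hxy : r + r' < dist x y) :
    (T * S).entry x y = 0 := by
  rw [BandMatrix.mul_entry]
  refine finsum_eq_zero_of_forall_eq_zero fun z => ?_
  by_cases hz : r < dist x z
  · rw [h x z hz, zero_mul]
  · rw [h' z y (by linarith [dist_triangle x z y]), mul_zero]

theorem IsTwisted.mul [CompleteSpace H] [BoundedGeometry X] (hp : UniformlyExpansive p)
    (hT : IsTwisted p f T) (hS : IsTwisted p f S) : IsTwisted p f (T * S) := by
  obtain ⟨r, hr, hprop⟩ := hT.propagation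
  obtain ⟨r', hr', hprop'⟩ := hS.propagation
  obtain ⟨s, hs, hps⟩ := exists_dist_image_le hp r
  obtain ⟨K, hK⟩ := exists_card_ballFinset_le (X := X) r
  obtain ⟨M, hM0, hM⟩ := hT.bounded'
  obtain ⟨M', hM0', hM'⟩ := hS.bounded'
  refine ⟨?_, ⟨K * (M * M'), fun x y => ?_⟩, ⟨r + r', by positivity,
    mul_propagation hprop hprop'⟩, ?_⟩
  · obtain ⟨N, c, h⟩ := hT.exists_hasLifts
    obtain ⟨N', c', h'⟩ := hS.exists_hasLifts
    -- `W_N₁(p x)` has to contain the subspace of row `x` of `T` and those of the rows `z` of `S`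
    -- with `z` within `r` of `x`.
    obtain ⟨N₁, hN₁⟩ := exists_nat_sq_ge (s + (N : ℝ) ^ 2 + (N' : ℝ) ^ 2)
    refine HasLifts.smooth (N := N₁) (c := K * (max (40 * c) 0 * M' + M * max (40 * c') 0))
      fun x y => ?_
    rw [mul_entry_eq_sum_ball hprop, AlgA.toFun_sum]
    have hterm : ∀ z ∈ ballFinset x r, HasLift (spanBall f N₁ (p x))
        (max (40 * c) 0 * M' + M * max (40 * c') 0) (T.entry x z * S.entry z y).toFun := by
      intro z hz
      have hz' := hps _ _ (mem_ballFinset.mp hz)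
      have h1 := ((h x z).enlarge (W' := spanBall f N₁ (p x)) (spanBall_le (by
        rw [dist_self]; nlinarith [sq_nonneg (N' : ℝ)]))).mono (le_max_left (40 * c) 0)
      have h2 := ((h' z y).enlarge (W' := spanBall f N₁ (p x)) (spanBall_le (by
        rw [dist_comm]; nlinarith [sq_nonneg (N : ℝ)]))).mono (le_max_left (40 * c') 0)
      exact h1.mul h2 (hM x z) (hM' z y)
    refine (HasLift.sum _ hterm).mono ?_
    gcongr
    exact hK x
  · rw [mul_entry_eq_sum_ball hprop]
    exact norm_sum_le_card_mul _ _ (by positivity) (hK x) fun z _ =>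
      (norm_mul_le _ _).trans (mul_le_mul (hM _ _) (hM' _ _) (norm_nonneg _) hM0)
  · obtain ⟨r₂, hr₂, h⟩ := hT.support
    refine ⟨r₂, hr₂, fun x y => ?_⟩
    rw [mul_entry_eq_sum_ball hprop]
    exact supp_sum_subset _ _ fun z _ => (supp_mul_subset_left _ _).trans (h x z)

/-- This allows the smoothness, propagation and support conditions to be used for every element of
`twistedAlg`. -/
theorem isTwisted_of_mem [CompleteSpace H] [BoundedGeometry X] (hp : UniformlyExpansive p)
    (hf : IsCoarseEmbedding f) (hT : T ∈ twistedAlg p f) : IsTwisted p f T := by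
  induction hT using NonUnitalStarAlgebra.adjoin_induction with
  | mem T h => exact h
  | add T S _ _ h h' => exact h.add h'
  | zero => exact IsTwisted.zero
  | mul T S _ _ h h' => exact h.mul hp h'
  | smul z T _ h => exact h.smul z
  | star T _ h => exact h.star hp hf

theorem IsTwisted.mem_twistedAlg (hT : IsTwisted p f T) : T ∈ twistedAlg p f :=
  NonUnitalStarAlgebra.subset_adjoin ℂ _ hT

end Twisted

/-! ### Matrices acting on columns. -/

section MulVec

variable {X A E : Type*} [NonUnitalRing A] [AddCommGroup E]

/-- The product of a matrix and a column, with respect to an action of the coefficients. -/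
def BandMatrix.mulVec (φ : A →+ E →+ E) (T : BandMatrix X A) (k : X → E) (x : X) : E :=
  ∑ᶠ y, φ (T.entry x y) (k y)

namespace BandMatrix

variable {φ : A →+ E →+ E}

theorem mulVec_eq_sum (T : BandMatrix X A) (k : X → E) (x : X) (s : Finset X)
    (hs : ∀ y, T.entry x y ≠ 0 → y ∈ s) : mulVec φ T k x = ∑ y ∈ s, φ (T.entry x y) (k y) :=
  finsum_eq_sum_of_support_subset _ fun y hy => hs y fun h => hy (by simp [h])

theorem mem_row (T : BandMatrix X A) (x y : X) (h : T.entry x y ≠ 0) :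
    y ∈ (T.row_finite x).toFinset := by simpa using h

theorem mulVec_add (T : BandMatrix X A) (k l : X → E) :
    mulVec φ T (k + l) = mulVec φ T k + mulVec φ T l := by
  ext x
  simp only [Pi.add_apply, mulVec_eq_sum T _ x _ (T.mem_row x), map_add, Finset.sum_add_distrib]

theorem add_mulVec (T S : BandMatrix X A) (k : X → E) :
    mulVec φ (T + S) k = mulVec φ T k + mulVec φ S k := by
  classical
  ext x
  have h1 : ∀ y, T.entry x y ≠ 0 → y ∈ (T.row_finite x).toFinset ∪ (S.row_finite x).toFinset :=
    fun y hy => Finset.mem_union_left _ (T.mem_row x y hy)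
  have h2 : ∀ y, S.entry x y ≠ 0 → y ∈ (T.row_finite x).toFinset ∪ (S.row_finite x).toFinset :=
    fun y hy => Finset.mem_union_right _ (S.mem_row x y hy)
  have h3 : ∀ y, (T + S).entry x y ≠ 0 → y ∈ (T.row_finite x).toFinset ∪ (S.row_finite x).toFinset := by
    intro y hy
    by_contra hn
    rw [add_entry, not_not.mp (mt (h1 y) hn), not_not.mp (mt (h2 y) hn), add_zero] at hy
    exact hy rfl
  rw [Pi.add_apply, mulVec_eq_sum T _ x _ h1, mulVec_eq_sum S _ x _ h2, mulVec_eq_sum (T + S) _ x _ h3,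
    ← Finset.sum_add_distrib]
  simp

theorem mul_mulVec (hφ : ∀ a b e, φ (a * b) e = φ a (φ b e)) (T S : BandMatrix X A) (k : X → E) :
    mulVec φ (T * S) k = mulVec φ T (mulVec φ S k) := by
  classical
  ext x
  let s := (T.row_finite x).toFinset
  let t := s.biUnion fun z => (S.row_finite z).toFinset
  have hs := T.mem_row x
  have ht : ∀ z ∈ s, ∀ y, S.entry z y ≠ 0 → y ∈ t := fun z hz y hy =>
    Finset.mem_biUnion.mpr ⟨z, hz, S.mem_row z y hy⟩
  have hTS : ∀ y, (T * S).entry x y ≠ 0 → y ∈ t := by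
    intro y hy
    rw [mul_entry_eq_sum T S x y s hs] at hy
    obtain ⟨z, hz, h⟩ := Finset.exists_ne_zero_of_sum_ne_zero hy
    exact ht z hz y (right_ne_zero_of_mul h)
  have h1 : ∀ z ∈ s, φ (T.entry x z) (mulVec φ S k z) =
      ∑ y ∈ t, φ (T.entry x z) (φ (S.entry z y) (k y)) := fun z hz => by
    rw [mulVec_eq_sum S k z t (ht z hz), map_sum]
  rw [mulVec_eq_sum (T * S) k x t hTS, mulVec_eq_sum T _ x s hs, Finset.sum_congr rfl h1,
    Finset.sum_comm]
  refine Finset.sum_congr rfl fun y _ => ?_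
  rw [mul_entry_eq_sum T S x y s hs, map_sum, AddMonoidHom.finsetSum_apply]
  exact Finset.sum_congr rfl fun z _ => hφ _ _ _

theorem smul_mulVec [Module ℂ A] [Module ℂ E] (hφ : ∀ (c : ℂ) a e, φ (c • a) e = c • φ a e) (c : ℂ)
    (T : BandMatrix X A) (k : X → E) : mulVec φ (c • T) k = c • mulVec φ T k := by
  ext x
  have h : ∀ y, (c • T).entry x y ≠ 0 → y ∈ (T.row_finite x).toFinset := fun y hy =>
    T.mem_row x y fun h => hy (by simp [h])
  rw [Pi.smul_apply, mulVec_eq_sum T _ x _ (T.mem_row x), mulVec_eq_sum _ _ x _ h, Finset.smul_sum]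
  simp [hφ]

theorem mulVec_smul [Module ℂ E] (hφ : ∀ (c : ℂ) a e, φ a (c • e) = c • φ a e) (c : ℂ)
    (T : BandMatrix X A) (k : X → E) : mulVec φ T (c • k) = c • mulVec φ T k := by
  ext x
  rw [Pi.smul_apply, mulVec_eq_sum T _ x _ (T.mem_row x), mulVec_eq_sum T _ x _ (T.mem_row x),
    Finset.smul_sum]
  simp [hφ]

end BandMatrix

end MulVec

/-! ### Band matrices. -/

section Banded

variable {X : Type u} [MetricSpace X] [BoundedGeometry X]

/-- `T` has propagation at most `r`, and its entries have norm at most `M`. -/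
structure IsBanded {A : Type*} [NormedAddCommGroup A] (r M : ℝ) (T : BandMatrix X A) : Prop where
  propagation : ∀ x y, r < dist x y → T.entry x y = 0
  norm_le : ∀ x y, ‖T.entry x y‖ ≤ M

theorem IsBanded.mulVec_eq {A E : Type*} [NonUnitalNormedRing A] [AddCommGroup E]
    {φ : A →+ E →+ E} {r M : ℝ} {T : BandMatrix X A} (hT : IsBanded r M T) (k : X → E) (x : X) :
    BandMatrix.mulVec φ T k x = ∑ y ∈ ballFinset x r, φ (T.entry x y) (k y) :=
  BandMatrix.mulVec_eq_sum T k x _ fun y hy => mem_ballFinset.mpr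
    (not_lt.mp fun h => hy (hT.propagation x y h))

theorem ballFinset_comm {x y : X} {r : ℝ} : y ∈ ballFinset x r ↔ x ∈ ballFinset y r := by
  rw [mem_ballFinset, mem_ballFinset, dist_comm]

/-- Double counting: a point `y` lies in the ball around `x` for at most `K` points `x`. -/
theorem sum_le_sum_biUnion_ball [DecidableEq X] {M : Type*} [AddCommGroup M] [PartialOrder M]
    [IsOrderedAddMonoid M]
    {r : ℝ} {K : ℕ} (hK : ∀ x : X, (ballFinset x r).card ≤ K) {f b : X → M} (hb : ∀ y, 0 ≤ b y)
    (h : ∀ x, f x ≤ ∑ y ∈ ballFinset x r, b y) (t : Finset X) :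
    ∑ x ∈ t, f x ≤ K • ∑ y ∈ t.biUnion fun x => ballFinset x r, b y := by
  calc ∑ x ∈ t, f x ≤ ∑ x ∈ t, ∑ y ∈ ballFinset x r, b y := Finset.sum_le_sum fun x _ => h x
    _ = ∑ y ∈ t.biUnion (fun x => ballFinset x r), ∑ x ∈ t with y ∈ ballFinset x r, b y := by
      refine Finset.sum_comm' fun x y => ?_
      simp only [Finset.mem_biUnion, Finset.mem_filter]
      exact ⟨fun ⟨h1, h2⟩ => ⟨⟨h1, h2⟩, x, h1, h2⟩, fun h => h.1⟩
    _ ≤ ∑ y ∈ t.biUnion (fun x => ballFinset x r), K • b y := by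
      refine Finset.sum_le_sum fun y _ => ?_
      rw [Finset.sum_const]
      refine nsmul_le_nsmul_left (hb y) ((Finset.card_le_card fun x hx => ?_).trans (hK y))
      exact ballFinset_comm.mp (Finset.mem_filter.mp hx).2
    _ = _ := (Finset.smul_sum).symm

/-- Columns dominated through a band matrix are summable. -/
theorem summable_of_forall_finset_norm_le [DecidableEq X] {M : Type*} [NormedAddCommGroup M]
    [CompleteSpace M]
    {r C : ℝ} {f b : X → M} (hb : Summable b)
    (h : ∀ t : Finset X, ‖∑ x ∈ t, f x‖ ≤ C * ‖∑ y ∈ t.biUnion fun x => ballFinset x r, b y‖) :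
    Summable f := by
  rw [summable_iff_vanishing_norm] at hb ⊢
  intro ε hε
  obtain ⟨s, hs⟩ := hb (ε / (max C 0 + 1)) (by positivity)
  -- The exceptional set is enlarged by `r`, so that balls around points outside it miss `s`.
  refine ⟨s.biUnion fun x => ballFinset x r, fun t ht => ?_⟩
  have hd : Disjoint (t.biUnion fun x => ballFinset x r) s := by
    rw [Finset.disjoint_left]
    intro y hy hys
    obtain ⟨x, hx, hyx⟩ := Finset.mem_biUnion.mp hy
    exact Finset.disjoint_left.mp ht hx (Finset.mem_biUnion.mpr ⟨y, hys, ballFinset_comm.mp hyx⟩)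
  have h1 := hs _ hd
  rw [lt_div_iff₀ (by positivity)] at h1
  have h2 := h t
  have h3 := norm_nonneg (∑ y ∈ t.biUnion fun x => ballFinset x r, b y)
  nlinarith [le_max_left C 0]

end Banded

/-! ### Inequalities for squares in a `C^*`-algebra. -/

section Squares

variable {A : Type*} [NonUnitalCStarAlgebra A] [PartialOrder A] [StarOrderedRing A]

/-- The difference of the two sides is `star (a - b) * (a - b)`. -/
theorem star_add_mul_add_le (a b : A) :
    star (a + b) * (a + b) ≤ 2 • (star a * a) + 2 • (star b * b) := by
  rw [← sub_nonneg]
  have h := star_mul_self_nonneg (a - b)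
  convert h using 1
  simp only [star_add, star_sub, add_mul, mul_add, sub_mul, mul_sub]
  abel

/-- A crude constant suffices, since the index sets will be balls of bounded cardinality. -/
theorem star_sum_mul_sum_le {ι : Type*} (s : Finset ι) (c : ι → A) :
    star (∑ i ∈ s, c i) * ∑ i ∈ s, c i ≤ (2 ^ s.card : ℕ) • ∑ i ∈ s, star (c i) * c i := by
  classical
  induction s using Finset.induction_on with
  | empty => simp
  | insert i s hi ih =>
    rw [Finset.sum_insert hi, Finset.sum_insert hi, Finset.card_insert_of_notMem hi]
    refine (star_add_mul_add_le _ _).trans ?_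
    rw [nsmul_add]
    have h1 : 2 • (star (c i) * c i) ≤ (2 ^ (s.card + 1) : ℕ) • (star (c i) * c i) :=
      nsmul_le_nsmul_left (star_mul_self_nonneg _) (by rw [pow_succ]; have := Nat.one_le_two_pow (n := s.card); omega)
    have h2 : 2 • (star (∑ i ∈ s, c i) * ∑ i ∈ s, c i) ≤
        (2 ^ (s.card + 1) : ℕ) • ∑ i ∈ s, star (c i) * c i := by
      rw [pow_succ, mul_comm, mul_nsmul']
      exact nsmul_le_nsmul_right ih 2
    exact add_le_add h1 h2

end Squares

/-! ### The Hilbert module and the action of band matrices on it. -/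

section HilbModOps

variable {X : Type u} {A : Type*} [NonUnitalCStarAlgebra A]

namespace HilbMod

theorem coeff_sub (a b : HilbMod X A) (x : X) : (a - b).coeff x = a.coeff x - b.coeff x := rfl

theorem norm_sum_le_norm_inner (a : HilbMod X A) (s : Finset X) :
    ‖∑ x ∈ s, star (a.coeff x) * a.coeff x‖ ≤ ‖a‖ * ‖a‖ := by
  let _ := CStarAlgebra.spectralOrder A
  have := CStarAlgebra.spectralOrderedRing A
  rw [norm_sq]
  exact CStarAlgebra.norm_le_norm_of_nonneg_of_le (Finset.sum_nonneg fun x _ => star_mul_self_nonneg _)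
    (sum_le_hasSum s (fun x _ => star_mul_self_nonneg _) (hasSum_inner a a))

theorem norm_coeff_le (a : HilbMod X A) (x : X) : ‖a.coeff x‖ ≤ ‖a‖ := by
  have h := norm_sum_le_norm_inner a {x}
  rw [Finset.sum_singleton, CStarRing.norm_star_mul_self] at h
  exact le_of_sq_le_sq (by simpa [sq] using h) (norm_nonneg a) |>.trans le_rfl

theorem norm_le_of_forall_sum {a : HilbMod X A} {C : ℝ} (hC : 0 ≤ C)
    (h : ∀ s : Finset X, ‖∑ x ∈ s, star (a.coeff x) * a.coeff x‖ ≤ C * C) : ‖a‖ ≤ C := by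
  refine le_of_sq_le_sq ?_ hC
  rw [sq, sq, norm_sq]
  exact le_of_tendsto (hasSum_inner a a).norm (Eventually.of_forall h)

instance : CompleteSpace (HilbMod X A) := by
  refine Metric.complete_of_cauchySeq_tendsto fun a ha => ?_
  have hx : ∀ x, ∃ b, Tendsto (fun n => (a n).coeff x) atTop (𝓝 b) := fun x =>
    cauchySeq_tendsto_of_complete (by
      rw [Metric.cauchySeq_iff] at ha ⊢
      intro ε hε
      obtain ⟨N, hN⟩ := ha ε hε
      refine ⟨N, fun m hm n hn => ?_⟩
      rw [dist_eq_norm, ← coeff_sub]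
      exact (norm_coeff_le _ x).trans_lt (by simpa [dist_eq_norm] using hN m hm n hn))
  choose b hb using hx
  -- The coefficientwise limit satisfies the Cauchy estimate uniformly over finite sets; this gives
  -- both its membership in `E` and the convergence in norm.
  have key : ∀ ε > 0, ∃ N, ∀ n ≥ N, ∀ s : Finset X,
      √‖∑ x ∈ s, star (b x - (a n).coeff x) * (b x - (a n).coeff x)‖ ≤ ε := by
    intro ε hε
    obtain ⟨N, hN⟩ := Metric.cauchySeq_iff.mp ha ε hε
    refine ⟨N, fun n hn s => ?_⟩
    have ht : Tendsto (fun m => √‖∑ x ∈ s, star ((a m - a n).coeff x) * (a m - a n).coeff x‖) atTop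
        (𝓝 √‖∑ x ∈ s, star (b x - (a n).coeff x) * (b x - (a n).coeff x)‖) := by
      refine (tendsto_finsetSum s fun x _ => ?_).norm.sqrt
      have := (hb x).sub_const ((a n).coeff x)
      exact this.star.mul this
    refine le_of_tendsto ht (eventually_atTop.mpr ⟨N, fun m hm => ?_⟩)
    refine (Real.sqrt_le_sqrt (norm_sum_le_norm_inner _ s)).trans ?_
    rw [Real.sqrt_mul_self (norm_nonneg _), ← dist_eq_norm]
    exact (hN m hm n hn).le
  have hs : Summable fun x => star (b x) * b x := by
    rw [summable_iff_vanishing_norm]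
    intro ε hε
    obtain ⟨N, hN⟩ := key (√ε / 2) (by positivity)
    obtain ⟨s, hs⟩ := summable_iff_vanishing_norm.mp (a N).summable (ε / 4) (by positivity)
    refine ⟨s, fun t ht => ?_⟩
    have h1 := hN N le_rfl t
    have h2 : √‖∑ x ∈ t, star ((a N).coeff x) * (a N).coeff x‖ < √ε / 2 := by
      have := Real.sqrt_lt_sqrt (norm_nonneg _) (hs t ht)
      rwa [show ε / 4 = ε / 2 ^ 2 by ring, Real.sqrt_div' _ (by positivity),
        Real.sqrt_sq (by norm_num)] at this
    have h3 := HilbMod.sqrt_add_le t (fun x => b x - (a N).coeff x) (fun x => (a N).coeff x)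
    simp only [sub_add_cancel] at h3
    exact (Real.sqrt_lt_sqrt_iff (norm_nonneg _)).mp (by linarith)
  obtain ⟨b', rfl⟩ : ∃ b' : HilbMod X A, b'.coeff = b := ⟨⟨b, hs⟩, rfl⟩
  refine ⟨b', Metric.tendsto_atTop.mpr fun ε hε => ?_⟩
  obtain ⟨N, hN⟩ := key (ε / 2) (by positivity)
  refine ⟨N, fun n hn => ?_⟩
  rw [dist_comm, dist_eq_norm]
  refine (norm_le_of_forall_sum (C := ε / 2) (by positivity) fun s => ?_).trans_lt (by linarith)
  have := hN n hn s
  rw [Real.sqrt_le_left (by positivity), sq] at this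
  exact this

open Classical in
/-- The element `c [x]` of `E`. -/
def single (x : X) (c : A) : HilbMod X A :=
  ⟨Pi.single x c, summable_of_hasFiniteSupport ((Set.finite_singleton x).subset fun y hy => by
    by_contra h
    exact hy (by simp [Pi.single_eq_of_ne (show y ≠ x from h)]))⟩

@[simp] theorem coeff_single_same (x : X) (c : A) : (single x c).coeff x = c := by
  classical exact Pi.single_eq_same (M := fun _ : X => A) x c

theorem coeff_single_ne {x y : X} (h : y ≠ x) (c : A) : (single x c).coeff y = 0 := by
  classical exact Pi.single_eq_of_ne (M := fun _ : X => A) h c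

theorem inner_single_left (x : X) (c : A) (b : HilbMod X A) :
    inner (single x c) b = star c * b.coeff x := by
  rw [inner, tsum_eq_single x fun y hy => by rw [coeff_single_ne hy]; simp, coeff_single_same]

theorem norm_single (x : X) (c : A) : ‖single x c‖ = ‖c‖ := by
  rw [norm_def, inner_single_left, coeff_single_same, CStarRing.norm_star_mul_self,
    Real.sqrt_mul_self (norm_nonneg _)]

theorem coeff_sum {ι : Type*} (s : Finset ι) (a : ι → HilbMod X A) (x : X) :
    (∑ i ∈ s, a i).coeff x = ∑ i ∈ s, (a i).coeff x :=
  map_sum (⟨⟨fun a : HilbMod X A => a.coeff x, rfl⟩, fun _ _ => rfl⟩ : HilbMod X A →+ A) _ _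

theorem coeff_sum_single (a : HilbMod X A) (s : Finset X) (x : X) [Decidable (x ∈ s)] :
    (∑ y ∈ s, single y (a.coeff y)).coeff x = if x ∈ s then a.coeff x else 0 := by
  rw [coeff_sum]
  split_ifs with h
  · rw [Finset.sum_eq_single_of_mem x h fun y _ hy => coeff_single_ne hy.symm _, coeff_single_same]
  · exact Finset.sum_eq_zero fun y hy => coeff_single_ne (by rintro rfl; exact h hy) _

theorem hasSum_single (a : HilbMod X A) : HasSum (fun x => single x (a.coeff x)) a := by
  classical
  rw [HasSum, SummationFilter.unconditional_filter, Metric.tendsto_atTop]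
  intro ε hε
  obtain ⟨s, hs⟩ := summable_iff_vanishing_norm.mp a.summable (ε / 2 * (ε / 2)) (by positivity)
  refine ⟨s, fun t ht => ?_⟩
  rw [dist_comm, dist_eq_norm]
  refine (norm_le_of_forall_sum (C := ε / 2) (by positivity) fun r => ?_).trans_lt (by linarith)
  have h := hs (r \ t) (Finset.sdiff_disjoint.mono_right ht)
  refine (le_of_eq ?_).trans h.le
  congr 1
  rw [Finset.sdiff_eq_filter, Finset.sum_filter]
  refine Finset.sum_congr rfl fun x _ => ?_
  rw [coeff_sub, coeff_sum_single]
  by_cases hx : x ∈ t <;> simp [hx]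

/-- The inner product with a fixed element, as a bounded operator. -/
def innerL (a : HilbMod X A) : HilbMod X A →L[ℂ] A :=
  LinearMap.mkContinuous ⟨⟨inner a, inner_add_right a⟩, fun z b => inner_smul_right z a b⟩ ‖a‖
    fun b => norm_inner_le a b

@[simp] theorem innerL_apply (a b : HilbMod X A) : innerL a b = inner a b := rfl

theorem continuous_inner_left (b : HilbMod X A) : Continuous fun a => inner a b := by
  simp_rw [← star_inner b]
  exact (innerL b).continuous.star

end HilbMod

/-- The star is isometric, so the adjoints of a convergent sequence form a Cauchy sequence, and
their limit is an adjoint of the limit. -/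
instance Adjointable.instCompleteSpace : CompleteSpace (Adjointable X A) := by
  have hc : IsClosed (AdjSubalgebra X A : Set (HilbMod X A →L[ℂ] HilbMod X A)) := by
    refine isClosed_of_closure_subset fun S hS => ?_
    obtain ⟨s, hs, hlim⟩ := mem_closure_iff_seq_limit.mp hS
    let s' : ℕ → Adjointable X A := fun n => ⟨s n, hs n⟩
    have hcs : CauchySeq fun n => (star (s' n)).op := by
      have h1 := hlim.cauchySeq
      rw [Metric.cauchySeq_iff] at h1 ⊢
      intro ε hε
      obtain ⟨N, hN⟩ := h1 ε hε
      refine ⟨N, fun m hm n hn => ?_⟩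
      have e : dist (star (s' m)).op (star (s' n)).op = dist (s m) (s n) := by
        change dist (star (s' m)) (star (s' n)) = dist (s' m) (s' n)
        rw [dist_eq_norm, dist_eq_norm, ← star_sub, norm_star]
      rw [e]
      exact hN m hm n hn
    obtain ⟨S', hS'⟩ := cauchySeq_tendsto_of_complete hcs
    refine ⟨S', fun a b => ?_⟩
    have h1 : Tendsto (fun n => HilbMod.inner (s n a) b) atTop (𝓝 (HilbMod.inner (S a) b)) :=
      ((HilbMod.continuous_inner_left b).tendsto _).comp
        (((ContinuousLinearMap.apply ℂ _ a).continuous.tendsto S).comp hlim)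
    have h2 : Tendsto (fun n => HilbMod.inner a ((star (s' n)).op b)) atTop
        (𝓝 (HilbMod.inner a (S' b))) :=
      ((HilbMod.innerL a).continuous.tendsto _).comp
        (((ContinuousLinearMap.apply ℂ _ b).continuous.tendsto S').comp hS')
    refine tendsto_nhds_unique h1 (h2.congr fun n => ?_)
    exact ((s' n).isAdj_star a b).symm
  exact hc.completeSpace_coe

instance : CStarAlgebra (Adjointable X A) where

variable [MetricSpace X] [BoundedGeometry X]

/-- `K` comes from the overlap of balls, `2 ^ K` from squaring sums of at most `K` terms, and `M ^
2` from the entries. -/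
theorem IsBanded.norm_sum_mulVec_le [DecidableEq X] {r M : ℝ} {T : BandMatrix X A}
    (hT : IsBanded r M T) {K : ℕ}
    (hK : ∀ x : X, (ballFinset x r).card ≤ K) (a : X → A) (t : Finset X) :
    ‖∑ x ∈ t, star (BandMatrix.mulVec AddMonoidHom.mul T a x) *
      BandMatrix.mulVec AddMonoidHom.mul T a x‖ ≤
    (K * (2 ^ K * M ^ 2)) * ‖∑ y ∈ t.biUnion fun x => ballFinset x r, star (a y) * a y‖ := by
  let _ := CStarAlgebra.spectralOrder A
  have := CStarAlgebra.spectralOrderedRing A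
  have hp : ∀ b : A, ∀ c : ℝ, 0 ≤ c → 0 ≤ c • (star b * b) := fun b c hc =>
    smul_nonneg hc (star_mul_self_nonneg b)
  have h := sum_le_sum_biUnion_ball (M := A) hK
    (f := fun x => star (BandMatrix.mulVec AddMonoidHom.mul T a x) *
      BandMatrix.mulVec AddMonoidHom.mul T a x)
    (b := fun y => (2 ^ K * M ^ 2 : ℝ) • (star (a y) * a y)) (fun y => hp _ _ (by positivity))
    (fun x => ?_) t
  · refine (CStarAlgebra.norm_le_norm_of_nonneg_of_le
      (Finset.sum_nonneg fun x _ => star_mul_self_nonneg _) h).trans ?_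
    rw [← Finset.smul_sum, ← Nat.cast_smul_eq_nsmul ℝ, smul_smul, norm_smul,
      Real.norm_of_nonneg (by positivity)]
  · rw [hT.mulVec_eq]
    refine (star_sum_mul_sum_le _ _).trans ?_
    rw [Finset.smul_sum]
    refine Finset.sum_le_sum fun y _ => ?_
    have h1 : star (AddMonoidHom.mul (T.entry x y) (a y)) * AddMonoidHom.mul (T.entry x y) (a y) ≤
        (M ^ 2 : ℝ) • (star (a y) * a y) := by
      change star (T.entry x y * a y) * (T.entry x y * a y) ≤ _
      have h2 := CStarAlgebra.star_left_conjugate_le_norm_smul (a := a y)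
        (b := star (T.entry x y) * T.entry x y) (IsSelfAdjoint.star_mul_self _)
      rw [CStarRing.norm_star_mul_self] at h2
      rw [star_mul, mul_assoc, ← mul_assoc (star (T.entry x y)), ← mul_assoc]
      refine h2.trans (smul_le_smul_of_nonneg_right ?_ (star_mul_self_nonneg _))
      have := hT.norm_le x y
      nlinarith [norm_nonneg (T.entry x y)]
    refine (nsmul_le_nsmul_right h1 _).trans ?_
    rw [← Nat.cast_smul_eq_nsmul ℝ, smul_smul]
    refine smul_le_smul_of_nonneg_right ?_ (star_mul_self_nonneg _)
    push_cast
    gcongr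
    · norm_num
    · exact hK x

/-- The operator of multiplication by a bounded band matrix. -/
theorem IsBanded.exists_op {r M : ℝ} {T : BandMatrix X A} (hT : IsBanded r M T) :
    ∃ S : HilbMod X A →L[ℂ] HilbMod X A, ∀ a,
      (S a).coeff = BandMatrix.mulVec AddMonoidHom.mul T a.coeff := by
  classical
  obtain ⟨K, hK⟩ := exists_card_ballFinset_le (X := X) r
  have hmem : ∀ a : HilbMod X A, Summable fun x =>
      star (BandMatrix.mulVec AddMonoidHom.mul T a.coeff x) *
        BandMatrix.mulVec AddMonoidHom.mul T a.coeff x := fun a =>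
    summable_of_forall_finset_norm_le a.summable fun t => hT.norm_sum_mulVec_le hK a.coeff t
  let L : HilbMod X A →ₗ[ℂ] HilbMod X A :=
    { toFun := fun a => ⟨_, hmem a⟩
      map_add' := fun a b => Subtype.ext (BandMatrix.mulVec_add T a.coeff b.coeff)
      map_smul' := fun c a => Subtype.ext (BandMatrix.mulVec_smul
        (fun c a e => mul_smul_comm c a e) c T a.coeff) }
  have hb : ∀ a, ‖L a‖ ≤ √(K * (2 ^ K * M ^ 2)) * ‖a‖ := fun a => by
    refine HilbMod.norm_le_of_forall_sum (by positivity) fun t => ?_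
    refine (hT.norm_sum_mulVec_le hK a.coeff t).trans ?_
    have e : √(K * (2 ^ K * M ^ 2)) * ‖a‖ * (√(K * (2 ^ K * M ^ 2)) * ‖a‖) =
        (K * (2 ^ K * M ^ 2)) * (‖a‖ * ‖a‖) := by
      rw [mul_mul_mul_comm, Real.mul_self_sqrt (by positivity)]
    rw [e]
    gcongr
    exact HilbMod.norm_sum_le_norm_inner a _
  exact ⟨L.mkContinuous _ hb, fun a => rfl⟩

theorem IsBanded.star {r M : ℝ} {T : BandMatrix X A} (hT : IsBanded r M T) :
    IsBanded r M (star T) :=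
  ⟨fun x y h => by rw [BandMatrix.star_entry, hT.propagation y x (by rwa [dist_comm]), star_zero],
    fun x y => by rw [BandMatrix.star_entry, norm_star]; exact hT.norm_le y x⟩

theorem IsBanded.exists_actsAs {r M : ℝ} {T : BandMatrix X A} (hT : IsBanded r M T) :
    ∃ S : Adjointable X A, ActsAs T S ∧ ActsAs (Star.star T) (Star.star S) := by
  obtain ⟨S, hS⟩ := hT.exists_op
  obtain ⟨S', hS'⟩ := hT.star.exists_op
  have hadj : HilbMod.IsAdj S S' := by
    intro a b
    -- Adjointness is checked on the elements `c [x]`, where all sums are finite, and extended by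
    -- continuity.
    have h1 : ∀ x c, HilbMod.inner (S (HilbMod.single x c)) b =
        HilbMod.inner (HilbMod.single x c) (S' b) := by
      intro x c
      have h2 : ∀ y, (S (HilbMod.single x c)).coeff y = T.entry y x * c := fun y => by
        rw [hS]
        refine (finsum_eq_single _ x fun z hz => ?_).trans ?_
        · rw [HilbMod.coeff_single_ne hz, map_zero]
        · rw [HilbMod.coeff_single_same]; rfl
      rw [HilbMod.inner_single_left, hS', hT.star.mulVec_eq, HilbMod.inner, Finset.mul_sum,
        tsum_eq_sum (s := ballFinset x r) fun y hy => ?_]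
      · refine Finset.sum_congr rfl fun y _ => ?_
        rw [h2, star_mul, mul_assoc]
        rfl
      · rw [h2, hT.propagation y x (by rwa [ballFinset_comm, mem_ballFinset, not_le] at hy)]
        simp
    have h3 : HasSum (fun x => HilbMod.inner (S (HilbMod.single x (a.coeff x))) b)
        (HilbMod.inner (S a) b) := by
      have := ((HilbMod.hasSum_single a).mapL S).mapL (HilbMod.innerL b)
      simpa [HilbMod.star_inner] using this.star
    have h4 : HasSum (fun x => HilbMod.inner (HilbMod.single x (a.coeff x)) (S' b))
        (HilbMod.inner a (S' b)) := by
      have := (HilbMod.hasSum_single a).mapL (HilbMod.innerL (S' b))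
      simpa [HilbMod.star_inner] using this.star
    exact h3.unique (by simpa only [h1] using h4)
  refine ⟨⟨S, S', hadj⟩, fun a y => congrFun (hS a) y, ?_⟩
  rw [Adjointable.eq_star (S := ⟨S, S', hadj⟩) (S' := ⟨S', S, hadj.symm⟩) hadj]
  exact fun a y => congrFun (hS' a) y

end HilbModOps

/-! ### Induced representations on `ℓ²(X, K)`. -/

section SquareSummable

variable {X K : Type*} [NormedAddCommGroup K] [InnerProductSpace ℂ K]

theorem lp.hasSum_norm_sq (k : lp (fun _ : X => K) 2) : HasSum (fun x => ‖k x‖ ^ 2) (‖k‖ ^ 2) := by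
  simpa using lp.hasSum_norm (p := 2) (by norm_num) k

theorem memℓp_two_iff {k : X → K} : Memℓp k 2 ↔ Summable fun x => ‖k x‖ ^ 2 := by
  simpa using memℓp_gen_iff (E := fun _ : X => K) (p := 2) (f := k) (by norm_num)

variable [MetricSpace X] [BoundedGeometry X] {A : Type*} [NonUnitalCStarAlgebra A]

variable [CompleteSpace K]

/-- The action of `A` on `K` given by a `*`-representation. -/
def actHom (ψ : A →⋆ₙₐ[ℂ] (K →L[ℂ] K)) : A →+ K →+ K where
  toFun a := (ψ a : K →L[ℂ] K).toLinearMap.toAddMonoidHom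
  map_zero' := by ext; simp
  map_add' _ _ := by ext; simp

@[simp] theorem actHom_apply (ψ : A →⋆ₙₐ[ℂ] (K →L[ℂ] K)) (a : A) (k : K) : actHom ψ a k = ψ a k := rfl

theorem norm_hom_apply_le (ψ : A →⋆ₙₐ[ℂ] (K →L[ℂ] K)) (a : A) (k : K) : ‖ψ a k‖ ≤ ‖a‖ * ‖k‖ :=
  ((ψ a).le_opNorm k).trans (by gcongr; exact NonUnitalStarAlgHom.norm_apply_le ψ a)

theorem IsBanded.sum_norm_mulVec_le [DecidableEq X] {r M : ℝ} {T : BandMatrix X A}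
    (hT : IsBanded r M T) {N : ℕ} (hN : ∀ x : X, (ballFinset x r).card ≤ N)
    (ψ : A →⋆ₙₐ[ℂ] (K →L[ℂ] K)) (k : X → K) (t : Finset X) :
    ∑ x ∈ t, ‖BandMatrix.mulVec (actHom ψ) T k x‖ ^ 2 ≤
      (N * (N * M ^ 2)) * ∑ y ∈ t.biUnion fun x => ballFinset x r, ‖k y‖ ^ 2 := by
  have h := sum_le_sum_biUnion_ball hN (f := fun x => ‖BandMatrix.mulVec (actHom ψ) T k x‖ ^ 2)
    (b := fun y => (N * M ^ 2) * ‖k y‖ ^ 2) (fun y => by positivity) (fun x => ?_) t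
  · refine h.trans (le_of_eq ?_)
    rw [← Finset.mul_sum, nsmul_eq_mul]
    ring
  · rw [hT.mulVec_eq]
    calc ‖∑ y ∈ ballFinset x r, actHom ψ (T.entry x y) (k y)‖ ^ 2
        ≤ (∑ y ∈ ballFinset x r, M * ‖k y‖) ^ 2 := by
          gcongr
          refine (norm_sum_le _ _).trans (Finset.sum_le_sum fun y _ => ?_)
          exact (norm_hom_apply_le ψ _ _).trans (by gcongr; exact hT.norm_le x y)
      _ ≤ (ballFinset x r).card * ∑ y ∈ ballFinset x r, (M * ‖k y‖) ^ 2 :=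
          sq_sum_le_card_mul_sum_sq
      _ ≤ N * ∑ y ∈ ballFinset x r, (M * ‖k y‖) ^ 2 := by
          gcongr
          exact hN x
      _ = _ := by
          rw [Finset.mul_sum]
          exact Finset.sum_congr rfl fun y _ => by ring

theorem IsBanded.exists_l2_op {r M : ℝ} {T : BandMatrix X A} (hT : IsBanded r M T)
    (ψ : A →⋆ₙₐ[ℂ] (K →L[ℂ] K)) :
    ∃ S : lp (fun _ : X => K) 2 →L[ℂ] lp (fun _ : X => K) 2, ∀ k x,
      S k x = BandMatrix.mulVec (actHom ψ) T k x := by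
  classical
  obtain ⟨N, hN⟩ := exists_card_ballFinset_le (X := X) r
  have hmem : ∀ k : lp (fun _ : X => K) 2, Memℓp (BandMatrix.mulVec (actHom ψ) T k) 2 := fun k => by
    refine memℓp_two_iff.mpr (summable_of_forall_finset_norm_le (lp.hasSum_norm_sq k).summable
      (r := r) (C := N * (N * M ^ 2)) fun t => ?_)
    rw [Real.norm_of_nonneg (Finset.sum_nonneg fun x _ => by positivity),
      Real.norm_of_nonneg (Finset.sum_nonneg fun x _ => by positivity)]
    exact hT.sum_norm_mulVec_le hN ψ k t
  let L : lp (fun _ : X => K) 2 →ₗ[ℂ] lp (fun _ : X => K) 2 :=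
    { toFun := fun k => ⟨_, hmem k⟩
      map_add' := fun k l => Subtype.ext (BandMatrix.mulVec_add T k l)
      map_smul' := fun c k => Subtype.ext (BandMatrix.mulVec_smul
        (fun c a e => map_smul (ψ a) c e) c T k) }
  have hb : ∀ k, ‖L k‖ ≤ √(N * (N * M ^ 2)) * ‖k‖ := fun k => by
    refine le_of_sq_le_sq ?_ (by positivity)
    rw [mul_pow, Real.sq_sqrt (by positivity)]
    refine le_of_tendsto (lp.hasSum_norm_sq (L k)) (Eventually.of_forall fun t => ?_)
    refine (hT.sum_norm_mulVec_le hN ψ k t).trans ?_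
    gcongr
    exact sum_le_hasSum _ (fun _ _ => by positivity) (lp.hasSum_norm_sq k)
  exact ⟨L.mkContinuous _ hb, fun k x => rfl⟩

theorem IsBanded.adjoint_eq {r M : ℝ} {T : BandMatrix X A} (hT : IsBanded r M T)
    {ψ : A →⋆ₙₐ[ℂ] (K →L[ℂ] K)} {S S' : lp (fun _ : X => K) 2 →L[ℂ] lp (fun _ : X => K) 2}
    (hS : ∀ k x, S k x = BandMatrix.mulVec (actHom ψ) T k x)
    (hS' : ∀ k x, S' k x = BandMatrix.mulVec (actHom ψ) (Star.star T) k x) : Star.star S = S' := by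
  classical
  ext l x
  refine ext_inner_left ℂ fun k => ?_
  have hl : ∀ m : lp (fun _ : X => K) 2, inner ℂ k (m x) = inner ℂ (lp.single 2 x k) m :=
    fun m => (lp.inner_single_left x k m).symm
  refine (hl _).trans ?_
  rw [ContinuousLinearMap.star_eq_adjoint,
    ContinuousLinearMap.adjoint_inner_right, hS', hT.star.mulVec_eq, inner_sum, lp.inner_eq_tsum]
  have h2 : ∀ y, S (lp.single 2 x k) y = ψ (T.entry y x) k := fun y => by
    rw [hS]
    refine (finsum_eq_single _ x fun z hz => ?_).trans ?_
    · rw [lp.single_apply_ne _ _ _ hz, map_zero]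
    · rw [lp.single_apply_self]; rfl
  rw [tsum_eq_sum (s := ballFinset x r) fun y hy => ?_]
  · refine Finset.sum_congr rfl fun y _ => ?_
    rw [h2, actHom_apply, BandMatrix.star_entry, map_star, ContinuousLinearMap.star_eq_adjoint,
      ContinuousLinearMap.adjoint_inner_right]
  · rw [h2, hT.propagation y x (by rwa [ballFinset_comm, mem_ballFinset, not_le] at hy)]
    simp

end SquareSummable

/-! ### Localization of the Hilbert module at points. -/

section Eval

variable {H : Type w} [NormedAddCommGroup H] [InnerProductSpace ℝ H] {V : Submodule ℝ H}

namespace AlgA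

/-- The evaluation of the elements of `A(V)` at a point and in a representation of the Clifford
algebra. -/
def rep (q : RPlus H) (ρ : CliffordRep (WithLp 2 (ℝ × H))) : AlgA V →⋆ₙₐ[ℂ] (ρ.K →L[ℂ] ρ.K) where
  toFun a := (a.toFun.val q).val ρ
  map_smul' _ _ := rfl
  map_zero' := rfl
  map_add' _ _ := rfl
  map_mul' _ _ := rfl
  map_star' _ := rfl

theorem norm_le {a : AlgA V} {C : ℝ} (hC : 0 ≤ C) (h : ∀ q ρ, ‖rep q ρ a‖ ≤ C) : ‖a‖ ≤ C :=
  BddFun.norm_le hC fun q => CliffordAmbient.norm_le hC fun ρ => h q ρ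

theorem norm_val_le (a : AlgA V) (q : RPlus H) : ‖a.toFun.val q‖ ≤ ‖a‖ := a.toFun.norm_val_le q

/-- `AlgA.rep` as a bounded operator. -/
def repL (q : RPlus H) (ρ : CliffordRep (WithLp 2 (ℝ × H))) : AlgA V →L[ℂ] (ρ.K →L[ℂ] ρ.K) :=
  LinearMap.mkContinuous ⟨⟨rep q ρ, map_add (rep q ρ)⟩, map_smul (rep q ρ)⟩ 1 fun a => by
    rw [one_mul]; exact NonUnitalStarAlgHom.norm_apply_le (rep q ρ) a

@[simp] theorem repL_apply (q : RPlus H) (ρ) (a : AlgA V) : repL q ρ a = rep q ρ a := rfl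

end AlgA

variable {X : Type u}

theorem HilbMod.hasSum_rep (q : RPlus H) (ρ) (a b : HilbMod X (AlgA V)) (k l : ρ.K) :
    HasSum (fun x => Inner.inner ℂ (AlgA.rep q ρ (a.coeff x) k) (AlgA.rep q ρ (b.coeff x) l))
      (Inner.inner ℂ k (AlgA.rep q ρ (HilbMod.inner a b) l)) := by
  have h := ((HilbMod.hasSum_inner a b).mapL (AlgA.repL q ρ)).mapL
    ((innerSL ℂ k).comp (ContinuousLinearMap.apply ℂ ρ.K l))
  refine h.congr_fun fun x => ?_
  simp only [ContinuousLinearMap.comp_apply, ContinuousLinearMap.apply_apply, innerSL_apply_apply,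
    AlgA.repL_apply, map_mul, map_star, ContinuousLinearMap.star_eq_adjoint,
    mul_apply_eq_comp, ContinuousLinearMap.adjoint_inner_right]

theorem HilbMod.hasSum_norm_rep (q : RPlus H) (ρ) (a : HilbMod X (AlgA V)) (k : ρ.K) :
    HasSum (fun x => ‖AlgA.rep q ρ (a.coeff x) k‖ ^ 2)
      (RCLike.re (Inner.inner ℂ k (AlgA.rep q ρ (HilbMod.inner a a) k))) := by
  have h := (HilbMod.hasSum_rep q ρ a a k k).mapL Complex.reCLM
  refine h.congr_fun fun x => ?_
  exact (inner_self_eq_norm_sq (𝕜 := ℂ) _).symm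

/-- The localization at a point and a vector of an element of the Hilbert module. -/
def HilbMod.localize (q : RPlus H) (ρ : CliffordRep (WithLp 2 (ℝ × H))) (k : ρ.K)
    (a : HilbMod X (AlgA V)) : lp (fun _ : X => ρ.K) 2 :=
  ⟨fun x => AlgA.rep q ρ (a.coeff x) k, memℓp_two_iff.mpr (HilbMod.hasSum_norm_rep q ρ a k).summable⟩

theorem HilbMod.norm_localize_le (q : RPlus H) (ρ : CliffordRep (WithLp 2 (ℝ × H))) (k : ρ.K)
    (a : HilbMod X (AlgA V)) : ‖HilbMod.localize q ρ k a‖ ≤ ‖a‖ * ‖k‖ := by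
  refine le_of_sq_le_sq ?_ (by positivity)
  have h0 : ‖HilbMod.localize q ρ k a‖ ^ 2 = _ :=
    (lp.hasSum_norm_sq (HilbMod.localize q ρ k a)).unique (HilbMod.hasSum_norm_rep q ρ a k)
  have h1 := norm_hom_apply_le (AlgA.rep q ρ) (HilbMod.inner a a) k
  rw [← HilbMod.norm_sq] at h1
  generalize AlgA.rep q ρ (HilbMod.inner a a) k = l at h0 h1
  have h2 := RCLike.re_le_norm (K := ℂ) (Inner.inner ℂ k l)
  have h3 := norm_inner_le_norm (𝕜 := ℂ) k l
  rw [h0]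
  calc _ ≤ ‖k‖ * ‖l‖ := h2.trans h3
    _ ≤ ‖k‖ * (‖a‖ * ‖a‖ * ‖k‖) := by gcongr
    _ = _ := by ring

/-- The norm of `A(V)` is detected by points and Clifford representations. With `l'` the image of
`l` under the value of `⟨a, a⟩`, the number `‖l'‖ ^ 2` is the inner product of the localizations of
`a` at `l'` and at `l`; Cauchy–Schwarz then bounds `⟨a, a⟩` by `C ^ 2`. -/
theorem HilbMod.norm_le_of_localize {a : HilbMod X (AlgA V)} {C : ℝ} (hC : 0 ≤ C)
    (h : ∀ q ρ k, ‖HilbMod.localize q ρ k a‖ ≤ C * ‖k‖) : ‖a‖ ≤ C := by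
  refine le_of_sq_le_sq ?_ hC
  rw [sq, HilbMod.norm_sq]
  refine AlgA.norm_le (by positivity) fun q ρ => ContinuousLinearMap.opNorm_le_bound _
    (by positivity) fun l => ?_
  set l' := AlgA.rep q ρ (HilbMod.inner a a) l
  have h1 : ‖l'‖ * ‖l'‖ ≤ ‖l'‖ * (C ^ 2 * ‖l‖) := by
    rw [← inner_self_eq_norm_mul_norm (𝕜 := ℂ)]
    have h2 := (lp.hasSum_inner (𝕜 := ℂ) (HilbMod.localize q ρ l' a)
      (HilbMod.localize q ρ l a)).unique (HilbMod.hasSum_rep q ρ a a l' l)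
    change Inner.inner ℂ _ _ = Inner.inner ℂ l' l' at h2
    rw [← h2]
    refine (RCLike.re_le_norm _).trans ((norm_inner_le_norm _ _).trans ?_)
    calc _ ≤ (C * ‖l'‖) * (C * ‖l‖) := mul_le_mul (h q ρ l') (h q ρ l) (norm_nonneg _) (by positivity)
      _ = _ := by ring
  rcases (norm_nonneg l').eq_or_lt with h0 | h0
  · rw [← h0]; positivity
  · exact le_of_mul_le_mul_left h1 h0

end Eval

/-! ### The regular representation and the induced ones. -/

section Hom

variable {X : Type u} {Y : Type v} {H : Type w} [MetricSpace X] [MetricSpace Y]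
  [NormedAddCommGroup H] [InnerProductSpace ℝ H] [CompleteSpace H] [BoundedGeometry X]
  [BoundedGeometry Y] {p : X → Y} {f : Y → H}

theorem IsTwisted.exists_isBanded {T : BandMatrix X (AlgA (spanAll f))} (h : IsTwisted p f T) :
    ∃ r M, IsBanded r M T := by
  obtain ⟨r, -, hr⟩ := h.propagation
  obtain ⟨M, hM⟩ := h.bounded
  exact ⟨r, M, hr, hM⟩

theorem actsAs_iff {A : Type*} [NonUnitalCStarAlgebra A] {T : BandMatrix X A}
    {S : Adjointable X A} : ActsAs T S ↔
      ∀ a, (S.op a).coeff = BandMatrix.mulVec AddMonoidHom.mul T a.coeff :=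
  ⟨fun h a => funext (h a), fun h a => congrFun (h a)⟩

theorem ActsAs.unique {A : Type*} [NonUnitalCStarAlgebra A] {T : BandMatrix X A}
    {S S' : Adjointable X A} (h : ActsAs T S) (h' : ActsAs T S') : S = S' :=
  Subtype.ext (ContinuousLinearMap.ext fun a => HilbMod.ext fun y => (h a y).trans (h' a y).symm)

variable (hp : UniformlyExpansive p) (hf : IsCoarseEmbedding f)

theorem exists_actsAs (hp : UniformlyExpansive p) (hf : IsCoarseEmbedding f) (T : twistedAlg p f) : ∃ S : Adjointable X (AlgA (spanAll f)),
    ActsAs (T : BandMatrix X (AlgA (spanAll f))) S ∧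
      ActsAs (star T : BandMatrix X (AlgA (spanAll f))) (star S) := by
  obtain ⟨r, M, h⟩ := (isTwisted_of_mem hp hf T.2).exists_isBanded
  exact h.exists_actsAs

/-- The action of the algebraic twisted Roe algebra on the Hilbert module. -/
def redHom : twistedAlg p f →⋆ₙₐ[ℂ] Adjointable X (AlgA (spanAll f)) where
  toFun T := (exists_actsAs hp hf T).choose
  map_smul' c T := by
    refine ActsAs.unique (exists_actsAs hp hf (c • T)).choose_spec.1 (actsAs_iff.mpr fun a => ?_)
    have h1 := actsAs_iff.mp (exists_actsAs hp hf T).choose_spec.1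
    exact (congrArg (fun g => c • g) (h1 a)).trans
      (BandMatrix.smul_mulVec (fun c a e => smul_mul_assoc c a e) c T.1 a.coeff).symm
  map_zero' := by
    refine ActsAs.unique (exists_actsAs hp hf 0).choose_spec.1 fun a y => ?_
    exact (finsum_eq_zero_of_forall_eq_zero fun x => zero_mul _).symm
  map_add' T S := by
    refine ActsAs.unique (exists_actsAs hp hf (T + S)).choose_spec.1 (actsAs_iff.mpr fun a => ?_)
    have h1 := actsAs_iff.mp (exists_actsAs hp hf T).choose_spec.1
    have h2 := actsAs_iff.mp (exists_actsAs hp hf S).choose_spec.1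
    exact (congrArg₂ (fun g g' => g + g') (h1 a) (h2 a)).trans
      (BandMatrix.add_mulVec T.1 S.1 a.coeff).symm
  map_mul' T S := by
    refine ActsAs.unique (exists_actsAs hp hf (T * S)).choose_spec.1 (actsAs_iff.mpr fun a => ?_)
    have h1 := actsAs_iff.mp (exists_actsAs hp hf T).choose_spec.1
    have h2 := actsAs_iff.mp (exists_actsAs hp hf S).choose_spec.1
    exact (h1 _).trans ((congrArg (BandMatrix.mulVec AddMonoidHom.mul T.1) (h2 a)).trans
      (BandMatrix.mul_mulVec (fun a b e => mul_assoc a b e) T.1 S.1 a.coeff).symm)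
  map_star' T := ActsAs.unique (exists_actsAs hp hf (star T)).choose_spec.1
    (exists_actsAs hp hf T).choose_spec.2

theorem actsAs_redHom (T : twistedAlg p f) :
    ActsAs (T : BandMatrix X (AlgA (spanAll f))) (redHom hp hf T) :=
  (exists_actsAs hp hf T).choose_spec.1

theorem coeff_redHom (T : twistedAlg p f) (a : HilbMod X (AlgA (spanAll f))) :
    ((redHom hp hf T).op a).coeff = BandMatrix.mulVec AddMonoidHom.mul T.1 a.coeff :=
  actsAs_iff.mp (actsAs_redHom hp hf T) a

variable {K : Type*} [NormedAddCommGroup K] [InnerProductSpace ℂ K] [CompleteSpace K]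
  (ψ : AlgA (spanAll f) →⋆ₙₐ[ℂ] (K →L[ℂ] K))

theorem exists_l2_op (hp : UniformlyExpansive p) (hf : IsCoarseEmbedding f)
    (ψ : AlgA (spanAll f) →⋆ₙₐ[ℂ] (K →L[ℂ] K)) (T : twistedAlg p f) :
    ∃ S : lp (fun _ : X => K) 2 →L[ℂ] lp (fun _ : X => K) 2, ∀ k x,
      S k x = BandMatrix.mulVec (actHom ψ) T.1 k x := by
  obtain ⟨r, M, h⟩ := (isTwisted_of_mem hp hf T.2).exists_isBanded
  exact h.exists_l2_op ψ

theorem l2_op_unique {T : BandMatrix X (AlgA (spanAll f))}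
    {S S' : lp (fun _ : X => K) 2 →L[ℂ] lp (fun _ : X => K) 2}
    (hS : ∀ k x, S k x = BandMatrix.mulVec (actHom ψ) T k x)
    (hS' : ∀ k x, S' k x = BandMatrix.mulVec (actHom ψ) T k x) : S = S' := by
  ext k x
  rw [hS, hS']

/-- The representation on `ℓ²(X, K)` induced by a representation of the coefficients on `K`. -/
def l2Hom : twistedAlg p f →⋆ₙₐ[ℂ] (lp (fun _ : X => K) 2 →L[ℂ] lp (fun _ : X => K) 2) where
  toFun T := (exists_l2_op hp hf ψ T).choose
  map_smul' c T := by
    refine l2_op_unique ψ (exists_l2_op hp hf ψ (c • T)).choose_spec fun k x => ?_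
    have h1 := (exists_l2_op hp hf ψ T).choose_spec
    exact (congrArg (fun g => c • g) (h1 k x)).trans
      (congrFun (BandMatrix.smul_mulVec (φ := actHom ψ)
        (fun c a e => by simp) c T.1 k).symm x)
  map_zero' := by
    refine l2_op_unique ψ (exists_l2_op hp hf ψ 0).choose_spec fun k x => ?_
    exact (finsum_eq_zero_of_forall_eq_zero fun y => by simp).symm
  map_add' T S := by
    refine l2_op_unique ψ (exists_l2_op hp hf ψ (T + S)).choose_spec fun k x => ?_
    have h1 := (exists_l2_op hp hf ψ T).choose_spec
    have h2 := (exists_l2_op hp hf ψ S).choose_spec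
    exact (congrArg₂ (fun g g' => g + g') (h1 k x) (h2 k x)).trans
      (congrFun (BandMatrix.add_mulVec T.1 S.1 k).symm x)
  map_mul' T S := by
    refine l2_op_unique ψ (exists_l2_op hp hf ψ (T * S)).choose_spec fun k x => ?_
    have h1 := (exists_l2_op hp hf ψ T).choose_spec
    have h2 := (exists_l2_op hp hf ψ S).choose_spec
    refine (h1 _ x).trans ?_
    have h3 : ⇑((exists_l2_op hp hf ψ S).choose k) = BandMatrix.mulVec (actHom ψ) S.1 k :=
      funext (h2 k)
    exact (congrFun (congrArg (BandMatrix.mulVec (actHom ψ) T.1) h3) x).trans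
      (congrFun (BandMatrix.mul_mulVec (φ := actHom ψ) (fun a b e => by simp) T.1 S.1 k).symm x)
  map_star' T := by
    obtain ⟨r, M, h⟩ := (isTwisted_of_mem hp hf T.2).exists_isBanded
    exact (h.adjoint_eq (exists_l2_op hp hf ψ T).choose_spec
      (exists_l2_op hp hf ψ (star T)).choose_spec).symm

theorem l2Hom_apply (T : twistedAlg p f) (k : lp (fun _ : X => K) 2) (x : X) :
    l2Hom hp hf ψ T k x = BandMatrix.mulVec (actHom ψ) T.1 k x :=
  (exists_l2_op hp hf ψ T).choose_spec k x

/-- The norm on the Hilbert module is bounded by the norms in the induced representations. -/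
theorem norm_redHom_le {T : twistedAlg p f} {C : ℝ} (hC : 0 ≤ C)
    (h : ∀ q ρ, ‖l2Hom hp hf (AlgA.rep q ρ) T‖ ≤ C) : ‖redHom hp hf T‖ ≤ C := by
  rw [Adjointable.norm_eq]
  refine ContinuousLinearMap.opNorm_le_bound _ hC fun a =>
    HilbMod.norm_le_of_localize (by positivity) fun q ρ k => ?_
  -- Localization intertwines the action on `E` with the induced representation.
  have e : HilbMod.localize q ρ k ((redHom hp hf T).op a) =
      l2Hom hp hf (AlgA.rep q ρ) T (HilbMod.localize q ρ k a) := by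
    ext x
    rw [l2Hom_apply]
    change AlgA.rep q ρ (((redHom hp hf T).op a).coeff x) k = _
    rw [coeff_redHom, BandMatrix.mulVec_eq_sum _ _ _ _ (BandMatrix.mem_row _ x),
      BandMatrix.mulVec_eq_sum _ _ _ _ (BandMatrix.mem_row _ x), map_sum,
      sum_apply]
    refine Finset.sum_congr rfl fun y _ => ?_
    change AlgA.rep q ρ (T.1.entry x y * a.coeff y) k = _
    rw [map_mul]
    rfl
  rw [e]
  calc _ ≤ C * (‖a‖ * ‖k‖) := ((l2Hom hp hf (AlgA.rep q ρ) T).le_opNorm _).trans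
        (mul_le_mul (h q ρ) (HilbMod.norm_localize_le q ρ k a) (norm_nonneg _) hC)
    _ = _ := by ring

/-- The test vector is `T(x, y)^* [y]`, since there may be no unit in the coefficients; its image
has coefficient `T(x, y) T(x, y)^*` at `x`. -/
theorem norm_entry_le_redHom (T : twistedAlg p f) (x y : X) :
    ‖T.1.entry x y‖ ≤ ‖redHom hp hf T‖ := by
  rcases eq_or_ne (T.1.entry x y) 0 with h0 | h0
  · rw [h0, norm_zero]; exact norm_nonneg _
  have hpos : 0 < ‖T.1.entry x y‖ := norm_pos_iff.mpr h0
  have h1 : ((redHom hp hf T).op (HilbMod.single y (star (T.1.entry x y)))).coeff x =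
      T.1.entry x y * star (T.1.entry x y) := by
    rw [coeff_redHom]
    refine (finsum_eq_single _ y fun z hz => ?_).trans ?_
    · rw [HilbMod.coeff_single_ne hz, map_zero]
    · rw [HilbMod.coeff_single_same]; rfl
  have h2 := HilbMod.norm_coeff_le
    ((redHom hp hf T).op (HilbMod.single y (star (T.1.entry x y)))) x
  rw [h1, CStarRing.norm_self_mul_star] at h2
  have h3 := (redHom hp hf T).op.le_opNorm (HilbMod.single y (star (T.1.entry x y)))
  rw [HilbMod.norm_single, norm_star] at h3
  exact le_of_mul_le_mul_right (h2.trans h3) hpos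

end Hom

/-! ### Colourings with separated colour classes. -/

section Colouring

variable {X : Type*} [MetricSpace X] [BoundedGeometry X]

/-- The points can be coloured with finitely many colours so that different points of the same
colour are far apart. -/
theorem exists_colouring (R : ℝ) : ∃ (n : ℕ) (c : X → Fin n), ∀ x y, c x = c y → dist x y ≤ R →
    x = y := by
  classical
  obtain ⟨N, hN⟩ := exists_card_ballFinset_le (X := X) R
  let rel : X → X → Prop := WellOrderingRel
  have hwf : WellFounded rel := (inferInstance : IsWellOrder X rel).wf
  -- Greedy colouring along a well-ordering: the least colour not used by an earlier point within
  -- `R`.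
  let F : ∀ x : X, (∀ y, rel y x → ℕ) → ℕ := fun x g =>
    sInf {n | ∀ y (h : rel y x), dist x y ≤ R → g y h ≠ n}
  let c : X → ℕ := hwf.fix F
  have hc : ∀ x, c x = sInf {n | ∀ y, rel y x → dist x y ≤ R → c y ≠ n} := fun x =>
    hwf.fix_eq F x
  have hmem : ∀ x, ∃ n ≤ N, ∀ y, rel y x → dist x y ≤ R → c y ≠ n := fun x => by
    obtain ⟨n, hn, hn'⟩ : ∃ n ∈ Finset.range (N + 1), n ∉ (ballFinset x R).image c := by
      refine Finset.exists_mem_notMem_of_card_lt_card ?_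
      rw [Finset.card_range]
      exact Nat.lt_succ_of_le (Finset.card_image_le.trans (hN x))
    refine ⟨n, Nat.lt_succ_iff.mp (Finset.mem_range.mp hn), fun y _ hy e => hn' ?_⟩
    exact Finset.mem_image.mpr ⟨y, mem_ballFinset.mpr hy, e⟩
  have hc1 : ∀ x y, rel y x → dist x y ≤ R → c y ≠ c x := fun x => by
    obtain ⟨n, -, hn⟩ := hmem x
    have := Nat.sInf_mem (s := {n | ∀ y, rel y x → dist x y ≤ R → c y ≠ n}) ⟨n, hn⟩
    rwa [← hc] at this
  have hc2 : ∀ x, c x < N + 1 := fun x => by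
    obtain ⟨n, hnN, hn⟩ := hmem x
    rw [hc]
    exact Nat.lt_succ_of_le ((Nat.sInf_le (show n ∈ {n | ∀ y, rel y x → dist x y ≤ R → c y ≠ n}
      from hn)).trans hnN)
  refine ⟨N + 1, fun x => ⟨c x, hc2 x⟩, fun x y e hxy => ?_⟩
  have e' : c x = c y := congrArg Fin.val e
  rcases @trichotomous X rel _ x y with h | h | h
  · exact absurd e' (hc1 y x h (by rwa [dist_comm]))
  · exact h
  · exact absurd e'.symm (hc1 x y h hxy)

end Colouring

/-! ### Restriction of a matrix to a set of positions. -/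

section Cut

variable {X : Type u} {A : Type*} [NonUnitalRing A]

open Classical in
/-- The matrix with the entries of `T` at the positions in `P`, and zero elsewhere. -/
def BandMatrix.cut (P : X → X → Prop) (T : BandMatrix X A) : BandMatrix X A where
  entry x y := if P x y then T.entry x y else 0
  row_finite x := (T.row_finite x).subset fun y hy h => hy (by simp [h])
  col_finite y := (T.col_finite y).subset fun x hx h => hx (by simp [h])

theorem BandMatrix.cut_of {P : X → X → Prop} {x y : X} (h : P x y) (T : BandMatrix X A) :
    (T.cut P).entry x y = T.entry x y := if_pos h

theorem BandMatrix.cut_of_not {P : X → X → Prop} {x y : X} (h : ¬P x y) (T : BandMatrix X A) :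
    (T.cut P).entry x y = 0 := if_neg h

theorem BandMatrix.cut_entry_or (P : X → X → Prop) (T : BandMatrix X A) (x y : X) :
    (T.cut P).entry x y = T.entry x y ∨ (T.cut P).entry x y = 0 := by
  by_cases h : P x y
  · exact .inl (cut_of h T)
  · exact .inr (cut_of_not h T)

/-- Evaluation of an entry. -/
def BandMatrix.entryHom (x y : X) : BandMatrix X A →+ A where
  toFun T := T.entry x y
  map_zero' := rfl
  map_add' _ _ := rfl

theorem BandMatrix.sum_entry {ι : Type*} (s : Finset ι) (T : ι → BandMatrix X A) (x y : X) :
    (∑ i ∈ s, T i).entry x y = ∑ i ∈ s, (T i).entry x y := map_sum (entryHom x y) T s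

theorem BandMatrix.sum_cut_colour {n : ℕ} (c : X → Fin n) (T : BandMatrix X A) :
    ∑ i, ∑ j, T.cut (fun x y => c x = i ∧ c y = j) = T := by
  ext x y
  simp only [sum_entry]
  rw [Finset.sum_eq_single (c x), Finset.sum_eq_single (c y)]
  · exact cut_of ⟨rfl, rfl⟩ T
  · exact fun j _ hj => cut_of_not (fun h => hj h.2.symm) T
  · simp
  · exact fun i _ hi => Finset.sum_eq_zero fun j _ => cut_of_not (fun h => hi h.1.symm) T
  · simp

end Cut

/-! ### Bounds valid in every representation. -/

section Twisted

variable {X : Type u} {Y : Type v} {H : Type w} [MetricSpace X] [MetricSpace Y]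
  [NormedAddCommGroup H] [InnerProductSpace ℝ H] [CompleteSpace H] [BoundedGeometry X]
  [BoundedGeometry Y] {p : X → Y} {f : Y → H} {T : BandMatrix X (AlgA (spanAll f))}

theorem IsTwisted.of_entries (hT : IsTwisted p f T) {S : BandMatrix X (AlgA (spanAll f))}
    (h : ∀ x y, S.entry x y = T.entry x y ∨ S.entry x y = 0) : IsTwisted p f S where
  smooth := by
    obtain ⟨N, c, hc⟩ := hT.exists_hasLifts
    refine HasLifts.smooth (N := N) (c := c) fun x y => ?_
    rcases h x y with e | e <;> rw [e]
    · exact hc x y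
    · exact HasLift.zero.mono (hc x y).nonneg
  bounded := by
    obtain ⟨M, hM0, hM⟩ := hT.bounded'
    refine ⟨M, fun x y => ?_⟩
    rcases h x y with e | e <;> rw [e]
    · exact hM x y
    · rwa [norm_zero]
  propagation := by
    obtain ⟨r, hr, h'⟩ := hT.propagation
    refine ⟨r, hr, fun x y hxy => ?_⟩
    rcases h x y with e | e
    · rw [e, h' x y hxy]
    · exact e
  support := by
    obtain ⟨r, hr, h'⟩ := hT.support
    refine ⟨r, hr, fun x y => ?_⟩
    rcases h x y with e | e <;> rw [e]
    · exact h' x y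
    · rw [supp_zero]; exact Set.empty_subset _

theorem IsTwisted.cut (hT : IsTwisted p f T) (P : X → X → Prop) : IsTwisted p f (T.cut P) :=
  hT.of_entries (T.cut_entry_or P)

/-- The quasi-inverse of a diagonal matrix with small entries. -/
theorem IsTwisted.exists_quasiInverse (hT : IsTwisted p f T)
    (hd : ∀ x y, x ≠ y → T.entry x y = 0) {M : ℝ} (hM : ∀ x, ‖T.entry x x‖ ≤ M) (hM1 : M < 1) :
    ∃ Q, IsTwisted p f Q ∧ Q = T + T * Q ∧ Q = T + Q * T := by
  obtain ⟨N, c, hc⟩ := hT.exists_hasLifts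
  have hex : ∀ x, ∃ b : AlgA (spanAll f),
      HasLift (spanBall f N (p x)) ((1 - M)⁻¹ * c * (1 - M)⁻¹) b.toFun ∧
      b = T.entry x x + T.entry x x * b ∧ b = T.entry x x + b * T.entry x x ∧
      ‖b‖ ≤ (1 - M)⁻¹ * M := fun x => by
    obtain ⟨b, h1, h2, h3, h4⟩ := (hc x x).quasiInverse (hM x) hM1
    exact ⟨⟨b, h1.mem_algASub (spanBall_le_spanAll f N (p x))⟩, h1, Subtype.ext h2, Subtype.ext h3, h4⟩
  choose b hb1 hb2 hb3 hb4 using hex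
  classical
  let Q : BandMatrix X (AlgA (spanAll f)) :=
    { entry := fun x y => if x = y then b x else 0
      row_finite := fun x => (Set.finite_singleton x).subset fun y hy => by
        by_contra h
        exact hy (if_neg fun e => h e.symm)
      col_finite := fun y => (Set.finite_singleton y).subset fun x hx => by
        by_contra h
        exact hx (if_neg h) }
  have hQ : ∀ x, Q.entry x x = b x := fun x => if_pos rfl
  have hQ' : ∀ x y, x ≠ y → Q.entry x y = 0 := fun x y h => if_neg h
  refine ⟨Q, ⟨?_, ⟨max ((1 - M)⁻¹ * M) 0, fun x y => ?_⟩, ⟨1, one_pos, fun x y hxy => ?_⟩, ?_⟩,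
    ?_, ?_⟩
  · refine HasLifts.smooth (N := N) (c := max ((1 - M)⁻¹ * c * (1 - M)⁻¹) 0) fun x y => ?_
    rcases eq_or_ne x y with rfl | h
    · rw [hQ]
      exact (hb1 x).mono (le_max_left _ _)
    · rw [hQ' _ _ h]
      exact HasLift.zero.mono (le_max_right _ _)
  · rcases eq_or_ne x y with rfl | h
    · rw [hQ]
      exact (hb4 x).trans (le_max_left _ _)
    · rw [hQ' _ _ h, norm_zero]
      exact le_max_right _ _
  · refine hQ' x y ?_
    rintro rfl
    rw [dist_self] at hxy
    linarith
  · obtain ⟨r, hr, h'⟩ := hT.support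
    refine ⟨r, hr, fun x y => ?_⟩
    rcases eq_or_ne x y with rfl | h
    · rw [hQ]
      refine (supp_subset_supp fun q hq => ?_).trans (h' x x)
      rw [hb2 x]
      simp [hq]
    · rw [hQ' _ _ h, supp_zero]
      exact Set.empty_subset _
  · ext x y
    have e : (T * Q).entry x y = T.entry x x * Q.entry x y := by
      rw [BandMatrix.mul_entry]
      exact finsum_eq_single _ x fun z hz => by rw [hd x z hz.symm, zero_mul]
    rw [BandMatrix.add_entry, e]
    rcases eq_or_ne x y with rfl | h
    · rw [hQ]
      exact hb2 x
    · rw [hQ' _ _ h, hd _ _ h, mul_zero, add_zero]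
  · ext x y
    have e : (Q * T).entry x y = Q.entry x x * T.entry x y := by
      rw [BandMatrix.mul_entry]
      exact finsum_eq_single _ x fun z hz => by rw [hQ' x z hz.symm, zero_mul]
    rw [BandMatrix.add_entry, e]
    rcases eq_or_ne x y with rfl | h
    · rw [hQ]
      exact hb3 x
    · rw [hQ' _ _ h, hd _ _ h, mul_zero, add_zero]

variable {𝓑 : Type*} [CStarAlgebra 𝓑] (π : twistedAlg p f →⋆ₙₐ[ℂ] 𝓑)

/-- If the norm `m` of the image were larger than `M`, then the matrix divided by `m` would have a
quasi-inverse among the twisted matrices, and `m` would not lie in the spectrum of the image; but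
the norm of a positive element does. No continuity of `π` is presupposed. -/
theorem norm_map_mul_star_le_of_diagonal (hp : UniformlyExpansive p) (hf : IsCoarseEmbedding f)
    (T : twistedAlg p f) (hd : ∀ x y, x ≠ y → (T * star T).1.entry x y = 0) {M : ℝ} (hM0 : 0 ≤ M)
    (hM : ∀ x, ‖(T * star T).1.entry x x‖ ≤ M) : ‖π (T * star T)‖ ≤ M := by
  let _ := CStarAlgebra.spectralOrder 𝓑
  have := CStarAlgebra.spectralOrderedRing 𝓑
  by_contra! hlt
  set D := T * star T
  set m := ‖π D‖
  have hm : 0 < m := hM0.trans_lt hlt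
  have : Nontrivial 𝓑 := ⟨π D, 0, norm_pos_iff.mp hm⟩
  have hpos : 0 ≤ π D := by
    rw [map_mul, map_star]
    exact mul_star_self_nonneg _
  have hspec := CStarAlgebra.norm_mem_spectrum_of_nonneg hpos
  refine (spectrum.mem_iff.mp hspec) ?_
  have hDt : IsTwisted p f ((m⁻¹ : ℂ) • D).1 :=
    isTwisted_of_mem hp hf ((m⁻¹ : ℂ) • D).2
  obtain ⟨Q, hQ, e1, e2⟩ := hDt.exists_quasiInverse (M := m⁻¹ * M) (fun x y h => by
      change (m⁻¹ : ℂ) • D.1.entry x y = 0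
      rw [hd x y h, smul_zero]) (fun x => by
      change ‖(m⁻¹ : ℂ) • D.1.entry x x‖ ≤ _
      rw [norm_smul, norm_inv, Complex.norm_real, Real.norm_of_nonneg hm.le]
      gcongr
      exact hM x) (by rw [inv_mul_lt_one₀ hm]; exact hlt)
  let Q' : twistedAlg p f := ⟨Q, hQ.mem_twistedAlg⟩
  have e1' : π Q' = (m⁻¹ : ℂ) • π D + (m⁻¹ : ℂ) • π D * π Q' := by
    rw [← map_smul, ← map_mul, ← map_add]
    exact congrArg π (Subtype.ext e1)
  have e2' : π Q' = (m⁻¹ : ℂ) • π D + π Q' * (m⁻¹ : ℂ) • π D := by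
    rw [← map_smul, ← map_mul, ← map_add]
    exact congrArg π (Subtype.ext e2)
  have hu : IsUnit (1 - (m⁻¹ : ℂ) • π D) := by
    refine ⟨⟨1 - (m⁻¹ : ℂ) • π D, 1 + π Q', ?_, ?_⟩, rfl⟩
    · rw [sub_mul, one_mul, mul_add, mul_one, ← e1']
      abel
    · rw [mul_sub, mul_one, add_mul, one_mul, ← e2']
      abel
  have e : algebraMap ℝ 𝓑 m - π D = (m : ℂ) • (1 - (m⁻¹ : ℂ) • π D) := by
    rw [smul_sub, smul_smul, mul_inv_cancel₀ (by exact_mod_cast hm.ne'), one_smul,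
      Algebra.algebraMap_eq_smul_one, Complex.coe_smul]
  rw [e]
  exact hu.smul (Units.mk0 (m : ℂ) (by exact_mod_cast hm.ne'))

/-- A matrix with at most one nonzero entry in each row and each column. -/
theorem norm_map_le_of_sparse (hp : UniformlyExpansive p) (hf : IsCoarseEmbedding f)
    (T : twistedAlg p f) (hrow : ∀ x y y', T.1.entry x y ≠ 0 → T.1.entry x y' ≠ 0 → y = y')
    (hcol : ∀ x x' y, T.1.entry x y ≠ 0 → T.1.entry x' y ≠ 0 → x = x') {M : ℝ} (hM0 : 0 ≤ M)
    (hM : ∀ x y, ‖T.1.entry x y‖ ≤ M) : ‖π T‖ ≤ M := by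
  -- Sparsity makes `T * star T` diagonal, and the `C^*`-identity passes the bound on to `T`.
  have h := norm_map_mul_star_le_of_diagonal π hp hf T (M := M ^ 2) (fun x y hxy => ?_)
    (by positivity) fun x => ?_
  · rw [map_mul, map_star, CStarRing.norm_self_mul_star, ← sq] at h
    exact le_of_sq_le_sq h hM0
  · refine finsum_eq_zero_of_forall_eq_zero fun z => ?_
    change T.1.entry x z * star (T.1.entry y z) = 0
    by_contra hne
    exact hxy (hcol x y z (left_ne_zero_of_mul hne)
      fun h0 => right_ne_zero_of_mul hne (by rw [h0, star_zero]))
  · change ‖∑ᶠ z, T.1.entry x z * star (T.1.entry x z)‖ ≤ _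
    by_cases hx : ∃ y, T.1.entry x y ≠ 0
    · obtain ⟨y, hy⟩ := hx
      rw [finsum_eq_single _ y fun z hz => by
        rw [not_not.mp fun h => hz (hrow x z y h hy), zero_mul], CStarRing.norm_self_mul_star, ← sq]
      gcongr
      exact hM x y
    · push Not at hx
      rw [finsum_eq_zero_of_forall_eq_zero fun z => by rw [hx z, zero_mul], norm_zero]
      positivity

/-- The norm of a band matrix in any representation is controlled by its propagation and its
entries. -/
theorem exists_norm_map_le (hp : UniformlyExpansive p) (hf : IsCoarseEmbedding f) (r : ℝ) :
    ∃ C : ℝ, 0 ≤ C ∧ ∀ {𝓑 : Type*} [CStarAlgebra 𝓑] (π : twistedAlg p f →⋆ₙₐ[ℂ] 𝓑)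
      (T : twistedAlg p f) (M : ℝ), 0 ≤ M → IsBanded r M T.1 → ‖π T‖ ≤ C * M := by
  -- Two positions in one row or column of `T` lie within `2 * r` of each other, so fixing the
  -- colours of row and column leaves at most one of them.
  obtain ⟨n, c, hc⟩ := exists_colouring (X := X) (2 * r)
  refine ⟨n * n, by positivity, fun π T M hM hT => ?_⟩
  have hTt := isTwisted_of_mem hp hf T.2
  let S : Fin n → Fin n → twistedAlg p f := fun i j =>
    ⟨T.1.cut fun x y => c x = i ∧ c y = j, (hTt.cut _).mem_twistedAlg⟩
  have hsum : ∑ i, ∑ j, S i j = T := by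
    refine Subtype.ext ?_
    rw [← BandMatrix.sum_cut_colour c T.1]
    simp [S]
  have hne : ∀ i j x y, (S i j).1.entry x y ≠ 0 → c x = i ∧ c y = j ∧ dist x y ≤ r := by
    intro i j x y h
    have h1 : c x = i ∧ c y = j := by
      by_contra hn
      exact h (BandMatrix.cut_of_not (P := fun x y => c x = i ∧ c y = j) hn T.1)
    refine ⟨h1.1, h1.2, ?_⟩
    by_contra! hn
    refine h ?_
    exact (BandMatrix.cut_of (P := fun x y => c x = i ∧ c y = j) h1 T.1).trans
      (hT.propagation x y hn)
  have hS : ∀ i j, ‖π (S i j)‖ ≤ M := fun i j => by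
    refine norm_map_le_of_sparse π hp hf (S i j) (fun x y y' h h' => ?_) (fun x x' y h h' => ?_) hM
      fun x y => ?_
    · obtain ⟨-, h1, h2⟩ := hne i j x y h
      obtain ⟨-, h1', h2'⟩ := hne i j x y' h'
      exact hc y y' (h1.trans h1'.symm) (by linarith [dist_triangle_left y y' x])
    · obtain ⟨h1, -, h2⟩ := hne i j x y h
      obtain ⟨h1', -, h2'⟩ := hne i j x' y h'
      exact hc x x' (h1.trans h1'.symm) (by linarith [dist_triangle_right x x' y])
    · rcases BandMatrix.cut_entry_or (fun x y => c x = i ∧ c y = j) T.1 x y with e | e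
      · exact (congrArg norm e).trans_le (hT.norm_le x y)
      · exact (congrArg norm e).trans_le (by rwa [norm_zero])
  rw [← hsum, map_sum]
  calc ‖∑ i, π (∑ j, S i j)‖ ≤ ∑ i : Fin n, ∑ j : Fin n, M := by
        refine (norm_sum_le _ _).trans (Finset.sum_le_sum fun i _ => ?_)
        rw [map_sum]
        exact (norm_sum_le _ _).trans (Finset.sum_le_sum fun j _ => hS i j)
    _ = n * n * M := by simp [mul_assoc]

end Twisted

/-! ### Multiplication by locally constant functions. -/

section Lift

variable {H : Type w} [NormedAddCommGroup H] [InnerProductSpace ℝ H] {W : Submodule ℝ H}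

theorem continuous_absPt : Continuous (absPt : ℝ × W → RPlus H) :=
  RPlus.continuous_mk ((continuous_abs.comp continuous_fst).subtype_mk _)
    (continuous_subtype_val.comp continuous_snd)

variable [FiniteDimensional ℝ W] {V : Submodule ℝ H}

/-- A function which is locally constant near the support of `a` takes the same value at the points
of the support of `a` with the same distance from `W` and the same projection to `W`. -/
theorem locallyConstant_eq_absPt {a : AlgA V} {Φ : C0W W} (h : ∀ q, a.toFun.val q = hatAt W Φ q)
    {κ : RPlus H → ℂ} (hκ : ∀ q ∈ supp a, ∀ᶠ q' in 𝓝 q, κ q' = κ q) {q : RPlus H}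
    (hq : a.toFun.val q ≠ 0) : κ (absPt (rad W q, W.orthogonalProjectionOnto q.2)) = κ q := by
  set P : H →L[ℝ] W := W.orthogonalProjectionOnto
  set ρ := rad W q
  let u : H := q.2 - P q.2
  have hρ : ρ ^ 2 = (q.1 : ℝ) ^ 2 + ‖u‖ ^ 2 := Real.sq_sqrt (by positivity)
  have hρ0 : 0 ≤ ρ := Real.sqrt_nonneg _
  -- The path keeps radius and projection fixed and runs from `absPt` at `t = 0` to `q` at `t = 1`.
  -- Whether `a` vanishes depends only on radius and projection, so the path stays in the support,
  -- where `κ` is locally constant.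
  let γ : unitInterval → RPlus H := fun t =>
    (NNReal.sqrt (ρ ^ 2 - (t : ℝ) ^ 2 * ‖u‖ ^ 2).toNNReal, (P q.2 : H) + (t : ℝ) • u)
  have hγ : Continuous γ := RPlus.continuous_mk
    (NNReal.continuous_sqrt.comp (continuous_real_toNNReal.comp (by fun_prop))) (by fun_prop)
  have hPu : P u = 0 := by
    rw [map_sub, sub_eq_zero]
    exact (W.orthogonalProjectionOnto_mem_subspace_eq_self (P q.2)).symm
  have hPγ : ∀ t, P (γ t).2 = P q.2 := fun t => by
    change P ((P q.2 : H) + (t : ℝ) • u) = _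
    rw [map_add, map_smul, hPu, smul_zero, add_zero]
    exact W.orthogonalProjectionOnto_mem_subspace_eq_self (P q.2)
  have hle : ∀ t : unitInterval, 0 ≤ ρ ^ 2 - (t : ℝ) ^ 2 * ‖u‖ ^ 2 := fun t => by
    have h1 := t.2.1
    have h2 := t.2.2
    have : (t : ℝ) ^ 2 ≤ 1 := by nlinarith
    nlinarith [sq_nonneg (q.1 : ℝ), sq_nonneg ‖u‖]
  have hγ1 : ∀ t, ((γ t).1 : ℝ) ^ 2 = ρ ^ 2 - (t : ℝ) ^ 2 * ‖u‖ ^ 2 := fun t => by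
    change ((NNReal.sqrt (ρ ^ 2 - (t : ℝ) ^ 2 * ‖u‖ ^ 2).toNNReal : ℝ≥0) : ℝ) ^ 2 = _
    rw [← NNReal.coe_pow, NNReal.sq_sqrt, Real.coe_toNNReal _ (hle t)]
  have hrad : ∀ t, rad W (γ t) = ρ := fun t => by
    have e : (γ t).2 - P (γ t).2 = (t : ℝ) • u := by
      rw [hPγ]
      exact add_sub_cancel_left _ _
    have : rad W (γ t) = √(((γ t).1 : ℝ) ^ 2 + ‖(γ t).2 - P (γ t).2‖ ^ 2) := rfl
    rw [this, e, hγ1, norm_smul, mul_pow, Real.norm_eq_abs, sq_abs, sub_add_cancel,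
      Real.sqrt_sq hρ0]
  have hne : ∀ t, γ t ∈ supp a := fun t => by
    refine mem_supp_of_ne_zero ?_
    rw [h, ← norm_ne_zero_iff, norm_hatAt, hrad]
    rw [h, ← norm_ne_zero_iff, norm_hatAt] at hq
    have e := hPγ t
    simp only [P] at e
    rw [e]
    exact hq
  have hlc : IsLocallyConstant fun t => κ (γ t) :=
    (IsLocallyConstant.iff_eventually_eq _).mpr fun t =>
      (hγ.tendsto t).eventually (hκ (γ t) (hne t))
  have h0 : γ 0 = absPt (ρ, P q.2) := by
    refine Prod.ext (NNReal.coe_injective ?_) ?_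
    · change _ = |ρ|
      rw [abs_of_nonneg hρ0]
      have e := (hγ1 0).trans (show ρ ^ 2 - (0 : ℝ) ^ 2 * ‖u‖ ^ 2 = ρ ^ 2 by ring)
      exact (sq_eq_sq₀ (NNReal.coe_nonneg _) hρ0).mp e
    · change (P q.2 : H) + ((0 : unitInterval) : ℝ) • u = P q.2
      simp
  have h1 : γ 1 = q := by
    refine Prod.ext (NNReal.coe_injective ?_) ?_
    · have e := (hγ1 1).trans (show ρ ^ 2 - (1 : ℝ) ^ 2 * ‖u‖ ^ 2 = (q.1 : ℝ) ^ 2 by rw [hρ]; ring)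
      exact (sq_eq_sq₀ (NNReal.coe_nonneg _) (NNReal.coe_nonneg _)).mp e
    · change (P q.2 : H) + ((1 : unitInterval) : ℝ) • u = q.2
      simp [u]
  rw [← h0, ← h1]
  exact hlc.apply_eq_of_isPreconnected isPreconnected_univ trivial trivial

/-- The product of an element of `A(W)` with a function which is locally constant near its
support. -/
theorem HasLift.locallyConstant_smul {c C : ℝ} {a : AlgA V} (h : HasLift W c a.toFun)
    {κ : RPlus H → ℂ} (hκ : ∀ q ∈ supp a, ∀ᶠ q' in 𝓝 q, κ q' = κ q) (hC : ∀ q, ‖κ q‖ ≤ C) :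
    ∃ b : BddFun H, HasLift W (C * c) b ∧ ∀ q, b.val q = κ q • a.toFun.val q := by
  obtain ⟨Φ, h1, h2, h3⟩ := h
  have hC0 : 0 ≤ C := (norm_nonneg _).trans (hC (absPt (0 : ℝ × W)))
  -- Off the support, a witnessing `g` is nonzero near the point and forces `Φ` to vanish there.
  -- Either way the product of `κ` and `Φ` is locally a constant multiple of `Φ`.
  have hloc : ∀ z : ℝ × W, (∀ᶠ z' in 𝓝 z, κ (absPt z') = κ (absPt z)) ∨ ∀ᶠ z' in 𝓝 z, Φ z' = 0 := by
    intro z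
    by_cases hz : absPt z ∈ supp a
    · exact .inl ((continuous_absPt.tendsto z).eventually (hκ _ hz))
    · obtain ⟨g, hg, hga⟩ : ∃ g : ZeroAtInftyContinuousMap (RPlus H) ℂ,
          g (absPt z) ≠ 0 ∧ ∀ q', g q' • a.toFun.val q' = 0 := not_not.mp hz
      refine .inr ((((g.continuous.comp continuous_absPt).tendsto z).eventually_ne hg).mono
        fun z' hz' => ?_)
      have := (smul_eq_zero.mp (hga (absPt z'))).resolve_left hz'
      rwa [h3, ← norm_eq_zero, h1.norm_hatAt_absPt, norm_eq_zero] at this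
  -- multiplication of a function supported where `Φ` is
  let mk : ∀ Ψ : C0W W, (∀ z, (∀ᶠ z' in 𝓝 z, Φ z' = 0) → ∀ᶠ z' in 𝓝 z, Ψ z' = 0) → C0W W :=
    fun Ψ hΨ =>
    { toFun := fun z => κ (absPt z) • Ψ z
      continuous_toFun := continuous_iff_continuousAt.mpr fun z => by
        rcases hloc z with hz | hz
        · exact (Ψ.continuous.continuousAt.const_smul (κ (absPt z))).congr
            (hz.mono fun z' e => by simp only [e]; rfl)
        · exact (continuousAt_const (y := (0 : Coef H))).congr ((hΨ z hz).mono fun z' e => by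
            simp only [e, smul_zero])
      zero_at_infty' := by
        have := Ψ.zero_at_infty'.norm.const_mul C
        rw [norm_zero, mul_zero] at this
        exact squeeze_zero_norm (fun z => (norm_smul_le _ _).trans
          (mul_le_mul_of_nonneg_right (hC _) (norm_nonneg _))) this }
  have hmk : ∀ Ψ hΨ z, mk Ψ hΨ z = κ (absPt z) • Ψ z := fun _ _ _ => rfl
  let Φκ := mk Φ fun _ => id
  have hΦκ : ∀ z, Φκ z = κ (absPt z) • Φ z := fun _ => rfl
  have hval : ∀ q, hatAt W Φκ q = κ q • a.toFun.val q := fun q => by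
    have e : hatAt W Φκ q =
        κ (absPt (rad W q, W.orthogonalProjectionOnto q.2)) • a.toFun.val q := by
      rw [h3, hatAt, hatAt, hΦκ, map_smul]
    rw [e]
    by_cases hq : a.toFun.val q = 0
    · rw [hq, smul_zero, smul_zero]
    · rw [locallyConstant_eq_absPt h3 hκ hq]
  refine ⟨⟨hatAt W Φκ, memℓp_infty ⟨C * ‖a‖, ?_⟩⟩, ⟨Φκ, ⟨fun z => ?_, fun s w => ?_⟩,
    fun s v hv => ?_, fun q => rfl⟩, hval⟩
  · rintro _ ⟨q, rfl⟩
    change ‖hatAt W Φκ q‖ ≤ _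
    rw [hval]
    exact (norm_smul_le _ _).trans (mul_le_mul (hC q) (AlgA.norm_val_le a q) (norm_nonneg _) hC0)
  · exact (cliffHat W).smul_mem (h1.mem z) _
  · have e : absPt ((-s, w) : ℝ × W) = absPt (s, w) :=
      Prod.ext (NNReal.coe_injective (abs_neg s)) rfl
    rw [hΦκ, hΦκ, e, h1.symm, map_smul]
  · obtain ⟨Ψ, hΨ, hΨc⟩ := h2 s v hv
    have hΨ0 : ∀ z, (∀ᶠ z' in 𝓝 z, Φ z' = 0) → ∀ᶠ z' in 𝓝 z, Ψ z' = 0 := fun z hz =>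
      hz.eventually_nhds.mono fun z' hz' =>
        ((hΨ z').congr_of_eventuallyEq (f₁ := fun _ => 0) (by
          exact hz'.mono fun _ e => e.symm)).unique
          (show HasLineDerivAt ℝ (fun _ => (0 : Coef H)) 0 z' (s, v) from hasDerivAt_const _ _)
    refine ⟨mk Ψ hΨ0, fun z => ?_, fun z => ?_⟩
    · rw [hmk Ψ hΨ0]
      rcases hloc z with hz | hz
      · have hd : HasLineDerivAt ℝ (fun z' => κ (absPt z) • Φ z') (κ (absPt z) • Ψ z) z (s, v) :=
          HasDerivAt.const_smul (κ (absPt z)) (hΨ z)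
        refine hd.congr_of_eventuallyEq ?_
        exact hz.mono fun z' e => by rw [hΦκ, e]
      · rw [(hΨ0 z hz).self_of_nhds, smul_zero]
        have hd : HasLineDerivAt ℝ (fun _ => (0 : Coef H)) 0 z (s, v) := hasDerivAt_const _ _
        refine hd.congr_of_eventuallyEq ?_
        exact hz.mono fun z' e => by rw [hΦκ, e, smul_zero]
    · rw [hmk Ψ hΨ0]
      exact (norm_smul_le _ _).trans (mul_le_mul (hC _) (hΨc z) (norm_nonneg _) hC0)

end Lift

/-! ### Schur products of twisted matrices. -/

section Schur

variable {X : Type u} {Y : Type v} {H : Type w} [MetricSpace X] [MetricSpace Y]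
  [NormedAddCommGroup H] [InnerProductSpace ℝ H] [CompleteSpace H] [BoundedGeometry X]
  [BoundedGeometry Y] {p : X → Y} {f : Y → H} {T : BandMatrix X (AlgA (spanAll f))}

/-- The Schur product of a twisted matrix with a bounded matrix of functions which are locally
constant near the supports of its entries. -/
theorem IsTwisted.exists_schur (hT : IsTwisted p f T) {κ : X → X → RPlus H → ℂ} {C : ℝ}
    (hC : ∀ x y q, ‖κ x y q‖ ≤ C)
    (hκ : ∀ x y, ∀ q ∈ supp (T.entry x y), ∀ᶠ q' in 𝓝 q, κ x y q' = κ x y q) :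
    ∃ S, IsTwisted p f S ∧
      ∀ x y q, (S.entry x y).toFun.val q = κ x y q • (T.entry x y).toFun.val q := by
  obtain ⟨N, c, hc⟩ := hT.exists_hasLifts
  have hex : ∀ x y, ∃ b : AlgA (spanAll f), HasLift (spanBall f N (p x)) (C * c) b.toFun ∧
      ∀ q, b.toFun.val q = κ x y q • (T.entry x y).toFun.val q := fun x y => by
    obtain ⟨b, h1, h2⟩ := (hc x y).locallyConstant_smul (hκ x y) (hC x y)
    exact ⟨⟨b, h1.mem_algASub (spanBall_le_spanAll f N (p x))⟩, h1, h2⟩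
  choose b hb1 hb2 using hex
  have h0 : ∀ x y, T.entry x y = 0 → b x y = 0 := fun x y h => AlgA.ext fun q => by
    rw [hb2, h]
    exact smul_zero _
  refine ⟨⟨b, fun x => (T.row_finite x).subset fun y hy => mt (h0 x y) hy,
    fun y => (T.col_finite y).subset fun x hx => mt (h0 x y) hx⟩, ⟨?_, ?_, ?_, ?_⟩, hb2⟩
  · exact HasLifts.smooth (N := N) (c := C * c) hb1
  · obtain ⟨M, hM⟩ := hT.bounded
    refine ⟨C * M, fun x y => BddFun.norm_le ?_ fun q => ?_⟩
    · exact mul_nonneg ((norm_nonneg _).trans (hC x y (0, 0))) ((norm_nonneg _).trans (hM x y))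
    · change ‖(b x y).toFun.val q‖ ≤ _
      rw [hb2]
      exact (norm_smul_le _ _).trans (mul_le_mul (hC x y q) ((AlgA.norm_val_le _ q).trans (hM x y))
        (norm_nonneg _) ((norm_nonneg _).trans (hC x y q)))
  · obtain ⟨r, hr, h⟩ := hT.propagation
    exact ⟨r, hr, fun x y hxy => h0 x y (h x y hxy)⟩
  · obtain ⟨r, hr, h⟩ := hT.support
    refine ⟨r, hr, fun x y => (supp_subset_supp fun q hq => ?_).trans (h x y)⟩
    rw [hb2, hq, smul_zero]

end Schur

/-! ### Kernels from property A. -/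

section PropertyA

variable {X : Type*} [MetricSpace X] [BoundedGeometry X] {ι : Type*} {P : ι → Set X}

/-- The functions of equi-property A, extended by zero to the whole space. -/
theorem EquiPropertyA.exists_kernel (h : EquiPropertyA P) {r ε : ℝ} (hr : 0 < r) (hε : 0 < ε) :
    ∃ S : ℝ, 0 < S ∧ ∃ ζ : ι → X → X → ℝ, (∀ i x z, 0 ≤ ζ i x z ∧ ζ i x z ≤ 1) ∧
      (∀ i x z, ζ i x z ≠ 0 → dist x z ≤ S) ∧
      (∀ i, ∀ x ∈ P i, ∑ z ∈ ballFinset x S, ζ i x z * ζ i x z = 1) ∧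
      ∀ i, ∀ x ∈ P i, ∀ x' ∈ P i, dist x x' ≤ r →
        |1 - ∑ z ∈ ballFinset x S, ζ i x z * ζ i x' z| ≤ ε := by
  classical
  -- For unit vectors `1 - ⟨ξ x, ξ x'⟩ = ‖ξ x - ξ x'‖ ^ 2 / 2`, which is at most `δ ^ 2 / 2`; the
  -- bounds `δ < 1` and `δ < ε` make this smaller than `ε`.
  obtain ⟨S, hS, ξ, h1, h2, ⟨δ, hδ, h3⟩, h4⟩ := h r hr (min ε 1) (by positivity)
  let ζ : ι → X → X → ℝ := fun i x z =>
    if hx : x ∈ P i ∧ z ∈ P i then ξ i ⟨x, hx.1⟩ ⟨z, hx.2⟩ else 0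
  have hζ : ∀ i x z (hx : x ∈ P i) (hz : z ∈ P i), ζ i x z = ξ i ⟨x, hx⟩ ⟨z, hz⟩ :=
    fun i x z hx hz => dif_pos ⟨hx, hz⟩
  have hζ0 : ∀ i x z, z ∉ P i → ζ i x z = 0 := fun i x z hz => dif_neg fun h => hz h.2
  have hsupp : ∀ i x z, ζ i x z ≠ 0 → dist x z ≤ S := fun i x z hne => by
    by_cases hx : x ∈ P i ∧ z ∈ P i
    · rw [hζ i x z hx.1 hx.2] at hne
      have := h4 i _ _ hne
      rw [Metric.mem_ball, dist_comm] at this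
      exact this.le
    · exact absurd (dif_neg hx) hne
  have hsum : ∀ i x x' (hx : x ∈ P i) (hx' : x' ∈ P i),
      ∑ z ∈ ballFinset x S, ζ i x z * ζ i x' z = inner ℝ (ξ i ⟨x, hx⟩) (ξ i ⟨x', hx'⟩) := by
    intro i x x' hx hx'
    have hz0 : ∀ z ∉ ballFinset x S, ζ i x z * ζ i x' z = 0 := fun z hz => by
      have : ζ i x z = 0 := by
        by_contra hne
        exact hz (mem_ballFinset.mpr (hsupp i x z hne))
      rw [this, zero_mul]
    rw [← tsum_eq_sum (L := .unconditional X) hz0, lp.inner_eq_tsum]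
    · have e : (fun z => ζ i x z * ζ i x' z) = (P i).indicator fun z => ζ i x z * ζ i x' z := by
        ext z
        by_cases hz : z ∈ P i
        · rw [Set.indicator_of_mem hz]
        · rw [Set.indicator_of_notMem hz, hζ0 i x z hz, zero_mul]
      rw [e, ← tsum_subtype]
      refine tsum_congr fun z => ?_
      rw [hζ i x z hx z.2, hζ i x' z hx' z.2]
      simp [mul_comm]
  refine ⟨S, hS, ζ, fun i x z => ?_, hsupp, fun i x hx => ?_, fun i x hx x' hx' hxx' => ?_⟩
  · by_cases hx : x ∈ P i ∧ z ∈ P i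
    · rw [hζ i x z hx.1 hx.2]
      exact h1 i _ _
    · rw [show ζ i x z = 0 from dif_neg hx]
      exact ⟨le_rfl, zero_le_one⟩
  · rw [hsum i x x hx hx, real_inner_self_eq_norm_sq, h2, one_pow]
  · rw [hsum i x x' hx hx']
    have e := norm_sub_sq_real (ξ i ⟨x, hx⟩) (ξ i ⟨x', hx'⟩)
    rw [h2, h2] at e
    have h5 := h3 i ⟨x, hx⟩ ⟨x', hx'⟩ hxx'
    have h6 := norm_nonneg (ξ i ⟨x, hx⟩ - ξ i ⟨x', hx'⟩)
    have h7 : δ < ε := hδ.trans_le (min_le_left _ _)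
    have h8 : δ < 1 := hδ.trans_le (min_le_right _ _)
    rw [abs_le]
    constructor <;> nlinarith

end PropertyA

/-! ### A norm estimate from partitions of unity. -/

section Hilbert

variable {K : Type*} [NormedAddCommGroup K] [InnerProductSpace ℂ K] [CompleteSpace K]

theorem inner_star_mul (A B : K →L[ℂ] K) (k l : K) :
    inner ℂ k ((star A * B) l) = inner ℂ (A k) (B l) := by
  rw [mul_apply_eq_comp, ContinuousLinearMap.star_eq_adjoint,
    ContinuousLinearMap.adjoint_inner_right]

theorem sum_norm_sq_eq_of_sum_star_mul {ι : Type*} (s : Finset ι) {A : ι → K →L[ℂ] K}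
    {B : K →L[ℂ] K} (h : ∑ i ∈ s, star (A i) * A i = star B * B) (k : K) :
    ∑ i ∈ s, ‖A i k‖ ^ 2 = ‖B k‖ ^ 2 := by
  have e : (inner ℂ k ((∑ i ∈ s, star (A i) * A i) k) : ℂ) = inner ℂ k ((star B * B) k) := by rw [h]
  rw [sum_apply, inner_sum] at e
  simp only [inner_star_mul, inner_self_eq_norm_sq_to_K] at e
  exact_mod_cast e

/-- An operator which is decomposed along a partition of unity is bounded by the norms of its
pieces. -/
theorem norm_le_of_partition {ι : Type*} (s : Finset ι) {U : K →L[ℂ] K} {a b D : ι → K →L[ℂ] K}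
    {C : ℝ} (hC : 0 ≤ C) (ha : ∑ i ∈ s, star (a i) * a i = U * star U)
    (hb : ∑ i ∈ s, star (b i) * b i = (U * star U) * (U * star U))
    (hD : ∑ i ∈ s, star (b i) * (D i * a i) = (U * star U) * (U * star U))
    (h : ∀ i ∈ s, ‖D i‖ ≤ C) : ‖U‖ ≤ C := by
  have hsa : star (U * star U) = U * star U := by simp
  -- Cauchy–Schwarz over `i`: the vectors `b i k` and `a i k` have total squared norms `‖U U* k‖ ^
  -- 2` and `‖U* k‖ ^ 2`, and one factor `‖U U* k‖` cancels.
  have key : ∀ k, ‖(U * star U) k‖ ≤ C * ‖star U k‖ := by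
    intro k
    have h1 : ∑ i ∈ s, ‖a i k‖ ^ 2 = ‖star U k‖ ^ 2 :=
      sum_norm_sq_eq_of_sum_star_mul s (by rw [ha, star_star]) k
    have h2 : ∑ i ∈ s, ‖b i k‖ ^ 2 = ‖(U * star U) k‖ ^ 2 :=
      sum_norm_sq_eq_of_sum_star_mul s (by rw [hb, hsa]) k
    have h3 : ‖(U * star U) k‖ ^ 2 ≤ ∑ i ∈ s, ‖b i k‖ * (C * ‖a i k‖) := by
      have e : (inner ℂ k ((∑ i ∈ s, star (b i) * (D i * a i)) k) : ℂ) =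
          inner ℂ ((U * star U) k) ((U * star U) k) := by
        rw [hD, ← inner_star_mul, hsa]
      rw [sum_apply, inner_sum, inner_self_eq_norm_sq_to_K] at e
      have e2 := congrArg norm e
      simp only [norm_pow, RCLike.norm_ofReal, abs_norm] at e2
      rw [← e2]
      refine (norm_sum_le _ _).trans (Finset.sum_le_sum fun i hi => ?_)
      rw [inner_star_mul]
      refine (norm_inner_le_norm _ _).trans ?_
      gcongr
      rw [mul_apply_eq_comp]
      exact ((D i).le_opNorm _).trans (by gcongr; exact h i hi)
    have h4 : ∑ i ∈ s, ‖b i k‖ * (C * ‖a i k‖) ≤ ‖(U * star U) k‖ * (C * ‖star U k‖) := by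
      have h5 := Real.sum_mul_le_sqrt_mul_sqrt s (fun i => ‖b i k‖) (fun i => C * ‖a i k‖)
      simp only [mul_pow] at h5
      rw [← Finset.mul_sum, h1, h2, ← mul_pow, Real.sqrt_sq (norm_nonneg _),
        Real.sqrt_sq (by positivity)] at h5
      exact h5
    rcases (norm_nonneg ((U * star U) k)).eq_or_lt with h0 | h0
    · rw [← h0]; positivity
    · refine le_of_mul_le_mul_left ?_ h0
      rw [← sq]
      exact h3.trans h4
  have h1 : ‖U * star U‖ ≤ C * ‖U‖ := ContinuousLinearMap.opNorm_le_bound _ (by positivity) fun k =>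
    (key k).trans (by
      rw [mul_assoc]
      gcongr
      exact ((star U).le_opNorm k).trans_eq (by rw [norm_star]))
  rw [CStarRing.norm_self_mul_star] at h1
  rcases (norm_nonneg U).eq_or_lt with h0 | h0
  · rwa [← h0]
  · exact le_of_mul_le_mul_right h1 h0

end Hilbert

/-! ### Entrywise homomorphisms and diagonal matrices. -/

section Matrices

variable {X : Type u} {A B : Type*}

namespace BandMatrix

variable [NonUnitalRing A] [StarRing A] [Module ℂ A] [NonUnitalRing B] [StarRing B] [Module ℂ B]

/-- The application of a homomorphism to all entries. -/
def mapHom (φ : A →⋆ₙₐ[ℂ] B) : BandMatrix X A →⋆ₙₐ[ℂ] BandMatrix X B where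
  toFun T := ⟨fun x y => φ (T.entry x y),
    fun x => (T.row_finite x).subset fun y hy h => hy (by simp [h]),
    fun y => (T.col_finite y).subset fun x hx h => hx (by simp [h])⟩
  map_smul' c T := by ext x y; exact map_smul φ c _
  map_zero' := by ext x y; exact map_zero φ
  map_add' S T := by ext x y; exact map_add φ _ _
  map_star' T := by ext x y; exact map_star φ _
  map_mul' S T := by
    ext x y
    change φ ((S * T).entry x y) = _
    rw [mul_entry_eq_sum S T x y _ (S.mem_row x), mul_entry_eq_sum _ _ x y (S.row_finite x).toFinset
      fun z hz => S.mem_row x z fun h => hz (by change φ (S.entry x z) = 0; rw [h, map_zero]), map_sum]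
    exact Finset.sum_congr rfl fun z _ => map_mul φ _ _

open Classical in
/-- Diagonal matrices. -/
def diag (d : X → A) : BandMatrix X A where
  entry x y := if x = y then d x else 0
  row_finite x := (Set.finite_singleton x).subset fun y hy => by
    by_contra h
    exact hy (if_neg fun e => h e.symm)
  col_finite y := (Set.finite_singleton y).subset fun x hx => by
    by_contra h
    exact hx (if_neg h)

theorem diag_same (d : X → A) (x : X) : (diag d).entry x x = d x := if_pos rfl

theorem diag_ne (d : X → A) {x y : X} (h : x ≠ y) : (diag d).entry x y = 0 := if_neg h

theorem diag_mul_entry (d : X → A) (T : BandMatrix X A) (x y : X) :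
    (diag d * T).entry x y = d x * T.entry x y := by
  rw [mul_entry, finsum_eq_single _ x fun z hz => by rw [diag_ne d hz.symm, zero_mul], diag_same]

theorem mul_diag_entry (d : X → A) (T : BandMatrix X A) (x y : X) :
    (T * diag d).entry x y = T.entry x y * d y := by
  rw [mul_entry, finsum_eq_single _ y fun z hz => by rw [diag_ne d hz, mul_zero], diag_same]

theorem star_diag (d : X → A) : star (diag d) = diag fun x => star (d x) := by
  ext x y
  rw [star_entry]
  rcases eq_or_ne x y with rfl | h
  · rw [diag_same, diag_same]
  · rw [diag_ne _ h, diag_ne _ h.symm, star_zero]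

end BandMatrix

end Matrices

section Eval

variable {H : Type w} [NormedAddCommGroup H] [InnerProductSpace ℝ H] {V : Submodule ℝ H}

/-- The evaluation of the elements of `A(V)` at a point. -/
def AlgA.evalHom (q : RPlus H) : AlgA V →⋆ₙₐ[ℂ] Coef H where
  toFun a := a.toFun.val q
  map_smul' _ _ := rfl
  map_zero' := rfl
  map_add' _ _ := rfl
  map_mul' _ _ := rfl
  map_star' _ := rfl

@[simp] theorem AlgA.evalHom_apply (q : RPlus H) (a : AlgA V) : AlgA.evalHom q a = a.toFun.val q := rfl

/-- Identities of matrices are checked point by point, because at a point the coefficients are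
unital and scalar multipliers become diagonal matrices. -/
theorem BandMatrix.ext_eval {X : Type u} {S T : BandMatrix X (AlgA V)}
    (h : ∀ q, mapHom (AlgA.evalHom q) S = mapHom (AlgA.evalHom q) T) : S = T := by
  ext x y
  exact AlgA.ext fun q => congrArg (fun R => BandMatrix.entry R x y) (h q)

end Eval

/-! ### Block diagonal matrices. -/

section Twisted

variable {X : Type u} {Y : Type v} {H : Type w} [MetricSpace X] [MetricSpace Y]
  [NormedAddCommGroup H] [InnerProductSpace ℝ H] [CompleteSpace H] [BoundedGeometry X]
  [BoundedGeometry Y] {p : X → Y} {f : Y → H}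

/-- The twisted matrices with supports in `O` form a `*`-subalgebra. -/
def twistedOnAlg (p : X → Y) (f : Y → H) (O : Set (RPlus H)) :
    NonUnitalStarSubalgebra ℂ (twistedAlg p f) where
  carrier := twistedOn p f O
  zero_mem' x y := supp_zero.trans_subset (Set.empty_subset _)
  add_mem' {S T} hS hT x y := (supp_subset_union (a := S.1.entry x y) (b := T.1.entry x y)
    (c := S.1.entry x y + T.1.entry x y) fun q h1 h2 => by
      rw [AlgA.toFun_add, BddFun.val_add, h1, h2, add_zero]).trans (Set.union_subset (hS x y) (hT x y))
  mul_mem' {S T} hS hT x y := by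
    change supp ((S.1 * T.1).entry x y) ⊆ O
    rw [BandMatrix.mul_entry_eq_sum _ _ _ _ _ (S.1.mem_row x)]
    exact supp_sum_subset _ _ fun z _ => (supp_mul_subset_left _ _).trans (hS x z)
  smul_mem' c T hT x y := (supp_subset_supp (a := T.1.entry x y) (c := c • T.1.entry x y) fun q h => by
    rw [AlgA.toFun_smul, BddFun.val_smul, h, smul_zero]).trans (hT x y)
  star_mem' {T} hT x y := (supp_star_subset (T.1.entry y x)).trans (hT y x)

variable (hp : UniformlyExpansive p) (hf : IsCoarseEmbedding f)

/-- The cut is the compression by a coordinate projection of `E`, which is contractive. -/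
theorem norm_redHom_cut_le (T : twistedAlg p f) (χ : X → Prop) {D : twistedAlg p f}
    (hD : D.1 = T.1.cut fun x y => χ x ∧ χ y) : ‖redHom hp hf D‖ ≤ ‖redHom hp hf T‖ := by
  classical
  let _ := CStarAlgebra.spectralOrder (AlgA (spanAll f))
  have := CStarAlgebra.spectralOrderedRing (AlgA (spanAll f))
  rw [Adjointable.norm_eq, Adjointable.norm_eq]
  refine ContinuousLinearMap.opNorm_le_bound _ (norm_nonneg _) fun a => ?_
  let b : HilbMod X (AlgA (spanAll f)) := ⟨fun x => if χ x then a.coeff x else 0,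
    HilbMod.summable_of_le a.summable fun s => by
      refine (CStarAlgebra.norm_le_norm_of_nonneg_of_le
        (Finset.sum_nonneg fun x _ => star_mul_self_nonneg _)
        (Finset.sum_le_sum fun x _ => ?_)).trans
        (le_mul_of_one_le_left (norm_nonneg (∑ x ∈ s, star (a.coeff x) * a.coeff x)) one_le_two)
      beta_reduce
      split_ifs
      · exact le_rfl
      · rw [mul_zero]
        exact star_mul_self_nonneg _⟩
  have hb : ∀ x, b.coeff x = if χ x then a.coeff x else 0 := fun x => rfl
  have hba : ‖b‖ ≤ ‖a‖ := by
    refine HilbMod.norm_le_of_forall_sum (norm_nonneg _) fun s => ?_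
    refine le_trans ?_ (HilbMod.norm_sum_le_norm_inner a s)
    refine CStarAlgebra.norm_le_norm_of_nonneg_of_le
        (Finset.sum_nonneg fun x _ => star_mul_self_nonneg _)
        (Finset.sum_le_sum fun x _ => ?_)
    rw [hb]
    split_ifs
    · exact le_rfl
    · rw [mul_zero]
      exact star_mul_self_nonneg _
  have hDa : ∀ x, ((redHom hp hf D).op a).coeff x =
      if χ x then ((redHom hp hf T).op b).coeff x else 0 := fun x => by
    rw [coeff_redHom, coeff_redHom, hD]
    by_cases hx : χ x
    · rw [if_pos hx]
      refine finsum_congr fun y => ?_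
      rw [hb]
      by_cases hy : χ y
      · rw [BandMatrix.cut_of (P := fun x y => χ x ∧ χ y) ⟨hx, hy⟩, if_pos hy]
      · rw [BandMatrix.cut_of_not (P := fun x y => χ x ∧ χ y) fun h => hy h.2, if_neg hy, map_zero,
          map_zero]
        rfl
    · rw [if_neg hx]
      refine finsum_eq_zero_of_forall_eq_zero fun y => ?_
      rw [BandMatrix.cut_of_not (P := fun x y => χ x ∧ χ y) fun h => hx h.1, map_zero]
      rfl
  calc ‖(redHom hp hf D).op a‖ ≤ ‖(redHom hp hf T).op b‖ := by
        refine HilbMod.norm_le_of_forall_sum (norm_nonneg _) fun s => ?_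
        refine le_trans ?_ (HilbMod.norm_sum_le_norm_inner ((redHom hp hf T).op b) s)
        refine CStarAlgebra.norm_le_norm_of_nonneg_of_le
            (Finset.sum_nonneg fun x _ => star_mul_self_nonneg _)
            (Finset.sum_le_sum fun x _ => ?_)
        rw [hDa]
        split_ifs
        · exact le_rfl
        · rw [mul_zero]
          exact star_mul_self_nonneg _
    _ ≤ ‖(redHom hp hf T).op‖ * ‖b‖ := (redHom hp hf T).op.le_opNorm b
    _ ≤ _ := by gcongr

/-- Taking roots of order `2 ^ n` removes the constant. -/
theorem le_of_forall_pow_two_pow_le {s t C : ℝ} (ht : 0 ≤ t)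
    (h : ∀ n : ℕ, s ^ 2 ^ n ≤ C * t ^ 2 ^ n) : s ≤ t := by
  by_contra! hlt
  rcases ht.eq_or_lt with rfl | ht
  · have := h 0
    simp only [pow_zero, pow_one, mul_zero] at this
    linarith
  · have h1 : 1 < s / t := (one_lt_div ht).mpr hlt
    obtain ⟨n, hn⟩ := pow_unbounded_of_one_lt C h1
    have h2 := h n
    rw [← div_le_iff₀ (by positivity), ← div_pow] at h2
    exact absurd (hn.trans_le ((pow_le_pow_right₀ h1.le Nat.lt_two_pow_self.le).trans h2)) (lt_irrefl _)

theorem norm_map_mul_star {B 𝓑 : Type*} [NonUnitalRing B] [StarRing B] [Module ℂ B] [CStarAlgebra 𝓑]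
    (φ : B →⋆ₙₐ[ℂ] 𝓑) (a : B) : ‖φ (a * star a)‖ = ‖φ a‖ ^ 2 := by
  rw [map_mul, map_star, CStarRing.norm_self_mul_star, sq]

theorem norm_map_mul_self {B 𝓑 : Type*} [NonUnitalRing B] [StarRing B] [Module ℂ B] [CStarAlgebra 𝓑]
    (φ : B →⋆ₙₐ[ℂ] 𝓑) {a : B} (ha : star a = a) : ‖φ (a * a)‖ = ‖φ a‖ ^ 2 := by
  rw [← norm_map_mul_star, ha]

/-- On block diagonal matrices with blocks of bounded size every representation is dominated by the
regular one. -/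
theorem norm_map_le_of_block {𝓑 : Type*} [CStarAlgebra 𝓑] (π : twistedAlg p f →⋆ₙₐ[ℂ] 𝓑)
    {rel : X → X → Prop} (hsymm : ∀ x y, rel x y → rel y x)
    (htrans : ∀ x y z, rel x y → rel y z → rel x z) {R : ℝ} (hR : ∀ x y, rel x y → dist x y ≤ R)
    (D : twistedAlg p f) (hD : ∀ x y, D.1.entry x y ≠ 0 → rel x y) :
    ‖π D‖ ≤ ‖redHom hp hf D‖ := by
  obtain ⟨C, hC, hCb⟩ := exists_norm_map_le (p := p) hp hf R
  have hmul : ∀ S T : twistedAlg p f, (∀ x y, S.1.entry x y ≠ 0 → rel x y) →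
      (∀ x y, T.1.entry x y ≠ 0 → rel x y) → ∀ x y, (S * T).1.entry x y ≠ 0 → rel x y := by
    intro S T hS hT x y hne
    obtain ⟨z, hz⟩ : ∃ z, S.1.entry x z * T.1.entry z y ≠ 0 := by
      by_contra! h
      exact hne (finsum_eq_zero_of_forall_eq_zero h)
    exact htrans x z y (hS x z (left_ne_zero_of_mul hz)) (hT z y (right_ne_zero_of_mul hz))
  -- `E n` is the power of `D * star D` with exponent `2 ^ n`. Transitivity of `rel` keeps the
  -- propagation of all of them at most `R`, so one constant `C` serves for every `n`.
  let E : ℕ → twistedAlg p f := fun n => Nat.rec (D * star D) (fun _ T => T * T) n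
  have hE : ∀ n, E (n + 1) = E n * E n := fun n => rfl
  have hErel : ∀ n x y, (E n).1.entry x y ≠ 0 → rel x y := by
    intro n
    induction n with
    | zero => exact hmul _ _ hD fun x y hne => hsymm _ _ (hD y x fun h => hne (by
        change star (D.1.entry y x) = 0
        rw [h, star_zero]))
    | succ n ih => exact hmul _ _ ih ih
  have hEstar : ∀ n, star (E n) = E n := by
    intro n
    induction n with
    | zero => change star (D * star D) = D * star D; simp
    | succ n ih => rw [hE, star_mul, ih]
  have hEnorm : ∀ n, ‖π (E n)‖ = (‖π D‖ ^ 2) ^ 2 ^ n := fun n => by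
    induction n with
    | zero => rw [pow_zero, pow_one]; exact norm_map_mul_star π D
    | succ n ih => rw [hE, norm_map_mul_self π (hEstar n), ih, ← pow_mul, ← pow_succ]
  have hEnorm' : ∀ n, ‖redHom hp hf (E n)‖ = (‖redHom hp hf D‖ ^ 2) ^ 2 ^ n := fun n => by
    induction n with
    | zero => rw [pow_zero, pow_one]; exact norm_map_mul_star (redHom hp hf) D
    | succ n ih => rw [hE, norm_map_mul_self (redHom hp hf) (hEstar n), ih, ← pow_mul, ← pow_succ]
  refine (sq_le_sq₀ (norm_nonneg _) (norm_nonneg _)).mp (le_of_forall_pow_two_pow_le (C := C)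
    (by positivity) fun n => ?_)
  rw [← hEnorm n, ← hEnorm' n]
  -- The entries are bounded by the norm on `E`, so `C` compares the two norms directly.
  refine hCb π (E n) _ (norm_nonneg _) ⟨fun x y hxy => ?_, fun x y => norm_entry_le_redHom hp hf _ x y⟩
  by_contra hne
  exact absurd (hR x y (hErel n x y hne)) (not_le.mpr hxy)

end Twisted

/-! ### Compression by property A. -/

section Twisted

variable {X : Type u} {Y : Type v} {H : Type w} [MetricSpace X] [MetricSpace Y]
  [NormedAddCommGroup H] [InnerProductSpace ℝ H] [CompleteSpace H] [BoundedGeometry X]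
  [BoundedGeometry Y] {p : X → Y} {f : Y → H}

/-- The evaluation of a twisted matrix at a point. -/
def evalAt (q : RPlus H) : twistedAlg p f →⋆ₙₐ[ℂ] BandMatrix X (Coef H) :=
  (BandMatrix.mapHom (AlgA.evalHom q)).comp (NonUnitalStarSubalgebraClass.subtype (twistedAlg p f))

@[simp] theorem evalAt_entry (q : RPlus H) (T : twistedAlg p f) (x y : X) :
    (evalAt q T).entry x y = (T.1.entry x y).toFun.val q := rfl

theorem ext_evalAt {S T : twistedAlg p f} (h : ∀ q, evalAt q S = evalAt q T) : S = T :=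
  Subtype.ext (BandMatrix.ext_eval h)

/-- The multipliers `Δ i` will not lie in the twisted algebra, but `Δ i * star u` and `Δ i * (u *
star u)` will; the three identities involve only these, `d i` and `u`, in the form required by
`norm_le_of_partition`. -/
theorem sum_star_mul_of_partition {ι B : Type*} [NonUnitalRing B] [StarRing B] (s : Finset ι)
    {Δ d : ι → B} {u : B} (hΔ : ∀ i ∈ s, star (Δ i) = Δ i) (hu : ∑ i ∈ s, Δ i * (Δ i * u) = u)
    (hu' : ∑ i ∈ s, Δ i * (Δ i * star u) = star u) (hd : ∑ i ∈ s, Δ i * (d i * Δ i) = u) :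
    ∑ i ∈ s, star (Δ i * star u) * (Δ i * star u) = u * star u ∧
    ∑ i ∈ s, star (Δ i * (u * star u)) * (Δ i * (u * star u)) = u * star u * (u * star u) ∧
    ∑ i ∈ s, star (Δ i * (u * star u)) * (d i * (Δ i * star u)) = u * star u * (u * star u) := by
  refine ⟨?_, ?_, ?_⟩
  · have e : u * star u = u * ∑ i ∈ s, Δ i * (Δ i * star u) := by rw [hu']
    rw [e, Finset.mul_sum]
    refine Finset.sum_congr rfl fun i hi => ?_
    rw [star_mul, hΔ i hi, star_star, mul_assoc]
  · have e : u * star u * (u * star u) = u * star u * ((∑ i ∈ s, Δ i * (Δ i * u)) * star u) := by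
      rw [hu]
    rw [e, Finset.sum_mul, Finset.mul_sum]
    refine Finset.sum_congr rfl fun i hi => ?_
    rw [star_mul, hΔ i hi, star_mul, star_star]
    simp only [mul_assoc]
  · have e : u * star u * (u * star u) =
        u * star u * ((∑ i ∈ s, Δ i * (d i * Δ i)) * star u) := by rw [hd]
    rw [e, Finset.sum_mul, Finset.mul_sum]
    refine Finset.sum_congr rfl fun i hi => ?_
    rw [star_mul, hΔ i hi, star_mul, star_star]
    simp only [mul_assoc]

/-- The compression of a twisted matrix by a partition of unity which is supported in separated
blocks is bounded in every representation by the norm on the Hilbert module. -/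
theorem exists_compression (hp : UniformlyExpansive p) (hf : IsCoarseEmbedding f)
    {K : Type*} [NormedAddCommGroup K] [InnerProductSpace ℂ K] [CompleteSpace K]
    (π : twistedAlg p f →⋆ₙₐ[ℂ] (K →L[ℂ] K)) {T : twistedAlg p f} {Ω : Set (RPlus H)}
    (hT : T ∈ twistedOnAlg p f Ω) {n : ℕ} {m : Fin n → X → RPlus H → ℝ}
    (hm : ∀ c x q, |m c x q| ≤ 1)
    (hloc : ∀ c x, ∀ q ∈ Ω, ∀ᶠ q' in 𝓝 q, m c x q' = m c x q)
    (hone : ∀ x y q, (T.1.entry x y).toFun.val q ≠ 0 →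
      ∑ c, m c x q * m c x q = 1 ∧ ∑ c, m c y q * m c y q = 1)
    {χ : Fin n → X → Prop} (hχ : ∀ c x q, m c x q ≠ 0 → χ c x)
    {rel : Fin n → X → X → Prop} (hsymm : ∀ c x y, rel c x y → rel c y x)
    (htrans : ∀ c x y z, rel c x y → rel c y z → rel c x z)
    {R : ℝ} (hR : ∀ c x y, rel c x y → dist x y ≤ R)
    (hrel : ∀ c x y, χ c x → χ c y → T.1.entry x y ≠ 0 → rel c x y) :
    ∃ U : twistedAlg p f, ‖π U‖ ≤ ‖redHom hp hf T‖ ∧ ∀ x y q, (U.1.entry x y).toFun.val q =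
      ((∑ c, m c x q * m c y q : ℝ) : ℂ) • (T.1.entry x y).toFun.val q := by
  -- `U` is `∑ m_c T m_c`, realized as a Schur product, which is twisted because the multipliers are
  -- locally constant on `Ω`.
  obtain ⟨U₀, hU₀, hU⟩ := (isTwisted_of_mem hp hf T.2).exists_schur
    (κ := fun x y q => ((∑ c, m c x q * m c y q : ℝ) : ℂ)) (C := n) (fun x y q => by
      rw [Complex.norm_real]
      refine (norm_sum_le_card_mul Finset.univ _ (K := 1) (N := n) zero_le_one (by simp)
        fun c _ => ?_).trans (by simp)
      rw [norm_mul]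
      exact mul_le_one₀ (hm c x q) (norm_nonneg _) (hm c y q))
    (fun x y q hq => by
      have h1 := (eventually_all (ι := Fin n)).mpr fun c => hloc c x q (hT x y hq)
      have h2 := (eventually_all (ι := Fin n)).mpr fun c => hloc c y q (hT x y hq)
      filter_upwards [h1, h2] with q' h1 h2
      simp only [h1, h2])
  let U : twistedAlg p f := ⟨U₀, hU₀.mem_twistedAlg⟩
  have hUe : ∀ x y q, (U.1.entry x y).toFun.val q =
      ((∑ c, m c x q * m c y q : ℝ) : ℂ) • (T.1.entry x y).toFun.val q := hU
  have hUT : ∀ x y q, (U.1.entry x y).toFun.val q ≠ 0 → (T.1.entry x y).toFun.val q ≠ 0 :=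
    fun x y q h h0 => h (by rw [hUe, h0, smul_zero])
  have hUΩ : U ∈ twistedOnAlg p f Ω := fun x y => (supp_subset_supp fun q h => by
    rw [hUe, h, smul_zero]).trans (hT x y)
  have hmul : ∀ S ∈ twistedOnAlg p f Ω, ∀ c, ∃ S' : twistedAlg p f, ∀ x y q,
      (S'.1.entry x y).toFun.val q = (m c x q : ℂ) • (S.1.entry x y).toFun.val q := by
    intro S hS c
    obtain ⟨S', h1, h2⟩ := (isTwisted_of_mem hp hf S.2).exists_schur
      (κ := fun x _ q => (m c x q : ℂ)) (C := 1) (fun x y q => by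
        rw [Complex.norm_real]; exact hm c x q)
      (fun x y q hq => (hloc c x q (hS x y hq)).mono fun q' h => by simp only [h])
    exact ⟨⟨S', h1.mem_twistedAlg⟩, h2⟩
  -- `a c` and `b c` play the role of `m_c U*` and `m_c U U*`.
  choose a ha using hmul (star U) (star_mem hUΩ)
  choose b hb using hmul (U * star U) (mul_mem hUΩ (star_mem hUΩ))
  -- The part of `T` between points of `χ c`, which is block diagonal for `rel c`.
  let D : Fin n → twistedAlg p f := fun c =>
    ⟨T.1.cut fun x y => χ c x ∧ χ c y, ((isTwisted_of_mem hp hf T.2).cut _).mem_twistedAlg⟩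
  have hD : ∀ c, ‖π (D c)‖ ≤ ‖redHom hp hf T‖ := fun c => by
    refine (norm_map_le_of_block hp hf π (hsymm c) (htrans c) (hR c) (D c) fun x y hne => ?_).trans
      (norm_redHom_cut_le hp hf T (χ c) rfl)
    have h1 : χ c x ∧ χ c y := by
      by_contra hn
      exact hne (BandMatrix.cut_of_not (P := fun x y => χ c x ∧ χ c y) hn T.1)
    refine hrel c x y h1.1 h1.2 fun h0 => hne ?_
    exact (BandMatrix.cut_of (P := fun x y => χ c x ∧ χ c y) h1 T.1).trans h0
  let Δ : RPlus H → Fin n → BandMatrix X (Coef H) := fun q c =>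
    BandMatrix.diag fun x => (m c x q : ℂ) • 1
  have hΔs : ∀ q c, star (Δ q c) = Δ q c := fun q c => by
    simp only [Δ, BandMatrix.star_diag, star_smul, star_one]
    congr 1
    ext1 x
    simp
  have hΔe : ∀ q c (S : BandMatrix X (Coef H)) x y,
      (Δ q c * S).entry x y = (m c x q : ℂ) • S.entry x y := fun q c S x y => by
    rw [BandMatrix.diag_mul_entry, smul_mul_assoc, one_mul]
  have hΔe' : ∀ q c (S : BandMatrix X (Coef H)) x y,
      (S * Δ q c).entry x y = (m c y q : ℂ) • S.entry x y := fun q c S x y => by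
    rw [BandMatrix.mul_diag_entry, mul_smul_comm, mul_one]
  have hEa : ∀ q c, evalAt q (a c) = Δ q c * evalAt q (star U) := fun q c => by
    refine BandMatrix.ext (funext₂ fun x y => ?_)
    rw [hΔe, evalAt_entry, ha]
    rfl
  have hEb : ∀ q c, evalAt q (b c) = Δ q c * evalAt q (U * star U) := fun q c => by
    refine BandMatrix.ext (funext₂ fun x y => ?_)
    rw [hΔe, evalAt_entry, hb]
    rfl
  -- `m c` vanishes off `χ c`, so replacing `T` by `D c` between two factors `m_c` changes nothing.
  have hEU : ∀ q, ∑ c, Δ q c * (evalAt q (D c) * Δ q c) = evalAt q U := fun q => by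
    refine BandMatrix.ext (funext₂ fun x y => ?_)
    rw [BandMatrix.sum_entry, evalAt_entry, hUe, Complex.ofReal_sum, Finset.sum_smul]
    refine Finset.sum_congr rfl fun c _ => ?_
    rw [hΔe, hΔe', smul_smul, Complex.ofReal_mul, evalAt_entry]
    by_cases h : χ c x ∧ χ c y
    · rw [show (D c).1.entry x y = T.1.entry x y from
        BandMatrix.cut_of (P := fun x y => χ c x ∧ χ c y) h T.1]
    · have h0 : (m c x q : ℂ) * (m c y q : ℂ) = 0 := by
        by_contra hne
        exact h ⟨hχ c x q (by exact_mod_cast left_ne_zero_of_mul hne),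
          hχ c y q (by exact_mod_cast right_ne_zero_of_mul hne)⟩
      rw [h0, zero_smul, zero_smul]
  have hΔU : ∀ q, ∑ c, Δ q c * (Δ q c * evalAt q U) = evalAt q U := fun q => by
    refine BandMatrix.ext (funext₂ fun x y => ?_)
    rw [BandMatrix.sum_entry]
    simp only [hΔe, smul_smul, ← Finset.sum_smul]
    by_cases h : (U.1.entry x y).toFun.val q = 0
    · rw [evalAt_entry, h, smul_zero]
    · have := (hone x y q (hUT x y q h)).1
      have e : ∑ c, (m c x q : ℂ) * (m c x q : ℂ) = 1 := by exact_mod_cast this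
      rw [e, one_smul]
  have hΔU' : ∀ q, ∑ c, Δ q c * (Δ q c * evalAt q (star U)) = evalAt q (star U) := fun q => by
    refine BandMatrix.ext (funext₂ fun x y => ?_)
    rw [BandMatrix.sum_entry]
    simp only [hΔe, smul_smul, ← Finset.sum_smul]
    have h1 : (evalAt q (star U)).entry x y = star ((U.1.entry y x).toFun.val q) := rfl
    rw [h1]
    by_cases h : (U.1.entry y x).toFun.val q = 0
    · rw [h, star_zero, smul_zero]
    · have := (hone y x q (hUT y x q h)).2
      have e : ∑ c, (m c x q : ℂ) * (m c x q : ℂ) = 1 := by exact_mod_cast this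
      rw [e, one_smul]
  have hid := fun q => sum_star_mul_of_partition Finset.univ (Δ := Δ q) (u := evalAt q U)
    (d := fun c => evalAt q (D c)) (fun c _ => hΔs q c) (hΔU q)
    (by simpa only [map_star] using hΔU' q) (hEU q)
  have h1 : ∑ c, star (a c) * a c = U * star U := ext_evalAt fun q => by
    simp only [map_sum, map_mul, map_star, hEa]
    exact (hid q).1
  have h2 : ∑ c, star (b c) * b c = (U * star U) * (U * star U) := ext_evalAt fun q => by
    simp only [map_sum, map_mul, map_star, hEb]
    exact (hid q).2.1
  have h3 : ∑ c, star (b c) * (D c * a c) = (U * star U) * (U * star U) := ext_evalAt fun q => by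
    simp only [map_sum, map_mul, map_star, hEb, hEa]
    exact (hid q).2.2
  refine ⟨U, ?_, hUe⟩
  refine norm_le_of_partition Finset.univ (a := fun c => π (a c)) (b := fun c => π (b c))
    (D := fun c => π (D c)) (norm_nonneg _) ?_ ?_ ?_ fun c _ => hD c
  · simp only [← map_star, ← map_mul, ← map_sum, h1]
  · simp only [← map_star, ← map_mul, ← map_sum, h2]
  · simp only [← map_star, ← map_mul, ← map_sum, h3]

/-- On the twisted matrices supported in a separated family of open sets every representation is
dominated by the regular one. -/
theorem norm_map_le_norm_redHom (hp : UniformlyExpansive p) (hf : IsCoarseEmbedding f)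
    (hA : ∀ R : ℝ, 0 < R → EquiPropertyA fun y : Y => p ⁻¹' Metric.ball y R)
    {J : Type*} {r : ℝ} (hr : 0 < r) {O : J → Set (RPlus H)} (hO : IsSeparate p f r O)
    {K : Type*} [NormedAddCommGroup K] [InnerProductSpace ℂ K] [CompleteSpace K]
    (π : twistedAlg p f →⋆ₙₐ[ℂ] (K →L[ℂ] K)) {T : twistedAlg p f}
    (hT : T ∈ twistedOnAlg p f (⋃ i, O i)) : ‖π T‖ ≤ ‖redHom hp hf T‖ := by
  classical
  have hTt := isTwisted_of_mem hp hf T.2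
  obtain ⟨r₁, hr₁, hprop⟩ := hTt.propagation
  obtain ⟨r₂, hr₂, hsupp⟩ := hTt.support
  obtain ⟨M, hM0, hM⟩ := hTt.bounded'
  -- Where `T(x, y)` is nonzero inside `O i`, the centres `f (p x)` and `f (p (ξ i))` are less than
  -- `r₂ + r` apart, hence `p x` is within `R₀` of `p (ξ i)`, and `p y` within `R₀ + s`.
  obtain ⟨R₀, hR₀, hdist⟩ := exists_dist_lt_of_norm_image_lt hf (r₂ + r)
  obtain ⟨s, hs, hps⟩ := exists_dist_image_le hp r₁
  obtain ⟨C, hC0, hC⟩ := exists_norm_map_le (p := p) hp hf r₁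
  choose ξ hξ using hO.subset_ball
  refine le_of_forall_pos_le_add fun δ hδ => ?_
  -- Chosen so that the error `C * (ε * M)` of the compression is at most `δ`; the summand 1 avoids
  -- division by zero.
  let ε := δ / (C * M + 1)
  have hCM : 0 ≤ C * M := mul_nonneg hC0 hM0
  have hε : 0 < ε := by positivity
  obtain ⟨S, hS, ζ, hζ01, hζS, hζ1, hζε⟩ := (hA (R₀ + s) (by positivity)).exists_kernel hr₁ hε
  -- At this separation an `S`-ball contains at most one point of each colour, and two points within
  -- `r₁` of each other that are near centres of one colour are near the same centre.
  obtain ⟨n, col, hcol⟩ := exists_colouring (X := X) (2 * S + r₁)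
  let μ : J → Fin n → X → ℝ := fun i c x => ∑ z ∈ ballFinset x S with col z = c, ζ (p (ξ i)) x z
  -- By disjointness the chosen index is the only one, so `m` depends on `q` only through the member
  -- of the family containing it.
  let m : Fin n → X → RPlus H → ℝ := fun c x q => if h : ∃ i, q ∈ O i then μ h.choose c x else 0
  have hmi : ∀ i q, q ∈ O i → ∀ c x, m c x q = μ i c x := by
    intro i q hq c x
    have h : ∃ i, q ∈ O i := ⟨i, hq⟩
    have e : h.choose = i := by
      by_contra hne
      have : q ∈ O h.choose ∩ O i := ⟨h.choose_spec, hq⟩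
      rw [hO.disjoint _ _ hne] at this
      exact this
    simp only [m]
    rw [dif_pos h, e]
  have hm0 : ∀ q, (¬∃ i, q ∈ O i) → ∀ c x, m c x q = 0 := fun q h c x => dif_neg h
  have hμ : ∀ i c x, |μ i c x| ≤ 1 := by
    intro i c x
    rw [abs_of_nonneg (Finset.sum_nonneg fun z _ => (hζ01 _ x z).1)]
    have hcard : ({z ∈ ballFinset x S | col z = c}).card ≤ 1 := Finset.card_le_one.mpr
      fun z hz z' hz' => by
        rw [Finset.mem_filter, mem_ballFinset] at hz hz'
        exact hcol z z' (hz.2.trans hz'.2.symm) (by linarith [dist_triangle_left z z' x])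
    refine (Finset.sum_le_card_nsmul _ _ 1 fun z _ => (hζ01 _ x z).2).trans ?_
    rw [nsmul_one]
    exact_mod_cast hcard
  have hμχ : ∀ i c x, μ i c x ≠ 0 → ∃ z, col z = c ∧ dist x z ≤ S := fun i c x h => by
    obtain ⟨z, hz, -⟩ := Finset.exists_ne_zero_of_sum_ne_zero h
    rw [Finset.mem_filter, mem_ballFinset] at hz
    exact ⟨z, hz.2, hz.1⟩
  -- A colour contributes at most one centre, common to `x` and `x'`, so products of different
  -- centres do not occur.
  have hsum : ∀ i x x', dist x x' ≤ r₁ → ∑ c, μ i c x * μ i c x' =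
      ∑ z ∈ ballFinset x S, ζ (p (ξ i)) x z * ζ (p (ξ i)) x' z := by
    intro i x x' hxx'
    rw [← Finset.sum_fiberwise (ballFinset x S) col]
    refine Finset.sum_congr rfl fun c _ => ?_
    rw [Finset.sum_mul]
    refine Finset.sum_congr rfl fun z hz => ?_
    rw [Finset.mem_filter, mem_ballFinset] at hz
    congr 1
    refine Finset.sum_eq_single z (fun z' hz' hne => ?_) fun hz' => ?_
    · rw [Finset.mem_filter, mem_ballFinset] at hz'
      refine absurd (hcol z' z (hz'.2.trans hz.2.symm) ?_) hne
      linarith [dist_triangle4_left z' z x' x, dist_triangle_left z' z x', dist_triangle x' x z,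
        dist_comm x x']
    · by_contra hne
      exact hz' (Finset.mem_filter.mpr ⟨mem_ballFinset.mpr (hζS _ _ _ hne), hz.2⟩)
  have hkey : ∀ x y q, (T.1.entry x y).toFun.val q ≠ 0 → dist x y ≤ r₁ ∧ ∃ i, q ∈ O i ∧
      x ∈ p ⁻¹' Metric.ball (p (ξ i)) (R₀ + s) ∧ y ∈ p ⁻¹' Metric.ball (p (ξ i)) (R₀ + s) := by
    intro x y q hq
    have hxy : dist x y ≤ r₁ := by
      by_contra! hn
      exact hq (by rw [hprop x y hn]; rfl)
    have hqs := mem_supp_of_ne_zero hq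
    obtain ⟨i, hi⟩ := Set.mem_iUnion.mp (hT x y hqs)
    have h1 := hdist _ _ (norm_sub_lt_of_mem_ballR hr₂ hr (hsupp x y hqs) (hξ i hi))
    have h2 := hps x y hxy
    refine ⟨hxy, i, hi, ?_, ?_⟩
    · change dist (p x) (p (ξ i)) < R₀ + s
      linarith
    · change dist (p y) (p (ξ i)) < R₀ + s
      linarith [dist_triangle_left (p y) (p (ξ i)) (p x)]
  obtain ⟨U, hU1, hU2⟩ := exists_compression hp hf π hT (m := m)
    (χ := fun c x => ∃ z, col z = c ∧ dist x z ≤ S)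
    (rel := fun c x y => ∃ z, col z = c ∧ dist x z ≤ S ∧ dist y z ≤ S) (R := 2 * S)
    (fun c x q => by
      by_cases h : ∃ i, q ∈ O i
      · obtain ⟨i, hi⟩ := h
        rw [hmi i q hi]
        exact hμ i c x
      · rw [hm0 q h]
        simp)
    (fun c x q hq => by
      obtain ⟨i, hi⟩ := Set.mem_iUnion.mp hq
      filter_upwards [(hO.isOpen i).mem_nhds hi] with q' hq'
      rw [hmi i q hi, hmi i q' hq'])
    (fun x y q hq => by
      obtain ⟨-, i, hi, hx, hy⟩ := hkey x y q hq
      simp only [hmi i q hi]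
      rw [hsum i x x (by rw [dist_self]; exact hr₁.le), hsum i y y (by rw [dist_self]; exact hr₁.le)]
      exact ⟨hζ1 _ x hx, hζ1 _ y hy⟩)
    (fun c x q hne => by
      by_cases h : ∃ i, q ∈ O i
      · obtain ⟨i, hi⟩ := h
        rw [hmi i q hi] at hne
        exact hμχ i c x hne
      · exact absurd (hm0 q h c x) hne)
    (fun c x y ⟨z, h1, h2, h3⟩ => ⟨z, h1, h3, h2⟩)
    (fun c x y w ⟨z, h1, h2, h3⟩ ⟨z', h1', h2', h3'⟩ => by
      have : z = z' := hcol z z' (h1.trans h1'.symm) (by linarith [dist_triangle_left z z' y])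
      subst this
      exact ⟨z, h1, h2, h3'⟩)
    (fun c x y ⟨z, h1, h2, h3⟩ => by linarith [dist_triangle_right x y z])
    (fun c x y ⟨z, h1, h2⟩ ⟨z', h1', h2'⟩ hne => by
      have hxy : dist x y ≤ r₁ := by
        by_contra! hn
        exact hne (hprop x y hn)
      have : z = z' := hcol z z' (h1.trans h1'.symm) (by
        linarith [dist_triangle_left z z' x, dist_triangle x y z'])
      subst this
      exact ⟨z, h1, h2, h2'⟩)
  have hTUe : ∀ x y q, ((T - U).1.entry x y).toFun.val q =
      ((1 - ∑ c, m c x q * m c y q : ℝ) : ℂ) • (T.1.entry x y).toFun.val q := fun x y q => by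
    change (T.1.entry x y + -U.1.entry x y).toFun.val q = _
    rw [AlgA.toFun_add, BddFun.val_add]
    change _ + -(U.1.entry x y).toFun.val q = _
    rw [hU2, Complex.ofReal_sub, sub_smul, Complex.ofReal_one, one_smul, sub_eq_add_neg]
  -- The difference has the propagation of `T` and entries of norm at most `ε * M`, so the bound
  -- valid in every representation applies.
  have hTU : ‖π (T - U)‖ ≤ C * (ε * M) := by
    refine hC π (T - U) (ε * M) (by positivity) ⟨fun x y hxy => AlgA.ext fun q => ?_,
      fun x y => BddFun.norm_le (by positivity) fun q => ?_⟩
    · rw [hTUe, hprop x y hxy]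
      exact smul_zero _
    · change ‖((T - U).1.entry x y).toFun.val q‖ ≤ _
      rw [hTUe]
      by_cases hq : (T.1.entry x y).toFun.val q = 0
      · rw [hq, smul_zero, norm_zero]
        positivity
      · obtain ⟨hxy, i, hi, hx, hy⟩ := hkey x y q hq
        rw [norm_smul, Complex.norm_real]
        simp only [hmi i q hi]
        rw [hsum i x y hxy]
        exact mul_le_mul (hζε _ x hx y hy hxy) ((AlgA.norm_val_le _ q).trans (hM x y))
          (norm_nonneg _) hε.le
  have h1 : π T = π U + π (T - U) := by rw [← map_add, add_sub_cancel]
  have h2 : C * (ε * M) ≤ δ := by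
    have : ε * (C * M + 1) = δ := div_mul_cancel₀ _ (by positivity)
    nlinarith
  rw [h1]
  exact (norm_add_le _ _).trans (add_le_add hU1 (hTU.trans h2))

end Twisted

/-! ### Extension of homomorphisms to completions. -/

section Extension

variable {B M R : Type*} [NonUnitalRing B] [StarRing B] [Module ℂ B] [NonUnitalCStarAlgebra M]
  [NonUnitalCStarAlgebra R] {φ : B →⋆ₙₐ[ℂ] M} {σ : B →⋆ₙₐ[ℂ] R}

theorem continuous_starHom (Λ : M →⋆ₙₐ[ℂ] R) : Continuous Λ :=
  AddMonoidHomClass.continuous_of_bound Λ 1 fun x => by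
    simpa using NonUnitalStarAlgHom.norm_apply_le Λ x

theorem starHom_ext_of_denseRange (hφ : DenseRange φ) {Λ Λ' : M →⋆ₙₐ[ℂ] R}
    (h : ∀ b, Λ (φ b) = Λ' (φ b)) : Λ = Λ' :=
  DFunLike.coe_injective
    (hφ.equalizer (continuous_starHom Λ) (continuous_starHom Λ') (funext h))

/-- A `*`-homomorphism extends to a completion for which it is contractive. -/
theorem exists_starHom_extension (hφ : DenseRange φ) (h : ∀ b, ‖σ b‖ ≤ ‖φ b‖) :
    ∃ Λ : M →⋆ₙₐ[ℂ] R, ∀ b, Λ (φ b) = σ b := by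
  let e : B →ₗ[ℂ] M := { toFun := φ, map_add' := map_add φ, map_smul' := map_smul φ }
  let g : B →ₗ[ℂ] R := { toFun := σ, map_add' := map_add σ, map_smul' := map_smul σ }
  have hΛ : ∀ b, g.extendOfNorm e (φ b) = σ b :=
    fun b => LinearMap.extendOfNorm_eq (f := g) (e := e) hφ ⟨1, fun x => (h x).trans_eq (one_mul _).symm⟩ b
  have hc : Continuous (g.extendOfNorm e) := (g.extendOfNorm e).continuous
  refine ⟨{ toFun := g.extendOfNorm e
            map_smul' := fun c x => map_smul _ c x
            map_zero' := map_zero _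
            map_add' := map_add _
            map_mul' := fun x y => ?_
            map_star' := fun x => ?_ }, hΛ⟩
  · refine hφ.induction_on₂ (p := fun x y => g.extendOfNorm e (x * y) =
      g.extendOfNorm e x * g.extendOfNorm e y) (isClosed_eq (by fun_prop) (by fun_prop))
      (fun a b => ?_) x y
    rw [← map_mul, hΛ, hΛ, hΛ, map_mul]
  · refine hφ.induction_on (p := fun x => g.extendOfNorm e (star x) = star (g.extendOfNorm e x)) x
      (isClosed_eq (by fun_prop) (by fun_prop)) fun b => ?_
    rw [← map_star, hΛ, hΛ, map_star]

/-- A `*`-homomorphism which is isometric on a `*`-subalgebra maps its closure bijectively. -/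
theorem bijOn_closure_image {Λ : M →⋆ₙₐ[ℂ] R} (hΛ : ∀ b, Λ (φ b) = σ b)
    (𝒮 : NonUnitalStarSubalgebra ℂ B) (h : ∀ b ∈ 𝒮, ‖σ b‖ = ‖φ b‖) :
    Set.BijOn Λ (closure (φ '' 𝒮)) (closure (σ '' 𝒮)) := by
  have hc := continuous_starHom Λ
  have himg : Λ '' (φ '' 𝒮) = σ '' 𝒮 := by
    rw [Set.image_image]
    exact Set.image_congr fun b _ => hΛ b
  have hnorm : ∀ x ∈ closure (φ '' 𝒮), ‖Λ x‖ = ‖x‖ := by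
    refine fun x hx => closure_minimal (t := {x | ‖Λ x‖ = ‖x‖}) ?_
      (isClosed_eq (by fun_prop) (by fun_prop)) hx
    rintro _ ⟨b, hb, rfl⟩
    rw [Set.mem_ofPred_eq, hΛ, h b hb]
  have hcl : closure (φ '' 𝒮) = ((𝒮.map φ).topologicalClosure : Set M) := by
    rw [← NonUnitalStarSubalgebra.coe_map]
    rfl
  have hdist : ∀ x ∈ closure (φ '' 𝒮), ∀ y ∈ closure (φ '' 𝒮), dist (Λ x) (Λ y) = dist x y := by
    intro x hx y hy
    rw [dist_eq_norm, dist_eq_norm, ← map_sub]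
    refine hnorm _ ?_
    rw [hcl] at hx hy ⊢
    exact sub_mem hx hy
  have hiso : Isometry ((closure (φ '' 𝒮)).domRestrict Λ) :=
    Isometry.of_dist_eq fun x y => hdist x x.2 y y.2
  refine ⟨fun x hx => ?_, fun x hx y hy hxy => ?_, ?_⟩
  · rw [← himg]
    exact image_closure_subset_closure_image hc ⟨x, hx, rfl⟩
  · rw [← dist_eq_zero, ← hdist x hx y hy, hxy, dist_self]
  · have hclosed : IsClosed (Λ '' closure (φ '' 𝒮)) := by
      have := isClosed_closure (s := φ '' 𝒮) |>.completeSpace_coe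
      rw [← Set.range_domRestrict]
      exact hiso.isClosedEmbedding.isClosed_range
    refine closure_minimal ?_ hclosed
    rw [← himg]
    exact Set.image_mono subset_closure

variable {A A' : Type*} [NonUnitalCStarAlgebra A] [NonUnitalCStarAlgebra A']

/-- Both completions are realized as closures inside larger `C^*`-algebras, so the extension is
formulated for subalgebras. Uniqueness comes from density, bijectivity from isometry. -/
theorem exists_starHom_closure_range (φ : B →⋆ₙₐ[ℂ] A) (σ : B →⋆ₙₐ[ℂ] A')
    (h : ∀ b, ‖σ b‖ ≤ ‖φ b‖) {𝓜 : NonUnitalStarSubalgebra ℂ A} {𝓡 : NonUnitalStarSubalgebra ℂ A'}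
    (h𝓜 : (𝓜 : Set A) = closure (Set.range φ)) (h𝓡 : (𝓡 : Set A') = closure (Set.range σ)) :
    (∀ b, φ b ∈ 𝓜) ∧ (∀ b, σ b ∈ 𝓡) ∧
    ∃ Λ : 𝓜 →⋆ₙₐ[ℂ] 𝓡, (∀ b (F : 𝓜) (S : 𝓡), F.1 = φ b → S.1 = σ b → Λ F = S) ∧
      (∀ Λ' : 𝓜 →⋆ₙₐ[ℂ] 𝓡, (∀ b (F : 𝓜) (S : 𝓡), F.1 = φ b → S.1 = σ b → Λ' F = S) → Λ' = Λ) ∧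
      ∀ (𝒮 : NonUnitalStarSubalgebra ℂ B) (P : Set 𝓜) (Q : Set 𝓡),
        P = {F | F.1 ∈ closure (φ '' 𝒮)} → Q = {S | S.1 ∈ closure (σ '' 𝒮)} →
        (∀ b ∈ 𝒮, ‖σ b‖ = ‖φ b‖) → Set.BijOn Λ P Q := by
  have hM : ∀ b, φ b ∈ 𝓜 := fun b => by
    rw [← SetLike.mem_coe, h𝓜]
    exact subset_closure ⟨b, rfl⟩
  have hR : ∀ b, σ b ∈ 𝓡 := fun b => by
    rw [← SetLike.mem_coe, h𝓡]
    exact subset_closure ⟨b, rfl⟩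
  refine ⟨hM, hR, ?_⟩
  have : IsClosed (𝓜 : Set A) := h𝓜 ▸ isClosed_closure
  have : IsClosed (𝓡 : Set A') := h𝓡 ▸ isClosed_closure
  let φ' : B →⋆ₙₐ[ℂ] 𝓜 := NonUnitalStarAlgHom.codRestrict φ 𝓜 hM
  let σ' : B →⋆ₙₐ[ℂ] 𝓡 := NonUnitalStarAlgHom.codRestrict σ 𝓡 hR
  have hd : DenseRange φ' := fun F => by
    rw [closure_subtype, ← Set.range_comp]
    exact h𝓜.subset F.2
  obtain ⟨Λ, hΛ⟩ := exists_starHom_extension (σ := σ') hd h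
  refine ⟨Λ, fun b F S hF hS => ?_, fun Λ' h' => ?_, fun 𝒮 P Q hP hQ h𝒮 => ?_⟩
  · obtain rfl : F = φ' b := Subtype.ext hF
    exact (hΛ b).trans (Subtype.ext hS.symm)
  · exact starHom_ext_of_denseRange hd fun b => (h' b (φ' b) (σ' b) rfl rfl).trans (hΛ b).symm
  · have e1 : {F : 𝓜 | F.1 ∈ closure (φ '' 𝒮)} = closure (φ' '' 𝒮) := by
      ext F
      rw [closure_subtype, Set.image_image]
      rfl
    have e2 : {S : 𝓡 | S.1 ∈ closure (σ '' 𝒮)} = closure (σ' '' 𝒮) := by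
      ext S
      rw [closure_subtype, Set.image_image]
      rfl
    rw [hP, hQ, e1, e2]
    exact bijOn_closure_image hΛ 𝒮 h𝒮

end Extension

/-! ### The maximal completion and the quotient map. -/

section Twisted

variable {X : Type u} {Y : Type v} {H : Type w} [MetricSpace X] [MetricSpace Y]
  [NormedAddCommGroup H] [InnerProductSpace ℝ H] [CompleteSpace H] [BoundedGeometry X]
  [BoundedGeometry Y] {p : X → Y} {f : Y → H}

theorem exists_isMaxImage (hp : UniformlyExpansive p) (hf : IsCoarseEmbedding f)
    (T : twistedAlg p f) : ∃ F : MaxAmbient.{max u w} (twistedAlg p f), IsMaxImage T F := by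
  obtain ⟨r, M, h⟩ := (isTwisted_of_mem hp hf T.2).exists_isBanded
  obtain ⟨C, -, hC⟩ := exists_norm_map_le hp hf r
  have hb : IsBanded r (max M 0) T.1 :=
    ⟨h.propagation, fun x y => (h.norm_le x y).trans (le_max_left _ _)⟩
  refine ⟨(⟨fun π => π.hom T, memℓp_infty ⟨C * max M 0, ?_⟩⟩ :
    lp (fun π : StarRep.{max u w} (twistedAlg p f) => π.K →L[ℂ] π.K) ∞), fun π => rfl⟩
  rintro _ ⟨π, rfl⟩
  exact hC π.hom T _ (le_max_right _ _) hb

theorem MaxAmbient.ext {B : Type v} [NonUnitalRing B] [StarRing B] [Module ℂ B]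
    {F G : MaxAmbient.{u} B} (h : ∀ π, F.val π = G.val π) : F = G :=
  lp.ext (funext h)

theorem IsMaxImage.unique {B : Type v} [NonUnitalRing B] [StarRing B] [Module ℂ B] {b : B}
    {F G : MaxAmbient.{u} B} (hF : IsMaxImage b F) (hG : IsMaxImage b G) : F = G :=
  MaxAmbient.ext fun π => (hF π).trans (hG π).symm

/-- The map of the algebraic twisted Roe algebra to its maximal completion. -/
def maxHom (hp : UniformlyExpansive p) (hf : IsCoarseEmbedding f) :
    twistedAlg p f →⋆ₙₐ[ℂ] MaxAmbient.{max u w} (twistedAlg p f) where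
  toFun T := (exists_isMaxImage hp hf T).choose
  map_smul' c T := IsMaxImage.unique (exists_isMaxImage hp hf (c • T)).choose_spec fun π =>
    (congrArg (c • ·) ((exists_isMaxImage hp hf T).choose_spec π)).trans (map_smul π.hom c T).symm
  map_zero' := IsMaxImage.unique (exists_isMaxImage hp hf 0).choose_spec fun π =>
    (map_zero π.hom).symm
  map_add' T S := IsMaxImage.unique (exists_isMaxImage hp hf (T + S)).choose_spec fun π =>
    (congrArg₂ (· + ·) ((exists_isMaxImage hp hf T).choose_spec π)
      ((exists_isMaxImage hp hf S).choose_spec π)).trans (map_add π.hom T S).symm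
  map_mul' T S := IsMaxImage.unique (exists_isMaxImage hp hf (T * S)).choose_spec fun π =>
    (congrArg₂ (· * ·) ((exists_isMaxImage hp hf T).choose_spec π)
      ((exists_isMaxImage hp hf S).choose_spec π)).trans (map_mul π.hom T S).symm
  map_star' T := IsMaxImage.unique (exists_isMaxImage hp hf (star T)).choose_spec fun π =>
    (congrArg star ((exists_isMaxImage hp hf T).choose_spec π)).trans (map_star π.hom T).symm

variable (hp : UniformlyExpansive p) (hf : IsCoarseEmbedding f)

theorem isMaxImage_maxHom (T : twistedAlg p f) : IsMaxImage T (maxHom hp hf T) :=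
  (exists_isMaxImage hp hf T).choose_spec

theorem norm_maxHom_le {T : twistedAlg p f} {C : ℝ} (hC : 0 ≤ C)
    (h : ∀ π : StarRep.{max u w} (twistedAlg p f), ‖π.hom T‖ ≤ C) : ‖maxHom hp hf T‖ ≤ C :=
  lp.norm_le_of_forall_le (E := fun π : StarRep.{max u w} (twistedAlg p f) => π.K →L[ℂ] π.K) hC
    fun π => (congrArg norm (isMaxImage_maxHom hp hf T π)).trans_le (h π)

theorem norm_le_norm_maxHom (T : twistedAlg p f) (π : StarRep.{max u w} (twistedAlg p f)) :
    ‖π.hom T‖ ≤ ‖maxHom hp hf T‖ :=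
  (congrArg norm (isMaxImage_maxHom hp hf T π)).symm.trans_le
    (lp.norm_apply_le_norm (E := fun π : StarRep.{max u w} (twistedAlg p f) => π.K →L[ℂ] π.K)
      ENNReal.top_ne_zero _ π)

/-- The induced representations live on spaces `ℓ²(X, K)` in the universe `max u w` and so are among
those which define the maximal norm. -/
theorem norm_redHom_le_norm_maxHom (T : twistedAlg p f) :
    ‖redHom hp hf T‖ ≤ ‖maxHom hp hf T‖ :=
  norm_redHom_le hp hf (norm_nonneg _) fun q ρ =>
    norm_le_norm_maxHom hp hf T ⟨_, l2Hom hp hf (AlgA.rep q ρ)⟩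

/-- The image of a subalgebra is already a subalgebra, so generating one before taking the closure
adds nothing. -/
theorem coe_maxClosure (𝒮 : NonUnitalStarSubalgebra ℂ (twistedAlg p f)) :
    (maxClosure (𝒮 : Set (twistedAlg p f)) : Set (MaxAmbient.{max u w} (twistedAlg p f))) =
      closure (maxHom hp hf '' 𝒮) := by
  have h : {F | ∃ b ∈ (𝒮 : Set (twistedAlg p f)), IsMaxImage b F} =
      (𝒮.map (maxHom hp hf) : Set (MaxAmbient.{max u w} (twistedAlg p f))) := by
    rw [NonUnitalStarSubalgebra.coe_map]
    ext F
    exact ⟨fun ⟨b, hb, hF⟩ => ⟨b, hb, (isMaxImage_maxHom hp hf b).unique hF⟩,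
      fun ⟨b, hb, hF⟩ => ⟨b, hb, hF ▸ isMaxImage_maxHom hp hf b⟩⟩
  rw [maxClosure, h, NonUnitalStarAlgebra.adjoin_eq, ← NonUnitalStarSubalgebra.coe_map]
  rfl

theorem coe_redClosure (𝒮 : NonUnitalStarSubalgebra ℂ (twistedAlg p f)) :
    (redClosure (𝒮 : Set (twistedAlg p f)) : Set (Adjointable X (AlgA (spanAll f)))) =
      closure (redHom hp hf '' 𝒮) := by
  have h : {S | ∃ T ∈ (𝒮 : Set (twistedAlg p f)),
      ActsAs (T : BandMatrix X (AlgA (spanAll f))) S} =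
      (𝒮.map (redHom hp hf) : Set (Adjointable X (AlgA (spanAll f)))) := by
    rw [NonUnitalStarSubalgebra.coe_map]
    ext F
    exact ⟨fun ⟨b, hb, hF⟩ => ⟨b, hb, (actsAs_redHom hp hf b).unique hF⟩,
      fun ⟨b, hb, hF⟩ => ⟨b, hb, hF ▸ actsAs_redHom hp hf b⟩⟩
  rw [redClosure, h, NonUnitalStarAlgebra.adjoin_eq, ← NonUnitalStarSubalgebra.coe_map]
  rfl

theorem coe_cuMax : (CuMax p f : Set (MaxAmbient.{max u w} (twistedAlg p f))) =
    closure (Set.range (maxHom hp hf)) := by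
  have h := coe_maxClosure hp hf ⊤
  rwa [NonUnitalStarAlgebra.coe_top, Set.image_univ] at h

theorem coe_cuRed : (CuRed p f : Set (Adjointable X (AlgA (spanAll f)))) =
    closure (Set.range (redHom hp hf)) := by
  have h := coe_redClosure hp hf ⊤
  rwa [NonUnitalStarAlgebra.coe_top, Set.image_univ] at h

theorem cuPhiOn_eq (O : Set (RPlus H)) :
    CuPhiOn p f O = {F | F.1 ∈ closure (maxHom hp hf '' twistedOnAlg p f O)} :=
  Set.ext fun F => Set.ext_iff.mp (coe_maxClosure hp hf (twistedOnAlg p f O)) F.1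

theorem cuRedOn_eq (O : Set (RPlus H)) :
    CuRedOn p f O = {S | S.1 ∈ closure (redHom hp hf '' twistedOnAlg p f O)} :=
  Set.ext fun S => Set.ext_iff.mp (coe_redClosure hp hf (twistedOnAlg p f O)) S.1

theorem isCanonicalQuotient_iff {Λ : CuMax p f →⋆ₙₐ[ℂ] CuRed p f} :
    IsCanonicalQuotient Λ ↔ ∀ T (F : CuMax p f) (S : CuRed p f),
      F.1 = maxHom hp hf T → S.1 = redHom hp hf T → Λ F = S := by
  refine ⟨fun h T F S hF hS => h T F S ?_ ?_, fun h T F S hF hS => h T F S ?_ ?_⟩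
  · rw [hF]
    exact isMaxImage_maxHom hp hf T
  · rw [hS]
    exact actsAs_redHom hp hf T
  · exact hF.unique (isMaxImage_maxHom hp hf T)
  · exact hS.unique (actsAs_redHom hp hf T)

end Twisted

end

theorem proposition3 {X Y H : Type*}
    [MetricSpace X] [MetricSpace Y] [BoundedGeometry X] [BoundedGeometry Y]
    [NormedAddCommGroup H] [InnerProductSpace ℝ H] [CompleteSpace H]
    (p : X → Y) (hp : UniformlyExpansive p)
    (hA : ∀ R : ℝ, 0 < R → EquiPropertyA fun y : Y => p ⁻¹' Metric.ball y R)
    (f : Y → H) (hf : IsCoarseEmbedding f)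
    {J : Type*} (r : ℝ) (hr : 0 < r) (O : J → Set (RPlus H)) (hO : IsSeparate p f r O) :
    (∀ T : twistedAlg p f, (∃ F : CuMax p f, IsMaxImage T F.1) ∧ ∃ S : CuRed p f, ActsAs T.1 S.1) ∧
    ∃ Λ : CuMax p f →⋆ₙₐ[ℂ] CuRed p f, IsCanonicalQuotient Λ ∧
      (∀ Λ' : CuMax p f →⋆ₙₐ[ℂ] CuRed p f, IsCanonicalQuotient Λ' → Λ' = Λ) ∧
      Set.BijOn Λ (CuPhiOn p f (⋃ i, O i)) (CuRedOn p f (⋃ i, O i)) := by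
  have main := exists_starHom_closure_range (maxHom hp hf) (redHom hp hf)
    (norm_redHom_le_norm_maxHom hp hf) (𝓜 := CuMax p f) (𝓡 := CuRed p f) (coe_cuMax hp hf)
    (coe_cuRed hp hf)
  refine ⟨fun T => ⟨⟨⟨_, main.1 T⟩, isMaxImage_maxHom hp hf T⟩, ⟨_, main.2.1 T⟩,
    actsAs_redHom hp hf T⟩, ?_⟩
  refine main.2.2.imp fun Λ h => ⟨(isCanonicalQuotient_iff hp hf).mpr h.1,
    fun Λ' h' => h.2.1 Λ' ((isCanonicalQuotient_iff hp hf).mp h'),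
    h.2.2 (twistedOnAlg p f (⋃ i, O i)) _ _ (cuPhiOn_eq hp hf _) (cuRedOn_eq hp hf _) fun T hT => ?_⟩
  -- One inequality holds for all twisted matrices; the other is where property A and separateness
  -- enter.
  exact le_antisymm (norm_redHom_le_norm_maxHom hp hf T) (norm_maxHom_le hp hf (norm_nonneg _) fun π =>
      norm_map_le_norm_redHom hp hf hA hr hO π.hom hT)
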